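/- **Conventions.** Vocabularies are many-sorted, with relation, function and constant symbols; structures have non-empty domains, and $|\mathcal A|$ counts the elements of all sorts. $\mathcal L^2$ is second-order logic with full semantics, $\mathcal L_{\omega\omega}$ is first-order logic, and formulas and structures are coded as sets in the usual way. $\mathrm{PwSt}(x,y)$ is the $\Pi_1$ predicate "$y=\wp(x)$", given by the formula $\forall z\,(z\in y\leftrightarrow\forall w\in z\;(w\in x))$. A class $\mathcal K$ of $\tau$-structures is $\underline\Sigma^{\mathrm B}(\mathcal L^*)$-axiomatisable if there is an $\mathcal L^*$-sentence $\phi$ in some vocabulary $\tau'\supseteq\tau$ (possibly with new sorts) such that $\mathcal K=\{\mathcal B{\upharpoonright}\tau:\mathcal B\models\phi\}$ and for every $\tau$-structure $\mathcal A$ there is a cardinal $\lambda_{\mathcal A}$ with $|\mathcal B|\le\lambda_{\mathcal A}$ whenever $\mathcal B\models\phi$ and $\mathcal B{\upharpoonright}\tau=\mathcal A$. It is $\underline\Delta^{\mathrm B}(\mathcal L^*)$-axiomatisable if both $\mathcal K$ and its complement in the class of $\tau$-structures are $\underline\Sigma^{\mathrm B}(\mathcal L^*)$-axiomatisable. A non-decreasing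 $F:\mathrm{Card}\to\mathrm{Card}$ is definably bounding if the class $\{(A,B):|B|\le F(|A|)\}$, in the vocabulary with two sorts and no symbols, is $\underline\Sigma^{\mathrm B}(\mathcal L_{\omega\omega})$-axiomatisable. The $\mathbf H$-rank is $\rho_{\mathbf H}(x)=\max(\aleph_0,|\mathrm{trcl}(x)|)$, and for a finite tuple it is the maximum of $\aleph_0$ and the $\mathbf H$-ranks of the entries. A relation $P(\vec x)$ on sets is $\Sigma_1^F(R)$ if there is a $\Delta_0(R)$-formula $\psi(\vec x,y)$ without parameters such that for all $\vec x$: $P(\vec x)\leftrightarrow\exists y\,\psi(\vec x,y)$, and if $P(\vec x)$ holds then $\psi(\vec x,y)$ for some $y$ with $\rho_{\mathbf H}(y)\le F(\rho_{\mathbf H}(\vec x))$. It is $\Delta_1^F(R)$ if both $P$ and its negation are $\Sigma_1^F(R)$. A logic $\mathcal L^*$ and a predicate $R$ are boundedly symbiotic if (1) the relation $\mathcal A\models_{\mathcal L^*}\phi$ between structures and sentences (of arbitrary vocabularies) is $\Delta_1^F(R)$ for some definably bounding $F$, and (2) for every definably bounding $F$ and every finite vocabulary $\tau$ (whose sorts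 and symbols are natural numbers), every $\Delta_1^F(R)$-definable class of $\tau$-structures that is closed under isomorphisms is $\underline\Delta^{\mathrm B}(\mathcal L^*)$-axiomatisable. A transitive set $M$ is $R$-correct if $(M,\in)\models R(\vec m)\leftrightarrow R(\vec m)$ for all tuples $\vec m$ from $M$. $\mathcal Q_R$ is the class of structures $(A,E)$ with one binary relation that are isomorphic to $(M,\in)$ for some non-empty transitive $R$-correct set $M$. **Proposition.** Full second-order logic $\mathcal L^2$ and the predicate $\mathrm{PwSt}$ are boundedly symbiotic. Moreover, the function $F(\alpha)=2^{2^\alpha}$ is definably bounding and the relation $\models_{\mathcal L^2}$ is $\Delta_1^F(\mathrm{PwSt})$ for this $F$; and $\mathcal Q_{\mathrm{PwSt}}$ is $\mathcal L^2$-axiomatisable, i.e. it is the class of all models of a single $\mathcal L^2$-sentence. -/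

import Mathlib

universe u

noncomputable section

namespace BddSymb

open Cardinal

/-! ## Set theory

The set-theoretic universe is `ZFSet.{u}`, and the cardinals of that universe are `Cardinal.{u}`. -/

/-- First-order formulas of the language `{∈}` of set theory with free variables `x₀, …, x_{n-1}`.
A quantifier binds the next variable `x_n`. -/
inductive SetForm : ℕ → Type
  | mem {n : ℕ} (i j : Fin n) : SetForm n
  | eq {n : ℕ} (i j : Fin n) : SetForm n
  | neg {n : ℕ} (φ : SetForm n) : SetForm n
  | and {n : ℕ} (φ ψ : SetForm n) : SetForm n
  | all {n : ℕ} (φ : SetForm (n + 1)) : SetForm n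

/-- The relativised satisfaction relation `(M, ∈) ⊨ φ(v)`, for a set or class `M`. -/
def SetForm.HoldsIn (M : Set ZFSet.{u}) : {n : ℕ} → SetForm n → (Fin n → ZFSet.{u}) → Prop
  | _, .mem i j, v => v i ∈ v j
  | _, .eq i j, v => v i = v j
  | _, .neg φ, v => ¬ φ.HoldsIn M v
  | _, .and φ ψ, v => φ.HoldsIn M v ∧ ψ.HoldsIn M v
  | _, .all φ, v => ∀ z ∈ M, φ.HoldsIn M (Fin.snoc (α := fun _ => ZFSet.{u}) v z)

/-- Truth in the universe. -/
def SetForm.Holds {n : ℕ} (φ : SetForm n) (v : Fin n → ZFSet.{u}) : Prop :=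
  φ.HoldsIn Set.univ v

def SetForm.imp {n : ℕ} (φ ψ : SetForm n) : SetForm n := .neg (.and φ (.neg ψ))

def SetForm.iff {n : ℕ} (φ ψ : SetForm n) : SetForm n := .and (φ.imp ψ) (ψ.imp φ)

/-- The predicate `PwSt(x₀, x₁)`, that is `x₁ = ℘(x₀)`, as the formula
`∀ z (z ∈ x₁ ↔ ∀ w (w ∈ z → w ∈ x₀))`. -/
def PwSt : SetForm 2 :=
  .all (SetForm.iff (.mem 2 1) (.all (SetForm.imp (.mem 3 2) (.mem 3 0))))

theorem PwSt_holdsIn (M : Set ZFSet.{u}) (v : Fin 2 → ZFSet.{u}) :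
    PwSt.HoldsIn M v ↔ ∀ z ∈ M, (z ∈ v 1 ↔ ∀ w ∈ M, w ∈ z → w ∈ v 0) := by
  have h3 : (3 : Fin 4) = Fin.last 3 := rfl
  have h2' : (2 : Fin 4) = Fin.castSucc (Fin.last 2) := rfl
  have h0' : (0 : Fin 4) = Fin.castSucc (Fin.castSucc 0) := rfl
  have h2 : (2 : Fin 3) = Fin.last 2 := rfl
  have h1 : (1 : Fin 3) = Fin.castSucc 1 := rfl
  simp only [PwSt, SetForm.iff, SetForm.imp, SetForm.HoldsIn]
  rw [h3, h2', h0', h2, h1]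
  simp only [Fin.snoc_last, Fin.snoc_castSucc]
  refine forall_congr' fun z => forall_congr' fun _ => ?_
  have h : ∀ p q : Prop, ¬(p ∧ ¬q) ↔ (p → q) := by intro p q; tauto
  simp only [h]
  tauto

theorem PwSt_holds (v : Fin 2 → ZFSet.{u}) : PwSt.Holds v ↔ v 1 = (v 0).powerset := by
  rw [SetForm.Holds, PwSt_holdsIn]
  simp only [Set.mem_univ, true_implies]
  constructor
  · intro h
    ext z
    rw [h z, ZFSet.mem_powerset]
    rfl
  · intro h z
    rw [h, ZFSet.mem_powerset]
    rfl

/-- `Δ₀(R)`-formulas with free variables `x₀, …, x_{n-1}`, for a `k`-ary predicate `R`: formulas of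
the language `{∈, R}` with bounded quantifiers only. `ball i φ` is `∀ x_n ∈ x_i, φ`. -/
inductive Delta0 (k : ℕ) : ℕ → Type
  | mem {n : ℕ} (i j : Fin n) : Delta0 k n
  | eq {n : ℕ} (i j : Fin n) : Delta0 k n
  | pred {n : ℕ} (i : Fin k → Fin n) : Delta0 k n
  | neg {n : ℕ} (φ : Delta0 k n) : Delta0 k n
  | and {n : ℕ} (φ ψ : Delta0 k n) : Delta0 k n
  | ball {n : ℕ} (i : Fin n) (φ : Delta0 k (n + 1)) : Delta0 k n

/-- Truth of a `Δ₀(R)`-formula in the universe. -/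
def Delta0.Holds {k : ℕ} (R : SetForm k) : {n : ℕ} → Delta0 k n → (Fin n → ZFSet.{u}) → Prop
  | _, .mem i j, v => v i ∈ v j
  | _, .eq i j, v => v i = v j
  | _, .pred i, v => R.Holds fun l => v (i l)
  | _, .neg φ, v => ¬ φ.Holds R v
  | _, .and φ ψ, v => φ.Holds R v ∧ ψ.Holds R v
  | _, .ball i φ, v => ∀ z ∈ v i, φ.Holds R (Fin.snoc (α := fun _ => ZFSet.{u}) v z)

/-- `H_κ`: the sets whose transitive closure (the least transitive set that includes them)
has fewer than `κ` elements. -/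
def HSet (κ : Cardinal.{u}) : Set ZFSet.{u} :=
  {x | ∃ t : ZFSet.{u}, t.IsTransitive ∧ x ⊆ t ∧ t.card < κ}

/-- The `H`-rank of `x`: the least infinite `κ` with `x ∈ H_{κ⁺}`. -/
def rhoH (x : ZFSet.{u}) : Cardinal.{u} :=
  sInf {κ | ℵ₀ ≤ κ ∧ x ∈ HSet (Order.succ κ)}

/-- The `H`-rank of a finite tuple. -/
def rhoTuple {n : ℕ} (x : Fin n → ZFSet.{u}) : Cardinal.{u} :=
  max ℵ₀ (⨆ i, rhoH (x i))

/-- `P` is `Σ₁^F(R)`-definable (without parameters). -/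
def IsSigma1 {k : ℕ} (R : SetForm k) (F : Cardinal.{u} → Cardinal.{u}) {n : ℕ}
    (P : (Fin n → ZFSet.{u}) → Prop) : Prop :=
  ∃ ψ : Delta0 k (n + 1),
    (∀ x, P x ↔ ∃ y, ψ.Holds R (Fin.snoc (α := fun _ => ZFSet.{u}) x y)) ∧
    (∀ x, P x → ∃ y, rhoH y ≤ F (rhoTuple x) ∧
      ψ.Holds R (Fin.snoc (α := fun _ => ZFSet.{u}) x y))

/-- `P` is `Δ₁^F(R)`-definable (without parameters). -/
def IsDelta1 {k : ℕ} (R : SetForm k) (F : Cardinal.{u} → Cardinal.{u}) {n : ℕ}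
    (P : (Fin n → ZFSet.{u}) → Prop) : Prop :=
  IsSigma1 R F P ∧ IsSigma1 R F fun x => ¬ P x

/-- The set `M` is `R`-correct: `(M, ∈) ⊨ R(m)` iff `R(m)`, for all tuples `m` from `M`. -/
def IsCorrect {k : ℕ} (R : SetForm k) (M : ZFSet.{u}) : Prop :=
  ∀ m : Fin k → ZFSet.{u}, (∀ i, m i ∈ M) → (R.HoldsIn {z | z ∈ M} m ↔ R.Holds m)

/-! ## Many-sorted vocabularies and structures -/

/-- A finite sequence of sorts. -/
structure Profile (S : Type u) where
  len : ℕ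
  sort : Fin len → S

def Profile.map {S T : Type u} (g : S → T) (p : Profile S) : Profile T := ⟨p.len, g ∘ p.sort⟩

/-- A many-sorted vocabulary. Constant symbols are function symbols without arguments. -/
structure Vocab where
  Srt : Type u
  Rel : Type u
  Fn : Type u
  relDom : Rel → Profile Srt
  fnDom : Fn → Profile Srt
  fnCod : Fn → Srt

/-- Tuples of elements of the sorts `p`, where `dom s` is the domain of sort `s`. -/
abbrev Tuple {S : Type u} (dom : S → ZFSet.{u}) (p : Profile S) : Type (u + 1) :=
  ∀ i : Fin p.len, {x : ZFSet.{u} // x ∈ dom (p.sort i)}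

/-- A `τ`-structure: for every sort a non-empty set, and interpretations of all symbols. -/
@[ext]
structure Str (τ : Vocab.{u}) where
  dom : τ.Srt → ZFSet.{u}
  dom_nonempty : ∀ s, (dom s).Nonempty
  rel : ∀ r : τ.Rel, Set (Tuple dom (τ.relDom r))
  fn : ∀ f : τ.Fn, Tuple dom (τ.fnDom f) → {x : ZFSet.{u} // x ∈ dom (τ.fnCod f)}

/-- The elements of sort `s`. -/
abbrev Str.El {τ : Vocab.{u}} (A : Str τ) (s : τ.Srt) : Type (u + 1) :=
  {x : ZFSet.{u} // x ∈ A.dom s}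

/-- The cardinality of a structure: all its sorts are counted. -/
def Str.card {τ : Vocab.{u}} (A : Str τ) : Cardinal.{u} := Cardinal.sum fun s => (A.dom s).card

structure Iso {τ : Vocab.{u}} (A B : Str τ) where
  map : ∀ s, A.El s ≃ B.El s
  map_rel : ∀ r t, t ∈ A.rel r ↔ (fun i => map _ (t i)) ∈ B.rel r
  map_fn : ∀ f t, map _ (A.fn f t) = B.fn f fun i => map _ (t i)

def ClosedUnderIso {τ : Vocab.{u}} (K : Str τ → Prop) : Prop :=
  ∀ A B : Str τ, Nonempty (Iso A B) → K A → K B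

/-- The symbols that are added to `τ` in an extended vocabulary: new sorts, and new relation and
function symbols, which may involve old and new sorts. -/
structure VocabExt (τ : Vocab.{u}) where
  Srt : Type u
  Rel : Type u
  Fn : Type u
  relDom : Rel → Profile (τ.Srt ⊕ Srt)
  fnDom : Fn → Profile (τ.Srt ⊕ Srt)
  fnCod : Fn → τ.Srt ⊕ Srt

/-- The extended vocabulary `τ' ⊇ τ`. -/
def VocabExt.vocab {τ : Vocab.{u}} (E : VocabExt τ) : Vocab.{u} where
  Srt := τ.Srt ⊕ E.Srt
  Rel := τ.Rel ⊕ E.Rel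
  Fn := τ.Fn ⊕ E.Fn
  relDom := Sum.elim (fun r => (τ.relDom r).map Sum.inl) E.relDom
  fnDom := Sum.elim (fun f => (τ.fnDom f).map Sum.inl) E.fnDom
  fnCod := Sum.elim (fun f => Sum.inl (τ.fnCod f)) E.fnCod

/-- The reduct `B ↾ τ`: the domains of the sorts of `τ` and the interpretations of the symbols
of `τ`. -/
def Str.reduct {τ : Vocab.{u}} {E : VocabExt τ} (B : Str E.vocab) : Str τ where
  dom s := B.dom (Sum.inl s)
  dom_nonempty s := B.dom_nonempty (Sum.inl s)
  rel r := B.rel (Sum.inl r)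
  fn f := B.fn (Sum.inl f)

/-! ## Vocabularies and structures as sets -/

/-- The natural number `n` as a von Neumann ordinal. -/
def natCode : ℕ → ZFSet.{u}
  | 0 => ∅
  | n + 1 => insert (natCode n) (natCode n)

/-- The finite sequence `(x₀, …, x_{n-1})` as the function `i ↦ x_i` on the ordinal `n`. -/
def seqCode {n : ℕ} (x : Fin n → ZFSet.{u}) : ZFSet.{u} :=
  ZFSet.range fun i : Fin n => ZFSet.pair (natCode i) (x i)

/-- The sets that serve as the sorts and symbols of `τ`: different sorts (relation symbols,
function symbols) are different sets. -/
structure Naming (τ : Vocab.{u}) where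
  srt : τ.Srt ↪ ZFSet.{u}
  rel : τ.Rel ↪ ZFSet.{u}
  fn : τ.Fn ↪ ZFSet.{u}

/-- All sorts and symbols are natural numbers. -/
def Naming.IsNatural {τ : Vocab.{u}} (ν : Naming τ) : Prop :=
  (∀ s, ∃ n, ν.srt s = natCode n) ∧ (∀ r, ∃ n, ν.rel r = natCode n) ∧
    ∀ f, ∃ n, ν.fn f = natCode n

def Naming.profile {τ : Vocab.{u}} (ν : Naming τ) (p : Profile τ.Srt) : ZFSet.{u} :=
  seqCode fun i => ν.srt (p.sort i)

/-- The vocabulary as a set: the set of its sorts, the function that maps every relation symbol to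
its sequence of sorts, and the function that maps every function symbol to its sequence of
argument sorts and its value sort. -/
def Naming.vocab {τ : Vocab.{u}} (ν : Naming τ) : ZFSet.{u} :=
  ZFSet.pair (ZFSet.range ν.srt)
    (ZFSet.pair (ZFSet.range fun r => ZFSet.pair (ν.rel r) (ν.profile (τ.relDom r)))
      (ZFSet.range fun f => ZFSet.pair (ν.fn f)
        (ZFSet.pair (ν.profile (τ.fnDom f)) (ν.srt (τ.fnCod f)))))

def tupleCode {S : Type u} {dom : S → ZFSet.{u}} {p : Profile S} (t : Tuple dom p) : ZFSet.{u} :=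
  seqCode fun i => (t i).1

/-- The structure as a set: its vocabulary, and the functions that map sorts to their domains,
relation symbols to sets of tuples and function symbols to graphs. -/
def Str.code {τ : Vocab.{u}} (ν : Naming τ) (A : Str τ) : ZFSet.{u} :=
  ZFSet.pair ν.vocab
    (ZFSet.pair (ZFSet.range fun s => ZFSet.pair (ν.srt s) (A.dom s))
      (ZFSet.pair
        (ZFSet.range fun r => ZFSet.pair (ν.rel r)
          (ZFSet.range fun t : {t // t ∈ A.rel r} => tupleCode t.1))
        (ZFSet.range fun f => ZFSet.pair (ν.fn f)
          (ZFSet.range fun t : Tuple A.dom (τ.fnDom f) =>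
            ZFSet.pair (tupleCode t) (A.fn f t).1))))

/-! ## Second-order and first-order logic -/

/-- Terms of sort `s`. Every sort has the variables `x_n^s`, `n = 0, 1, …`. -/
inductive Term (τ : Vocab.{u}) : τ.Srt → Type u
  | var (s : τ.Srt) (n : ℕ) : Term τ s
  | app (f : τ.Fn) (ts : ∀ i : Fin (τ.fnDom f).len, Term τ ((τ.fnDom f).sort i)) :
      Term τ (τ.fnCod f)

/-- Second-order formulas. Every profile `p` has the relation variables `X_n^p`, `n = 0, 1, …`. -/
inductive Form (τ : Vocab.{u}) : Type u
  | eq {s : τ.Srt} (t₁ t₂ : Term τ s) : Form τ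
  | rel (r : τ.Rel) (ts : ∀ i : Fin (τ.relDom r).len, Term τ ((τ.relDom r).sort i)) : Form τ
  | rvar (p : Profile τ.Srt) (n : ℕ) (ts : ∀ i : Fin p.len, Term τ (p.sort i)) : Form τ
  | neg (φ : Form τ) : Form τ
  | and (φ ψ : Form τ) : Form τ
  | all₁ (s : τ.Srt) (n : ℕ) (φ : Form τ) : Form τ
  | all₂ (p : Profile τ.Srt) (n : ℕ) (φ : Form τ) : Form τ

def Term.vars {τ : Vocab.{u}} : {s : τ.Srt} → Term τ s → Set (τ.Srt × ℕ)
  | _, .var s n => {(s, n)}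
  | _, .app _ ts => ⋃ i, (ts i).vars

/-- The free first-order variables. -/
def Form.free₁ {τ : Vocab.{u}} : Form τ → Set (τ.Srt × ℕ)
  | .eq t₁ t₂ => t₁.vars ∪ t₂.vars
  | .rel _ ts => ⋃ i, (ts i).vars
  | .rvar _ _ ts => ⋃ i, (ts i).vars
  | .neg φ => φ.free₁
  | .and φ ψ => φ.free₁ ∪ ψ.free₁
  | .all₁ s n φ => φ.free₁ \ {(s, n)}
  | .all₂ _ _ φ => φ.free₁

/-- The free second-order variables. -/
def Form.free₂ {τ : Vocab.{u}} : Form τ → Set (Profile τ.Srt × ℕ)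
  | .eq _ _ => ∅
  | .rel _ _ => ∅
  | .rvar p n _ => {(p, n)}
  | .neg φ => φ.free₂
  | .and φ ψ => φ.free₂ ∪ ψ.free₂
  | .all₁ _ _ φ => φ.free₂
  | .all₂ p n φ => φ.free₂ \ {(p, n)}

def Form.IsSentence {τ : Vocab.{u}} (φ : Form τ) : Prop := φ.free₁ = ∅ ∧ φ.free₂ = ∅

def Form.IsFirstOrder {τ : Vocab.{u}} : Form τ → Prop
  | .eq _ _ => True
  | .rel _ _ => True
  | .rvar _ _ _ => False
  | .neg φ => φ.IsFirstOrder
  | .and φ ψ => φ.IsFirstOrder ∧ ψ.IsFirstOrder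
  | .all₁ _ _ φ => φ.IsFirstOrder
  | .all₂ _ _ _ => False

def Term.eval {τ : Vocab.{u}} (A : Str τ) (v : ∀ x : τ.Srt × ℕ, A.El x.1) :
    {s : τ.Srt} → Term τ s → A.El s
  | _, .var s n => v (s, n)
  | _, .app f ts => A.fn f fun i => (ts i).eval A v

open Classical in
/-- Satisfaction with full second-order semantics: relation quantifiers range over all relations
of the given profile. -/
def Form.Realize {τ : Vocab.{u}} (A : Str τ) : Form τ → (∀ x : τ.Srt × ℕ, A.El x.1) →
    (∀ X : Profile τ.Srt × ℕ, Set (Tuple A.dom X.1)) → Prop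
  | .eq t₁ t₂, v, _ => t₁.eval A v = t₂.eval A v
  | .rel r ts, v, _ => (fun i => (ts i).eval A v) ∈ A.rel r
  | .rvar p n ts, v, V => (fun i => (ts i).eval A v) ∈ V (p, n)
  | .neg φ, v, V => ¬ φ.Realize A v V
  | .and φ ψ, v, V => φ.Realize A v V ∧ ψ.Realize A v V
  | .all₁ s n φ, v, V => ∀ a : A.El s, φ.Realize A (Function.update v (s, n) a) V
  | .all₂ p n φ, v, V => ∀ Z : Set (Tuple A.dom p), φ.Realize A v (Function.update V (p, n) Z)

/-- Truth of a sentence (the choice of the assignment does not matter). -/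
def Form.Truth {τ : Vocab.{u}} (A : Str τ) (φ : Form τ) : Prop := ∀ v V, φ.Realize A v V

/-- Terms as sets. -/
def Term.code {τ : Vocab.{u}} (ν : Naming τ) : {s : τ.Srt} → Term τ s → ZFSet.{u}
  | _, .var s n => ZFSet.pair (natCode 0) (ZFSet.pair (ν.srt s) (natCode n))
  | _, .app f ts =>
      ZFSet.pair (natCode 1) (ZFSet.pair (ν.fn f) (seqCode fun i => (ts i).code ν))

/-- Formulas as sets. -/
def Form.code {τ : Vocab.{u}} (ν : Naming τ) : Form τ → ZFSet.{u}
  | .eq t₁ t₂ => ZFSet.pair (natCode 0) (ZFSet.pair (t₁.code ν) (t₂.code ν))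
  | .rel r ts => ZFSet.pair (natCode 1) (ZFSet.pair (ν.rel r) (seqCode fun i => (ts i).code ν))
  | .rvar p n ts =>
      ZFSet.pair (natCode 2) (ZFSet.pair (ZFSet.pair (ν.profile p) (natCode n))
        (seqCode fun i => (ts i).code ν))
  | .neg φ => ZFSet.pair (natCode 3) (φ.code ν)
  | .and φ ψ => ZFSet.pair (natCode 4) (ZFSet.pair (φ.code ν) (ψ.code ν))
  | .all₁ s n φ =>
      ZFSet.pair (natCode 5) (ZFSet.pair (ZFSet.pair (ν.srt s) (natCode n)) (φ.code ν))
  | .all₂ p n φ =>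
      ZFSet.pair (natCode 6) (ZFSet.pair (ZFSet.pair (ν.profile p) (natCode n)) (φ.code ν))

/-- The data of a logic: its sentences in every vocabulary, their codes as sets and their truth in
structures. Only the two logics below are used. -/
structure Logic where
  Sent : Vocab.{u} → Type u
  code : ∀ {τ : Vocab.{u}}, Naming τ → Sent τ → ZFSet.{u}
  Sat : ∀ {τ : Vocab.{u}}, Str τ → Sent τ → Prop

/-- Full second-order logic `L²`. -/
def L2 : Logic.{u} where
  Sent τ := {φ : Form τ // φ.IsSentence}
  code ν φ := φ.1.code ν
  Sat A φ := φ.1.Truth A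

/-- First-order logic. -/
def FOL : Logic.{u} where
  Sent τ := {φ : Form τ // φ.IsSentence ∧ φ.IsFirstOrder}
  code ν φ := φ.1.code ν
  Sat A φ := φ.1.Truth A

/-! ## Axiomatisability and bounded symbiosis -/

def IsAxiomatisable (L : Logic.{u}) {τ : Vocab.{u}} (K : Str τ → Prop) : Prop :=
  ∃ φ : L.Sent τ, ∀ A, K A ↔ L.Sat A φ

/-- `K` is a bounded projection of the model class of an `L`-sentence in an extended
vocabulary. -/
def IsSigmaB (L : Logic.{u}) {τ : Vocab.{u}} (K : Str τ → Prop) : Prop :=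
  ∃ (E : VocabExt τ) (φ : L.Sent E.vocab),
    (∀ A, K A ↔ ∃ B : Str E.vocab, L.Sat B φ ∧ A = B.reduct) ∧
    ∀ A : Str τ, ∃ c : Cardinal.{u}, ∀ B : Str E.vocab, L.Sat B φ → A = B.reduct → B.card ≤ c

def IsDeltaB (L : Logic.{u}) {τ : Vocab.{u}} (K : Str τ → Prop) : Prop :=
  IsSigmaB L K ∧ IsSigmaB L fun A => ¬ K A

/-- The vocabulary with two sorts and no symbols. -/
def twoSorts : Vocab.{u} where
  Srt := ULift Bool
  Rel := PEmpty
  Fn := PEmpty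
  relDom := PEmpty.elim
  fnDom := PEmpty.elim
  fnCod := PEmpty.elim

/-- `F` is non-decreasing and the class of all `(A, B)` with `|B| ≤ F(|A|)` is a bounded projection
of a first-order model class. -/
def DefinablyBounding (F : Cardinal.{u} → Cardinal.{u}) : Prop :=
  Monotone F ∧ IsSigmaB FOL.{u} fun S : Str twoSorts.{u} =>
    (S.dom ⟨true⟩).card ≤ F (S.dom ⟨false⟩).card

/-- The satisfaction relation of `L` as a binary relation between sets: `x₀` is a structure (in any
vocabulary whatsoever), `x₁` is an `L`-sentence in its vocabulary, and it is true in `x₀`. -/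
def SatRel (L : Logic.{u}) (x : Fin 2 → ZFSet.{u}) : Prop :=
  ∃ (τ : Vocab.{u}) (ν : Naming τ) (A : Str τ) (φ : L.Sent τ),
    x 0 = A.code ν ∧ x 1 = L.code ν φ ∧ L.Sat A φ

/-- A class of `τ`-structures as a class of sets. -/
def ClassRel {τ : Vocab.{u}} (ν : Naming τ) (K : Str τ → Prop) (x : Fin 1 → ZFSet.{u}) : Prop :=
  ∃ A : Str τ, K A ∧ x 0 = A.code ν

def BoundedlySymbiotic (L : Logic.{u}) {k : ℕ} (R : SetForm k) : Prop :=
  (∃ F : Cardinal.{u} → Cardinal.{u}, DefinablyBounding F ∧ IsDelta1 R F (SatRel L)) ∧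
  ∀ F : Cardinal.{u} → Cardinal.{u}, DefinablyBounding F →
    ∀ τ : Vocab.{u}, Finite τ.Srt → Finite τ.Rel → Finite τ.Fn →
      ∀ ν : Naming τ, ν.IsNatural →
        ∀ K : Str τ → Prop, ClosedUnderIso K → IsDelta1 R F (ClassRel ν K) → IsDeltaB L K

/-- The vocabulary `{E}` with one sort and one binary relation symbol. -/
def binVocab : Vocab.{u} where
  Srt := PUnit
  Rel := PUnit
  Fn := PEmpty
  relDom _ := ⟨2, fun _ => PUnit.unit⟩
  fnDom := PEmpty.elim
  fnCod := PEmpty.elim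

/-- The structure `(M, ∈)`. -/
def memStr (M : ZFSet.{u}) (hM : M.Nonempty) : Str binVocab.{u} where
  dom _ := M
  dom_nonempty _ := hM
  rel _ := {t | (t (0 : Fin 2)).1 ∈ (t (1 : Fin 2)).1}
  fn f := f.elim

/-- The class `Q_R` of structures that are isomorphic to a transitive `R`-correct `∈`-model. -/
def QClass {k : ℕ} (R : SetForm k) (A : Str binVocab.{u}) : Prop :=
  ∃ (M : ZFSet.{u}) (hM : M.Nonempty), M.IsTransitive ∧ IsCorrect R M ∧
    Nonempty (Iso A (memStr M hM))

end BddSymb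

end

set_option linter.unusedVariables false

noncomputable section

namespace BddSymb

open Cardinal

/-! ## Codes -/

/-! Satisfaction. Let T be a transitive set that contains ∅ and is closed under adjunction `a, b ↦ b
∪ {a}`. If T contains the code of a structure, it contains the codes of all its terms, formulas and
tuples. Assignments can then be coded as subsets of T, and a candidate truth relation, which relates
formulas with a truth value to assignments, as a subset of ℘(T). A sentence is true exactly if every
candidate closed under Tarski's clauses declares it true under the empty assignment (`sat_iff`).
Being the code of a structure is expressible over T as well (`satIn_iff`). So satisfaction is given
by one formula with quantifiers bounded by T, ℘(T) and ℘(℘(T)), and the answer does not depend on T.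
Hence satisfaction and its negation are both Σ₁, with witness ℘(℘(T)) (`isSigma1_of_D3`). Arguments
of H-rank κ lie in some such T of size at most κ (`exists_adjClosed`), which is where 2^(2^κ) comes
from. This function is definably bounding: two extensionality axioms embed a new sort P into ℘(A),
and B into ℘(P).

Correct models. By the Mostowski collapse, a set with a binary relation is a copy of a transitive
∈-model exactly if the relation is well-founded and extensional. The model is correct for `PwSt`
exactly if, whenever it takes b for the power set of a, every subset of the extension of a is the
extension of an element. These conditions are second-order (`qClass_iff`), and they make
Δ₀(`PwSt`)-formulas absolute (`IsCollapse.holdsE_iff`).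

From Δ₁^F to Δ^B. Suppose that membership of a code x in a class is given by ∃ y ψ(x, y) with the
witness bounded through F. Over a structure A, a second-order sentence describes a well-founded
correct model M with constants for a code x of a copy of A and for a y with ψ(x, y), and with maps
that decode the domains of x onto the sorts of A. To bound such expansions, sorts U and W are added
together with the first-order sentence that defines F, so that |W| ≤ F(|U|). Moreover U injects into
ω and the coded domains, and an element of M is determined by its traces on U and W. So |M| ≤
2^(|U|+|W|), and everything is bounded in terms of A (`exists_bound_of_codeAx`). Conversely, if A is
moved to initial ordinals, its code has H-rank at most the size of the set s of natural numbers and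
elements of these ordinals. With U = s, the power set of a union of two transitive sets, of sizes at
most |U| and F(|U|), can serve as M (`exists_codeAx_model`). The same argument applies to the
complement of the class. -/

theorem mem_natCode {z : ZFSet.{u}} {n : ℕ} : z ∈ natCode n ↔ ∃ i < n, z = natCode i := by
  induction n with
  | zero => simp [natCode]
  | succ n ih =>
    rw [natCode, ZFSet.mem_insert_iff, ih]
    constructor
    · rintro (rfl | ⟨i, hi, rfl⟩)
      · exact ⟨n, by omega, rfl⟩
      · exact ⟨i, by omega, rfl⟩
    · rintro ⟨i, hi, rfl⟩
      rcases Nat.lt_succ_iff_lt_or_eq.1 hi with h | rfl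
      · exact Or.inr ⟨i, h, rfl⟩
      · exact Or.inl rfl

theorem natCode_injective : Function.Injective natCode.{u} := by
  have key : ∀ m n : ℕ, m < n → natCode.{u} m ≠ natCode n := by
    intro m n h e
    have : natCode.{u} m ∈ natCode.{u} n := mem_natCode.2 ⟨m, h, rfl⟩
    rw [e] at this
    exact ZFSet.mem_irrefl _ this
  intro m n e
  rcases lt_trichotomy m n with h | h | h
  · exact (key _ _ h e).elim
  · exact h
  · exact (key _ _ h e.symm).elim

@[simp] theorem natCode_inj {m n : ℕ} : natCode.{u} m = natCode n ↔ m = n :=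
  natCode_injective.eq_iff

theorem mem_seqCode {n : ℕ} {x : Fin n → ZFSet.{u}} {z : ZFSet.{u}} :
    z ∈ seqCode x ↔ ∃ i : Fin n, z = ZFSet.pair (natCode i) (x i) := by
  simp [seqCode, eq_comm]

theorem pair_mem_seqCode {n : ℕ} {x : Fin n → ZFSet.{u}} {a b : ZFSet.{u}} :
    ZFSet.pair a b ∈ seqCode x ↔ ∃ i : Fin n, a = natCode i ∧ b = x i := by
  simp [mem_seqCode, ZFSet.pair_inj]

theorem seqCode_len {n m : ℕ} {x : Fin n → ZFSet.{u}} {y : Fin m → ZFSet.{u}}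
    (h : seqCode x = seqCode y) : n = m := by
  have key : ∀ {n m : ℕ} {x : Fin n → ZFSet.{u}} {y : Fin m → ZFSet.{u}},
      seqCode x = seqCode y → ¬ n < m := by
    intro n m x y h hlt
    have h1 : ZFSet.pair (natCode n) (y ⟨n, hlt⟩) ∈ seqCode y :=
      pair_mem_seqCode.2 ⟨⟨n, hlt⟩, rfl, rfl⟩
    rw [← h] at h1
    obtain ⟨i, hi, -⟩ := pair_mem_seqCode.1 h1
    have := natCode_injective hi
    omega
  exact le_antisymm (not_lt.1 (key h.symm)) (not_lt.1 (key h))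

theorem seqCode_inj {n : ℕ} {x y : Fin n → ZFSet.{u}} : seqCode x = seqCode y ↔ x = y := by
  refine ⟨fun h => funext fun i => ?_, fun h => h ▸ rfl⟩
  have h1 : ZFSet.pair (natCode i) (x i) ∈ seqCode x := pair_mem_seqCode.2 ⟨i, rfl, rfl⟩
  rw [h] at h1
  obtain ⟨j, hj, h2⟩ := pair_mem_seqCode.1 h1
  have : i = j := Fin.ext (natCode_injective hj)
  rw [h2, this]

theorem tupleCode_inj {S : Type u} {dom : S → ZFSet.{u}} {p : Profile S} {t t' : Tuple dom p} :
    tupleCode t = tupleCode t' ↔ t = t' := by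
  unfold tupleCode
  rw [seqCode_inj]
  refine ⟨fun h => funext fun i => Subtype.ext (congrFun h i), fun h => h ▸ rfl⟩

/-! ## Definability by `Δ₀(PwSt)`-formulas -/

theorem snoc_eta {n : ℕ} (w : Fin (n + 1) → ZFSet.{u}) :
    Fin.snoc (α := fun _ => ZFSet.{u}) (fun j => w j.castSucc) (w (Fin.last n)) = w :=
  Fin.snoc_init_self w

def Delta0.rename {k : ℕ} : {n : ℕ} → Delta0 k n → {m : ℕ} → (Fin n → Fin m) → Delta0 k m
  | _, .mem i j, _, σ => .mem (σ i) (σ j)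
  | _, .eq i j, _, σ => .eq (σ i) (σ j)
  | _, .pred i, _, σ => .pred fun l => σ (i l)
  | _, .neg φ, _, σ => .neg (φ.rename σ)
  | _, .and φ ψ, _, σ => .and (φ.rename σ) (ψ.rename σ)
  | _, .ball i φ, m, σ =>
    .ball (σ i) (φ.rename (Fin.snoc (α := fun _ => Fin (m + 1)) (fun j => (σ j).castSucc)
      (Fin.last m)))

theorem Delta0.holds_rename {k : ℕ} (R : SetForm k) {n : ℕ} (φ : Delta0 k n) {m : ℕ}
    (σ : Fin n → Fin m) (v : Fin m → ZFSet.{u}) :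
    (φ.rename σ).Holds R v ↔ φ.Holds R fun j => v (σ j) := by
  induction φ generalizing m with
  | mem | eq | pred => rfl
  | neg φ ih => simp only [rename, Holds, ih]
  | and φ ψ ih1 ih2 => simp only [rename, Holds, ih1, ih2]
  | ball i φ ih =>
    simp only [rename, Holds, ih]
    refine forall_congr' fun z => forall_congr' fun _ => ?_
    have : (fun j => Fin.snoc (α := fun _ => ZFSet.{u}) v z
        (Fin.snoc (α := fun _ => Fin (m + 1)) (fun j => (σ j).castSucc) (Fin.last m) j)) =
        Fin.snoc (α := fun _ => ZFSet.{u}) (fun j => v (σ j)) z := by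
      funext j
      refine Fin.lastCases ?_ (fun j => ?_) j <;> simp
    rw [this]

/-- `P` is defined by a `Δ₀(PwSt)`-formula. -/
class D0 {n : ℕ} (P : (Fin n → ZFSet.{u}) → Prop) : Prop where
  out : ∃ ψ : Delta0 2 n, ∀ w, ψ.Holds PwSt w ↔ P w

namespace D0

variable {n m : ℕ}

section

variable {P Q : (Fin n → ZFSet.{u}) → Prop}

theorem congr (hP : D0 P) (h : ∀ w, P w ↔ Q w) : D0 Q := by
  obtain ⟨ψ, hψ⟩ := hP.out
  exact ⟨ψ, fun w => (hψ w).trans (h w)⟩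

theorem comp (hP : D0 P) (σ : Fin n → Fin m) : D0 fun w : Fin m → ZFSet.{u} => P fun j => w (σ j) := by
  obtain ⟨ψ, hψ⟩ := hP.out
  exact ⟨ψ.rename σ, fun w => by rw [Delta0.holds_rename, hψ]⟩

instance mem (i j : Fin n) : D0 fun w : Fin n → ZFSet.{u} => w i ∈ w j :=
  ⟨.mem i j, fun _ => Iff.rfl⟩

instance eq (i j : Fin n) : D0 fun w : Fin n → ZFSet.{u} => w i = w j :=
  ⟨.eq i j, fun _ => Iff.rfl⟩

instance eq_powerset (i j : Fin n) : D0 fun w : Fin n → ZFSet.{u} => w i = (w j).powerset :=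
  ⟨.pred ![j, i], fun w => by simp only [Delta0.Holds, PwSt_holds]; rfl⟩

instance not [hP : D0 P] : D0 fun w => ¬ P w := by
  obtain ⟨ψ, hψ⟩ := hP.out
  exact ⟨.neg ψ, fun w => by simp only [Delta0.Holds, hψ]⟩

instance and [hP : D0 P] [hQ : D0 Q] : D0 fun w => P w ∧ Q w := by
  obtain ⟨ψ, hψ⟩ := hP.out
  obtain ⟨χ, hχ⟩ := hQ.out
  exact ⟨.and ψ χ, fun w => by simp only [Delta0.Holds, hψ, hχ]⟩

instance or [hP : D0 P] [hQ : D0 Q] : D0 fun w => P w ∨ Q w :=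
  (inferInstance : (D0 fun w => ¬ (¬ P w ∧ ¬ Q w))).congr fun w => by tauto

end

/-- The quantifier instances take a predicate of a tuple and a bound element, so instance search can
follow a formula written in ordinary notation. A definability proof then reduces to finding an
equivalent formula with bounded quantifiers. -/
instance ball (i : Fin n) {P : (Fin n → ZFSet.{u}) → ZFSet.{u} → Prop}
    [hP : D0 fun w : Fin (n + 1) → ZFSet.{u} => P (fun j => w j.castSucc) (w (Fin.last n))] :
    D0 fun w => ∀ z, z ∈ w i → P w z := by
  obtain ⟨ψ, hψ⟩ := hP.out
  exact ⟨.ball i ψ, fun w => by simp only [Delta0.Holds, hψ, Fin.snoc_castSucc, Fin.snoc_last]⟩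

instance bex (i : Fin n) {P : (Fin n → ZFSet.{u}) → ZFSet.{u} → Prop}
    [hP : D0 fun w : Fin (n + 1) → ZFSet.{u} => P (fun j => w j.castSucc) (w (Fin.last n))] :
    D0 fun w => ∃ z, z ∈ w i ∧ P w z :=
  (inferInstance : (D0 fun w => ¬ ∀ z, z ∈ w i → ¬ P w z)).congr fun w => by
    simp only [not_forall, not_not, exists_prop]

/-- There are no formulas at all without a variable, hence the index `i`. -/
theorem false (i : Fin n) : D0 fun _ : Fin n → ZFSet.{u} => False :=
  (inferInstance : (D0 fun w : Fin n → ZFSet.{u} => ¬ w i = w i)).congr fun w => by simp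

theorem finite_forall (i : Fin n) {ι : Type*} [Finite ι] {P : ι → (Fin n → ZFSet.{u}) → Prop}
    (h : ∀ k, D0 (P k)) : D0 fun w => ∀ k, P k w := by
  have := Fintype.ofFinite ι
  suffices H : ∀ s : Finset ι, D0 fun w => ∀ k ∈ s, P k w from
    (H Finset.univ).congr fun w => by simp
  classical
  intro s
  induction s using Finset.induction_on with
  | empty => exact (inferInstance : (D0 fun w : Fin n → ZFSet.{u} => w i = w i)).congr fun w => by simp
  | insert a s _ ih =>
    have := h a
    exact (inferInstance : (D0 fun w => P a w ∧ ∀ k ∈ s, P k w)).congr fun w => by simp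

theorem finite_exists (i : Fin n) {ι : Type*} [Finite ι] {P : ι → (Fin n → ZFSet.{u}) → Prop}
    (h : ∀ k, D0 (P k)) : D0 fun w => ∃ k, P k w := by
  have h2 : D0 fun w => ∀ k, ¬ P k w := finite_forall i fun k => by have := h k; infer_instance
  exact (inferInstance : (D0 fun w => ¬ ∀ k, ¬ P k w)).congr fun w => by simp

instance eq_empty (i : Fin n) : D0 fun w : Fin n → ZFSet.{u} => w i = ∅ := by
  have := D0.false.{u} (Fin.last n)
  exact (inferInstance : (D0 fun w : Fin n → ZFSet.{u} => ∀ z, z ∈ w i → False)).congr fun w => by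
    rw [ZFSet.eq_empty]

instance eq_insert (i j k : Fin n) :
    D0 fun w : Fin n → ZFSet.{u} => w i = insert (w j) (w k) :=
  (inferInstance : (D0 fun w : Fin n → ZFSet.{u} =>
    (∀ z, z ∈ w i → z = w j ∨ z ∈ w k) ∧ w j ∈ w i ∧ ∀ z, z ∈ w k → z ∈ w i)).congr fun w => by
    constructor
    · rintro ⟨h1, h2, h3⟩
      ext z
      rw [ZFSet.mem_insert_iff]
      exact ⟨h1 z, fun h => h.elim (fun h => h ▸ h2) (h3 z)⟩
    · intro h
      simp only [h, ZFSet.mem_insert_iff]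
      tauto

instance eq_unordered (i j k : Fin n) :
    D0 fun w : Fin n → ZFSet.{u} => w i = {w j, w k} :=
  (inferInstance : (D0 fun w : Fin n → ZFSet.{u} =>
    (∀ z, z ∈ w i → z = w j ∨ z = w k) ∧ w j ∈ w i ∧ w k ∈ w i)).congr fun w => by
    constructor
    · rintro ⟨h1, h2, h3⟩
      ext z
      rw [ZFSet.mem_pair]
      exact ⟨h1 z, fun h => h.elim (fun h => h ▸ h2) fun h => h ▸ h3⟩
    · intro h
      simp only [h, ZFSet.mem_pair]
      tauto

instance eq_pair (i j k : Fin n) :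
    D0 fun w : Fin n → ZFSet.{u} => w i = ZFSet.pair (w j) (w k) :=
  (inferInstance : (D0 fun w : Fin n → ZFSet.{u} =>
    (∀ z, z ∈ w i → z = {w j, w j} ∨ z = {w j, w k}) ∧ (∃ z, z ∈ w i ∧ z = {w j, w j}) ∧
      ∃ z, z ∈ w i ∧ z = {w j, w k})).congr fun w => by
    simp only [ZFSet.pair_eq_singleton]
    constructor
    · rintro ⟨h1, ⟨_, h2, rfl⟩, ⟨_, h3, rfl⟩⟩
      ext z
      rw [ZFSet.pair, ZFSet.mem_pair]
      exact ⟨h1 z, fun h => h.elim (fun h => h ▸ h2) fun h => h ▸ h3⟩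
    · intro h
      simp only [h, ZFSet.pair, ZFSet.mem_pair]
      refine ⟨fun z => id, ⟨_, Or.inl rfl, rfl⟩, ⟨_, Or.inr rfl, rfl⟩⟩

instance eq_natCode (i : Fin n) (k : ℕ) : D0 fun w : Fin n → ZFSet.{u} => w i = natCode k := by
  induction k generalizing n with
  | zero => exact eq_empty i
  | succ k ih =>
    have := ih (Fin.last n)
    exact (inferInstance : (D0 fun w : Fin n → ZFSet.{u} =>
      ∃ z, z ∈ w i ∧ (z = natCode k ∧ w i = insert z z))).congr fun w => by
      simp only [natCode]
      constructor
      · rintro ⟨z, _, rfl, h⟩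
        exact h
      · intro h
        exact ⟨_, h ▸ ZFSet.mem_insert _ _, rfl, h⟩

end D0

/-- The graph of `f` is defined by a `Δ₀(PwSt)`-formula. -/
class D0Fun {n : ℕ} (f : (Fin n → ZFSet.{u}) → ZFSet.{u}) : Prop where
  out : D0 fun w : Fin (n + 1) → ZFSet.{u} => w (Fin.last n) = f fun j => w j.castSucc

namespace D0Fun

variable {n m : ℕ} {f g : (Fin n → ZFSet.{u}) → ZFSet.{u}}

theorem eq_comp (hf : D0Fun f) (σ : Fin n → Fin m) (i : Fin m) :
    D0 fun w : Fin m → ZFSet.{u} => w i = f fun j => w (σ j) :=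
  (hf.out.comp (Fin.snoc (α := fun _ => Fin m) σ i)).congr fun w => by simp

theorem eq_var (hf : D0Fun f) (i : Fin n) : D0 fun w : Fin n → ZFSet.{u} => w i = f w :=
  hf.eq_comp id i

theorem of_eq (i : Fin n) : D0Fun fun w : Fin n → ZFSet.{u} => w i := ⟨D0.eq _ _⟩

theorem natCode (k : ℕ) : D0Fun fun _ : Fin n → ZFSet.{u} => natCode k := ⟨D0.eq_natCode _ _⟩

/-- Both components lie two membership steps below the pair, so the values of `f` and `g` can be
found by bounded quantifiers inside the pair itself. -/
theorem pair (hf : D0Fun f) (hg : D0Fun g) :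
    D0Fun fun w : Fin n → ZFSet.{u} => ZFSet.pair (f w) (g w) := by
  constructor
  have h1 := hf.eq_comp (m := n + 5) (fun j => j.castSucc.castSucc.castSucc.castSucc.castSucc)
    (Fin.last (n + 2)).castSucc.castSucc
  have h2 := hg.eq_comp (m := n + 5) (fun j => j.castSucc.castSucc.castSucc.castSucc.castSucc)
    (Fin.last (n + 4))
  refine (inferInstance : (D0 fun w : Fin (n + 1) → ZFSet.{u} =>
    ∃ s, s ∈ w (Fin.last n) ∧ ∃ a, a ∈ s ∧ ∃ t, t ∈ w (Fin.last n) ∧ ∃ b, b ∈ t ∧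
      (a = f (fun j => w j.castSucc) ∧ b = g (fun j => w j.castSucc) ∧
        w (Fin.last n) = ZFSet.pair a b))).congr fun w => ?_
  constructor
  · rintro ⟨s, hs, a, ha, t, ht, b, hb, rfl, rfl, h⟩
    exact h
  · intro h
    refine ⟨{f fun j => w j.castSucc}, ?_, _, ?_, {f fun j => w j.castSucc, g fun j => w j.castSucc},
      ?_, _, ?_, rfl, rfl, h⟩
    · rw [h]; simp [ZFSet.pair]
    · simp
    · rw [h]; simp [ZFSet.pair]
    · simp

theorem range {ι : Type*} [Finite ι] {f : ι → (Fin n → ZFSet.{u}) → ZFSet.{u}}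
    (hf : ∀ k, D0Fun (f k)) : D0Fun fun w : Fin n → ZFSet.{u} => ZFSet.range fun k => f k w := by
  constructor
  have h (k : ι) := (hf k).eq_comp (m := n + 2) (fun j => j.castSucc.castSucc) (Fin.last (n + 1))
  have h1 := D0.finite_exists (Fin.last _) h
  have h2 := D0.finite_forall (Fin.last n) fun k =>
    (inferInstance : (D0 fun w : Fin (n + 1) → ZFSet.{u} => ∃ z, z ∈ w (Fin.last n) ∧
      z = f k (fun j => w j.castSucc)))
  refine (inferInstance : (D0 fun w : Fin (n + 1) → ZFSet.{u} =>
    (∀ z, z ∈ w (Fin.last n) → ∃ k, z = f k fun j => w j.castSucc) ∧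
    ∀ k, ∃ z, z ∈ w (Fin.last n) ∧ z = f k (fun j => w j.castSucc))).congr fun w => ?_
  constructor
  · rintro ⟨h1, h2⟩
    ext z
    rw [ZFSet.mem_range]
    constructor
    · intro hz
      obtain ⟨k, rfl⟩ := h1 z hz
      exact ⟨k, rfl⟩
    · rintro ⟨k, rfl⟩
      obtain ⟨z, hz, rfl⟩ := h2 k
      exact hz
  · intro h
    simp only [h, ZFSet.mem_range]
    refine ⟨?_, fun k => ⟨_, ⟨k, rfl⟩, rfl⟩⟩
    rintro z ⟨k, rfl⟩
    exact ⟨k, rfl⟩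

theorem seqCode {k : ℕ} {f : Fin k → (Fin n → ZFSet.{u}) → ZFSet.{u}} (hf : ∀ k, D0Fun (f k)) :
    D0Fun fun w : Fin n → ZFSet.{u} => seqCode fun i => f i w :=
  range fun i => (natCode i).pair (hf i)

end D0Fun

end BddSymb

namespace BddSymb

open Cardinal

/-! ## Third-order definability over sets closed under adjunction -/

/-- A transitive set that contains `∅` and is closed under `a, b ↦ b ∪ {a}`. -/
structure AdjClosed : Type (u + 1) where
  set : ZFSet.{u}
  trans : set.IsTransitive
  empty_mem : ∅ ∈ set
  insert_mem : ∀ {a b}, a ∈ set → b ∈ set → insert a b ∈ set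

namespace AdjClosed

variable (T : AdjClosed.{u})

abbrev El : Type (u + 1) := {x : ZFSet.{u} // x ∈ T.set}

theorem pair_mem {a b : ZFSet.{u}} (ha : a ∈ T.set) (hb : b ∈ T.set) : ZFSet.pair a b ∈ T.set := by
  have hs {x} (hx : x ∈ T.set) : ({x} : ZFSet) ∈ T.set := by
    rw [← ZFSet.pair_eq_singleton, ZFSet.insert_eq]
    have := T.insert_mem hx T.empty_mem
    have h2 : insert x (∅ : ZFSet) = {x} := by ext; simp
    rw [h2] at this
    convert this using 1
    ext; simp
  exact T.insert_mem (hs ha) (hs (T.insert_mem ha (hs hb)))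

theorem mem_of_pair {a b : ZFSet.{u}} (h : ZFSet.pair a b ∈ T.set) : a ∈ T.set ∧ b ∈ T.set := by
  have h2 : ({a, b} : ZFSet) ∈ T.set := T.trans _ h (by simp [ZFSet.pair])
  exact ⟨T.trans _ h2 (by simp), T.trans _ h2 (by simp)⟩

theorem natCode_mem (n : ℕ) : natCode n ∈ T.set := by
  induction n with
  | zero => exact T.empty_mem
  | succ n ih => exact T.insert_mem ih ih

theorem finite_range_mem {ι : Type*} [Finite ι] [Small.{u} ι] {f : ι → ZFSet.{u}}
    (h : ∀ i, f i ∈ T.set) : ZFSet.range f ∈ T.set := by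
  classical
  have := Fintype.ofFinite ι
  suffices H : ∀ s : Finset ι, ∃ z ∈ T.set, ∀ y, y ∈ z ↔ ∃ i ∈ s, f i = y by
    obtain ⟨z, hz, h2⟩ := H Finset.univ
    convert hz using 1
    ext y
    simp [h2]
  intro s
  induction s using Finset.induction_on with
  | empty => exact ⟨∅, T.empty_mem, by simp⟩
  | insert a s _ ih =>
    obtain ⟨z, hz, h2⟩ := ih
    refine ⟨insert (f a) z, T.insert_mem (h a) hz, fun y => ?_⟩
    simp [h2, eq_comm]

theorem seqCode_mem {n : ℕ} {x : Fin n → ZFSet.{u}} (h : ∀ i, x i ∈ T.set) :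
    seqCode x ∈ T.set :=
  T.finite_range_mem fun i => T.pair_mem (T.natCode_mem _) (h i)

variable {T}

def pr (a b : T.El) : T.El := ⟨ZFSet.pair a.1 b.1, T.pair_mem a.2 b.2⟩

def nt (n : ℕ) : T.El := ⟨natCode n, T.natCode_mem n⟩

def sq {n : ℕ} (x : Fin n → T.El) : T.El := ⟨seqCode fun i => (x i).1, T.seqCode_mem fun i => (x i).2⟩

@[simp] theorem pr_val (a b : T.El) : (pr a b).1 = ZFSet.pair a.1 b.1 := rfl

@[simp] theorem nt_val (n : ℕ) : (nt n : T.El).1 = natCode n := rfl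

@[simp] theorem sq_val {n : ℕ} (x : Fin n → T.El) : (sq x).1 = seqCode fun i => (x i).1 := rfl

@[simp] theorem pr_inj {a b c d : T.El} : pr a b = pr c d ↔ a = c ∧ b = d := by
  rw [Subtype.ext_iff, pr_val, pr_val, ZFSet.pair_inj, ← Subtype.ext_iff, ← Subtype.ext_iff]

@[simp] theorem nt_inj {m n : ℕ} : (nt m : T.El) = nt n ↔ m = n := by
  rw [Subtype.ext_iff, nt_val, nt_val, natCode_inj]

/-- The point of `℘(T)` that codes the pair of an element and a subset of `T`. -/
def ptSet (k : T.El) (X : Set T.El) : Set T.El :=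
  {e | e = pr (nt 0) k ∨ ∃ a, a ∈ X ∧ e = pr (nt 1) a}

theorem ptSet_inj {k l : T.El} {X Y : Set T.El} : ptSet k X = ptSet l Y ↔ k = l ∧ X = Y := by
  refine ⟨fun h => ?_, by rintro ⟨rfl, rfl⟩; rfl⟩
  have hs : ∀ e, e ∈ ptSet k X ↔ e ∈ ptSet l Y := fun e => by rw [h]
  constructor
  · simpa [ptSet] using hs (pr (nt 0) k)
  · ext a
    simpa [ptSet, -Subtype.exists] using hs (pr (nt 1) a)

variable (T)

/-- The default value makes decoding total, so a set variable can be read as an element, a subset or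
a relation over T without side conditions. Every such object is decoded from a member of T, ℘(T) or
℘(℘(T)) respectively, which turns quantifiers over these objects into bounded ones. -/
def toEl (z : ZFSet.{u}) : T.El := open Classical in if h : z ∈ T.set then ⟨z, h⟩ else ⟨∅, T.empty_mem⟩

def toSet (z : ZFSet.{u}) : Set T.El := {a | a.1 ∈ z}

def ofSet (X : Set T.El) : ZFSet.{u} := T.set.sep fun z => ∃ h : z ∈ T.set, (⟨z, h⟩ : T.El) ∈ X

def toRel (z : ZFSet.{u}) (k : T.El) (X : Set T.El) : Prop := T.ofSet (ptSet k X) ∈ z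

def ofRel (Z : T.El → Set T.El → Prop) : ZFSet.{u} :=
  T.set.powerset.sep fun z => ∃ k X, z = T.ofSet (ptSet k X) ∧ Z k X

variable {T}

@[simp] theorem toEl_val (a : T.El) : T.toEl a.1 = a := by simp [toEl]

theorem toEl_of_mem {z : ZFSet.{u}} (h : z ∈ T.set) : T.toEl z = ⟨z, h⟩ := by simp [toEl, h]

theorem toEl_of_notMem {z : ZFSet.{u}} (h : z ∉ T.set) : T.toEl z = ⟨∅, T.empty_mem⟩ := by
  simp [toEl, h]

@[simp] theorem mem_toSet {a : T.El} {z : ZFSet.{u}} : a ∈ T.toSet z ↔ a.1 ∈ z := Iff.rfl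

theorem mem_ofSet {X : Set T.El} {z : ZFSet.{u}} :
    z ∈ T.ofSet X ↔ ∃ h : z ∈ T.set, (⟨z, h⟩ : T.El) ∈ X := by
  simp only [ofSet, ZFSet.mem_sep]
  exact ⟨fun h => h.2, fun h => ⟨h.1, h⟩⟩

@[simp] theorem toSet_ofSet (X : Set T.El) : T.toSet (T.ofSet X) = X := by
  ext a
  simp [mem_ofSet, a.2]

theorem ofSet_inj {X Y : Set T.El} : T.ofSet X = T.ofSet Y ↔ X = Y :=
  ⟨fun h => by rw [← toSet_ofSet X, h, toSet_ofSet], fun h => h ▸ rfl⟩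

theorem ofSet_mem (X : Set T.El) : T.ofSet X ∈ T.set.powerset := by
  rw [ZFSet.mem_powerset]
  intro z hz
  exact (mem_ofSet.1 hz).1

@[simp] theorem toRel_ofRel (Z : T.El → Set T.El → Prop) : T.toRel (T.ofRel Z) = Z := by
  funext k X
  simp only [toRel, ofRel, ZFSet.mem_sep, ofSet_mem, true_and, ofSet_inj, ptSet_inj, eq_iff_iff]
  constructor
  · rintro ⟨l, Y, ⟨rfl, rfl⟩, h⟩
    exact h
  · intro h
    exact ⟨k, X, ⟨rfl, rfl⟩, h⟩

theorem ofRel_mem (Z : T.El → Set T.El → Prop) : T.ofRel Z ∈ T.set.powerset.powerset := by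
  rw [ZFSet.mem_powerset]
  intro z hz
  exact (ZFSet.mem_sep.1 hz).1

variable (T)

/-- `T`, `℘(T)` and `℘(℘(T))`. -/
def base : Fin 3 → ZFSet.{u} := ![T.set, T.set.powerset, T.set.powerset.powerset]

variable {T}

/-- Transitivity of T gives T ⊆ ℘(T) ⊆ ℘(℘(T)), so ℘(℘(T)) bounds elements and coded subsets alike.
-/
theorem mem_pow2_of_mem_pow {z : ZFSet.{u}} (h : z ∈ T.set.powerset) :
    z ∈ T.set.powerset.powerset := by
  rw [ZFSet.mem_powerset] at *
  intro a ha
  rw [ZFSet.mem_powerset]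
  exact T.trans _ (h ha)

theorem mem_pow2_of_mem {z : ZFSet.{u}} (h : z ∈ T.set) : z ∈ T.set.powerset.powerset :=
  mem_pow2_of_mem_pow (ZFSet.mem_powerset.2 (T.trans _ h))

end AdjClosed

open AdjClosed

/-- `P` is defined, uniformly in `T`, by a `Δ₀(PwSt)`-formula with the parameters `T`, `℘(T)`
and `℘(℘(T))`. -/
class D3 {n : ℕ} (P : ∀ _ : AdjClosed.{u}, (Fin n → ZFSet.{u}) → Prop) : Prop where
  out : ∃ ψ : Delta0 2 (3 + n), ∀ T w,
    ψ.Holds PwSt (Fin.append (α := ZFSet.{u}) T.base w) ↔ P T w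

namespace D3

variable {n m : ℕ}

theorem of_D0 {Q : (Fin (3 + n) → ZFSet.{u}) → Prop} (h : D0 Q) :
    D3 fun T w => Q (Fin.append (α := ZFSet.{u}) T.base w) := by
  obtain ⟨ψ, hψ⟩ := h.out
  exact ⟨ψ, fun T w => hψ _⟩

section

variable {P Q : ∀ _ : AdjClosed.{u}, (Fin n → ZFSet.{u}) → Prop}

theorem congr (hP : D3 P) (h : ∀ T w, P T w ↔ Q T w) : D3 Q := by
  obtain ⟨ψ, hψ⟩ := hP.out
  exact ⟨ψ, fun T w => (hψ T w).trans (h T w)⟩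

theorem comp (hP : D3 P) (σ : Fin n → Fin m) : D3 fun T (w : Fin m → ZFSet.{u}) => P T fun j => w (σ j) := by
  obtain ⟨ψ, hψ⟩ := hP.out
  refine ⟨ψ.rename (Fin.append (α := Fin (3 + m)) (fun j => j.castAdd m) fun j => (σ j).natAdd 3), fun T w => ?_⟩
  rw [Delta0.holds_rename, ← hψ]
  have : (fun j => Fin.append (α := ZFSet.{u}) T.base w (Fin.append (α := Fin (3 + m))
      (fun j => j.castAdd m) (fun j => (σ j).natAdd 3) j)) =
      Fin.append (α := ZFSet.{u}) T.base fun j => w (σ j) := by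
    funext j
    refine Fin.addCases (fun j => ?_) (fun j => ?_) j <;> simp
  rw [this]

instance not [hP : D3 P] : D3 fun T w => ¬ P T w := by
  obtain ⟨ψ, hψ⟩ := hP.out
  exact ⟨.neg ψ, fun T w => by simp only [Delta0.Holds, hψ]⟩

instance and [hP : D3 P] [hQ : D3 Q] : D3 fun T w => P T w ∧ Q T w := by
  obtain ⟨ψ, hψ⟩ := hP.out
  obtain ⟨χ, hχ⟩ := hQ.out
  exact ⟨.and ψ χ, fun T w => by simp only [Delta0.Holds, hψ, hχ]⟩

instance imp [hP : D3 P] [hQ : D3 Q] : D3 fun T w => P T w → Q T w :=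
  (inferInstance : (D3 fun T w => ¬ (P T w ∧ ¬ Q T w))).congr fun T w => by tauto

instance or [hP : D3 P] [hQ : D3 Q] : D3 fun T w => P T w ∨ Q T w :=
  (inferInstance : (D3 fun T w => ¬ (¬ P T w ∧ ¬ Q T w))).congr fun T w => by tauto

instance iff [hP : D3 P] [hQ : D3 Q] : D3 fun T w => (P T w ↔ Q T w) :=
  (inferInstance : (D3 fun T w => (P T w → Q T w) ∧ (Q T w → P T w))).congr fun T w => by tauto

end

theorem ball_base (i : Fin 3) {P : ∀ _ : AdjClosed.{u}, (Fin n → ZFSet.{u}) → ZFSet.{u} → Prop}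
    (hP : D3 fun T (w : Fin (n + 1) → ZFSet.{u}) => P T (fun j => w j.castSucc) (w (Fin.last n))) :
    D3 fun T w => ∀ z, z ∈ T.base i → P T w z := by
  obtain ⟨ψ, hψ⟩ := hP.out
  refine ⟨.ball (i.castAdd n) ψ, fun T w => ?_⟩
  simp only [Delta0.Holds, Fin.append_left]
  refine forall_congr' fun z => forall_congr' fun _ => ?_
  have := hψ T (Fin.snoc (α := fun _ => ZFSet.{u}) w z)
  simp only [Fin.append_snoc, Fin.snoc_castSucc, Fin.snoc_last] at this
  exact this

theorem bex_base (i : Fin 3) {P : ∀ _ : AdjClosed.{u}, (Fin n → ZFSet.{u}) → ZFSet.{u} → Prop}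
    (hP : D3 fun T (w : Fin (n + 1) → ZFSet.{u}) => P T (fun j => w j.castSucc) (w (Fin.last n))) :
    D3 fun T w => ∃ z, z ∈ T.base i ∧ P T w z := by
  have := ball_base i (P := fun T w z => ¬ P T w z) inferInstance
  exact (inferInstance : (D3 fun T w => ¬ ∀ z, z ∈ T.base i → ¬ P T w z)).congr fun T w => by
    simp only [not_forall, not_not, exists_prop]

instance all_el {P : ∀ T : AdjClosed.{u}, (Fin n → ZFSet.{u}) → T.El → Prop}
    [hP : D3 fun T (w : Fin (n + 1) → ZFSet.{u}) =>
      P T (fun j => w j.castSucc) (T.toEl (w (Fin.last n)))] :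
    D3 fun T w => ∀ a : T.El, P T w a :=
  (ball_base 0 (P := fun T w z => P T w (T.toEl z)) hP).congr fun T w =>
    ⟨fun h a => by simpa using h a.1 a.2, fun h z _ => h _⟩

instance ex_el {P : ∀ T : AdjClosed.{u}, (Fin n → ZFSet.{u}) → T.El → Prop}
    [hP : D3 fun T (w : Fin (n + 1) → ZFSet.{u}) =>
      P T (fun j => w j.castSucc) (T.toEl (w (Fin.last n)))] :
    D3 fun T w => ∃ a : T.El, P T w a :=
  (inferInstance : (D3 fun T w => ¬ ∀ a : T.El, ¬ P T w a)).congr fun T w => by simp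

instance all_set {P : ∀ T : AdjClosed.{u}, (Fin n → ZFSet.{u}) → Set T.El → Prop}
    [hP : D3 fun T (w : Fin (n + 1) → ZFSet.{u}) =>
      P T (fun j => w j.castSucc) (T.toSet (w (Fin.last n)))] :
    D3 fun T w => ∀ X : Set T.El, P T w X :=
  (ball_base 1 (P := fun T w z => P T w (T.toSet z)) hP).congr fun T w =>
    ⟨fun h X => by simpa using h _ (ofSet_mem X), fun h z _ => h _⟩

instance all_rel {P : ∀ T : AdjClosed.{u}, (Fin n → ZFSet.{u}) → (T.El → Set T.El → Prop) → Prop}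
    [hP : D3 fun T (w : Fin (n + 1) → ZFSet.{u}) =>
      P T (fun j => w j.castSucc) (T.toRel (w (Fin.last n)))] :
    D3 fun T w => ∀ Z : T.El → Set T.El → Prop, P T w Z :=
  (ball_base 2 (P := fun T w z => P T w (T.toRel z)) hP).congr fun T w =>
    ⟨fun h Z => by simpa using h _ (ofRel_mem Z), fun h z _ => h _⟩

end D3

/-- Variables, and functions with values in `℘(℘(T))` and with a definable graph. -/
def D3Term {n : ℕ} (f : ∀ _ : AdjClosed.{u}, (Fin n → ZFSet.{u}) → ZFSet.{u}) : Prop :=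
  (∃ i, f = fun _ w => w i) ∨
    (∀ T w, f T w ∈ T.set.powerset.powerset) ∧
      D3 fun T (w : Fin (n + 1) → ZFSet.{u}) => w (Fin.last n) = f T fun j => w j.castSucc

/-- A term t is substituted through `∃ z ∈ ℘(℘(T)), z = t ∧ P z`; this is why `D3Term` requires
values in ℘(℘(T)). The induction removes the last argument, keeping the variables `w` as a separate
block in front. -/
theorem D3.subst {n m : ℕ} {P : ∀ _ : AdjClosed.{u}, (Fin m → ZFSet.{u}) → Prop} (hP : D3 P)
    {f : Fin m → ∀ _ : AdjClosed.{u}, (Fin n → ZFSet.{u}) → ZFSet.{u}} (hf : ∀ i, D3Term (f i)) :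
    D3 fun T w => P T fun i => f i T w := by
  suffices H : ∀ (m : ℕ) (P : ∀ _ : AdjClosed.{u}, (Fin (n + m) → ZFSet.{u}) → Prop), D3 P →
      ∀ f : Fin m → ∀ _ : AdjClosed.{u}, (Fin n → ZFSet.{u}) → ZFSet.{u}, (∀ i, D3Term (f i)) →
        D3 fun T w => P T (Fin.append (α := ZFSet.{u}) w fun i => f i T w) by
    refine (H m (fun T w => P T fun i => w (Fin.natAdd n i)) (hP.comp _) f hf).congr fun T w => ?_
    simp
  clear hP hf f P m
  intro m
  induction m with
  | zero =>
    intro P hP f hf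
    refine hP.congr fun T w => ?_
    have : (Fin.append (α := ZFSet.{u}) w fun i => f i T w) = w := by
      funext i
      exact Fin.append_left w (fun i => f i T w) i
    rw [this]
  | succ m ih =>
    intro P hP f hf
    have key : D3 fun T (w : Fin (n + m) → ZFSet.{u}) =>
        P T (Fin.snoc (α := fun _ => ZFSet.{u}) w (f (Fin.last m) T fun i => w (i.castAdd m))) := by
      rcases hf (Fin.last m) with ⟨i, hi⟩ | ⟨h1, h2⟩
      · refine (hP.comp (Fin.snoc (α := fun _ => Fin (n + m)) id (i.castAdd m))).congr fun T w => ?_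
        have : (fun j => w (Fin.snoc (α := fun _ => Fin (n + m)) id (i.castAdd m) j)) =
            Fin.snoc (α := fun _ => ZFSet.{u}) w (f (Fin.last m) T fun i => w (i.castAdd m)) := by
          rw [hi]
          funext j
          refine Fin.lastCases ?_ (fun j => ?_) j <;> simp
        exact iff_of_eq (congrArg (P T) this)
      · have h3 := h2.comp (Fin.snoc (α := fun _ => Fin (n + m + 1))
          (fun i : Fin n => (i.castAdd m).castSucc) (Fin.last (n + m)))
        simp only [Fin.snoc_last, Fin.snoc_castSucc] at h3
        have h4 := D3.bex_base 2 (P := fun T (w : Fin (n + m) → ZFSet.{u}) z =>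
          z = f (Fin.last m) T (fun i => w (i.castAdd m)) ∧
            P T (Fin.snoc (α := fun _ => ZFSet.{u}) w z))
          (by
            have : D3 fun T (w : Fin (n + m + 1) → ZFSet.{u}) =>
                P T (Fin.snoc (α := fun _ => ZFSet.{u}) (fun j => w j.castSucc)
                  (w (Fin.last (n + m)))) :=
              hP.congr fun T w => iff_of_eq (congrArg (P T) (snoc_eta (n := n + m) w).symm)
            exact inferInstance)
        refine h4.congr fun T w => ?_
        constructor
        · rintro ⟨z, _, rfl, h⟩
          exact h
        · intro h
          exact ⟨_, h1 _ _, rfl, h⟩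
    refine (ih _ key (fun i => f i.castSucc) fun i => hf _).congr fun T w => ?_
    simp only [Fin.append_left]
    have : (Fin.append (α := ZFSet.{u}) w fun i => f i T w) = Fin.snoc (α := fun _ => ZFSet.{u})
        (Fin.append (α := ZFSet.{u}) w fun i => f i.castSucc T w) (f (Fin.last m) T w) := by
      rw [← Fin.append_snoc]
      congr 1
      funext i
      refine Fin.lastCases ?_ (fun j => ?_) i <;> simp
    rw [this]

/-- Element-valued functions with a definable graph. -/
class D3El {n : ℕ} (f : ∀ T : AdjClosed.{u}, (Fin n → ZFSet.{u}) → T.El) : Prop where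
  out : D3 fun T (w : Fin (n + 1) → ZFSet.{u}) => w (Fin.last n) = (f T fun j => w j.castSucc).1

/-- Set-valued functions with a definable graph. -/
class D3Set {n : ℕ} (F : ∀ T : AdjClosed.{u}, (Fin n → ZFSet.{u}) → Set T.El) : Prop where
  out : D3 fun T (w : Fin (n + 1) → ZFSet.{u}) =>
    w (Fin.last n) = T.ofSet (F T fun j => w j.castSucc)

theorem D3El.term {n : ℕ} {f : ∀ T : AdjClosed.{u}, (Fin n → ZFSet.{u}) → T.El} (hf : D3El f) :
    D3Term fun T w => (f T w).1 :=
  Or.inr ⟨fun _ _ => mem_pow2_of_mem (Subtype.property _), hf.out⟩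

theorem D3Set.term {n : ℕ} {F : ∀ T : AdjClosed.{u}, (Fin n → ZFSet.{u}) → Set T.El}
    (hF : D3Set F) : D3Term fun T w => T.ofSet (F T w) :=
  Or.inr ⟨fun _ _ => mem_pow2_of_mem_pow (ofSet_mem _), hF.out⟩

theorem D3Term.var {n : ℕ} (i : Fin n) : D3Term.{u} fun _ w => w i := Or.inl ⟨i, rfl⟩

end BddSymb

namespace BddSymb

open Cardinal AdjClosed

/-! ### Substitution of definable terms into definable predicates -/

namespace D3

variable {n m : ℕ}

theorem raw {Q : (Fin m → ZFSet.{u}) → Prop} (h : D0 Q)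
    {f : Fin m → ∀ _ : AdjClosed.{u}, (Fin n → ZFSet.{u}) → ZFSet.{u}} (hf : ∀ i, D3Term (f i)) :
    D3 fun T w => Q fun i => f i T w := by
  have h1 := of_D0 (h.comp fun i => Fin.natAdd 3 i)
  simp only [Fin.append_right] at h1
  exact h1.subst hf

theorem raw2 {Q : ZFSet.{u} → ZFSet.{u} → Prop} (h : D0 fun v : Fin 2 → ZFSet.{u} => Q (v 0) (v 1))
    {f g : ∀ _ : AdjClosed.{u}, (Fin n → ZFSet.{u}) → ZFSet.{u}} (hf : D3Term f) (hg : D3Term g) :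
    D3 fun T w => Q (f T w) (g T w) :=
  raw (f := ![f, g]) h fun i => by fin_cases i <;> assumption

theorem raw3 {Q : ZFSet.{u} → ZFSet.{u} → ZFSet.{u} → Prop}
    (h : D0 fun v : Fin 3 → ZFSet.{u} => Q (v 0) (v 1) (v 2))
    {f g k : ∀ _ : AdjClosed.{u}, (Fin n → ZFSet.{u}) → ZFSet.{u}} (hf : D3Term f) (hg : D3Term g)
    (hk : D3Term k) : D3 fun T w => Q (f T w) (g T w) (k T w) :=
  raw (f := ![f, g, k]) h fun i => by fin_cases i <;> assumption

theorem el1 {Q : ∀ T : AdjClosed.{u}, T.El → Prop}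
    (h : D3 fun T (v : Fin 1 → ZFSet.{u}) => Q T (T.toEl (v 0)))
    {f : ∀ T : AdjClosed.{u}, (Fin n → ZFSet.{u}) → T.El} [hf : D3El f] :
    D3 fun T w => Q T (f T w) :=
  (h.subst (f := ![fun T w => (f T w).1]) fun i => by
    fin_cases i; exact hf.term).congr fun T w => by simp

theorem el2 {Q : ∀ T : AdjClosed.{u}, T.El → T.El → Prop}
    (h : D3 fun T (v : Fin 2 → ZFSet.{u}) => Q T (T.toEl (v 0)) (T.toEl (v 1)))
    {f g : ∀ T : AdjClosed.{u}, (Fin n → ZFSet.{u}) → T.El} [hf : D3El f] [hg : D3El g] :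
    D3 fun T w => Q T (f T w) (g T w) :=
  (h.subst (f := ![fun T w => (f T w).1, fun T w => (g T w).1]) fun i => by
    fin_cases i
    exacts [hf.term, hg.term]).congr fun T w => by simp

theorem el3 {Q : ∀ T : AdjClosed.{u}, T.El → T.El → T.El → Prop}
    (h : D3 fun T (v : Fin 3 → ZFSet.{u}) => Q T (T.toEl (v 0)) (T.toEl (v 1)) (T.toEl (v 2)))
    {f g k : ∀ T : AdjClosed.{u}, (Fin n → ZFSet.{u}) → T.El} [hf : D3El f] [hg : D3El g]
    [hk : D3El k] : D3 fun T w => Q T (f T w) (g T w) (k T w) :=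
  (h.subst (f := ![fun T w => (f T w).1, fun T w => (g T w).1, fun T w => (k T w).1]) fun i => by
    fin_cases i
    exacts [hf.term, hg.term, hk.term]).congr fun T w => by simp

/-- Predicates of one element, one set, and three more elements. -/
theorem el_set_el3 {Q : ∀ T : AdjClosed.{u}, T.El → Set T.El → T.El → T.El → T.El → Prop}
    (h : D3 fun T (v : Fin 5 → ZFSet.{u}) =>
      Q T (T.toEl (v 0)) (T.toSet (v 1)) (T.toEl (v 2)) (T.toEl (v 3)) (T.toEl (v 4)))
    {f k l r : ∀ T : AdjClosed.{u}, (Fin n → ZFSet.{u}) → T.El}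
    {G : ∀ T : AdjClosed.{u}, (Fin n → ZFSet.{u}) → Set T.El}
    [hf : D3El f] [hG : D3Set G] [hk : D3El k] [hl : D3El l] [hr : D3El r] :
    D3 fun T w => Q T (f T w) (G T w) (k T w) (l T w) (r T w) :=
  (h.subst (f := ![fun T w => (f T w).1, fun T w => T.ofSet (G T w), fun T w => (k T w).1,
    fun T w => (l T w).1, fun T w => (r T w).1]) fun i => by
    fin_cases i
    exacts [hf.term, hG.term, hk.term, hl.term, hr.term]).congr fun T w => by simp

instance false : D3 fun (_ : AdjClosed.{u}) (_ : Fin n → ZFSet.{u}) => False :=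
  of_D0 (D0.false (Fin.castAdd n 0))

instance mem_el {f g : ∀ T : AdjClosed.{u}, (Fin n → ZFSet.{u}) → T.El} [hf : D3El f]
    [hg : D3El g] : D3 fun T w => (f T w).1 ∈ (g T w).1 :=
  raw2 (Q := fun a b => a ∈ b) inferInstance hf.term hg.term

instance eq_el {f g : ∀ T : AdjClosed.{u}, (Fin n → ZFSet.{u}) → T.El} [hf : D3El f]
    [hg : D3El g] : D3 fun T w => f T w = g T w :=
  (raw2 (Q := fun a b => a = b) inferInstance hf.term hg.term).congr fun T w => by
    rw [Subtype.ext_iff]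

instance eq_succ {f g : ∀ T : AdjClosed.{u}, (Fin n → ZFSet.{u}) → T.El} [hf : D3El f]
    [hg : D3El g] : D3 fun T w => (f T w).1 = insert (g T w).1 (g T w).1 :=
  raw2 (Q := fun a b => a = insert b b) inferInstance hf.term hg.term

instance mem_set {f : ∀ T : AdjClosed.{u}, (Fin n → ZFSet.{u}) → T.El}
    {F : ∀ T : AdjClosed.{u}, (Fin n → ZFSet.{u}) → Set T.El} [hf : D3El f]
    [hF : D3Set F] : D3 fun T w => f T w ∈ F T w :=
  (raw2 (Q := fun a b => a ∈ b) inferInstance hf.term hF.term).congr fun T w => by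
    rw [← mem_toSet, toSet_ofSet]

end D3

/-! ### Definable terms over T -/

section terms

variable {n : ℕ}

instance D3El.var (i : Fin n) : D3El fun (T : AdjClosed.{u}) w => T.toEl (w i) := by
  constructor
  have h : D0 fun w : Fin (3 + (n + 1)) → ZFSet.{u} =>
      (w (Fin.natAdd 3 i.castSucc) ∈ w (Fin.castAdd (n + 1) 0) ∧
        w (Fin.natAdd 3 (Fin.last n)) = w (Fin.natAdd 3 i.castSucc)) ∨
      ¬ w (Fin.natAdd 3 i.castSucc) ∈ w (Fin.castAdd (n + 1) 0) ∧
        w (Fin.natAdd 3 (Fin.last n)) = ∅ := inferInstance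
  refine (D3.of_D0 h).congr fun T w => ?_
  simp only [Fin.append_right, Fin.append_left]
  change (_ ∈ T.set ∧ _ ∨ ¬ _ ∈ T.set ∧ _) ↔ _
  by_cases h : w i.castSucc ∈ T.set
  · simp [h, toEl_of_mem]
  · simp [h, toEl_of_notMem]

theorem D3.weaken_last {P : ∀ _ : AdjClosed.{u}, (Fin n → ZFSet.{u}) → ZFSet.{u} → Prop}
    (h : D3 fun T (w : Fin (n + 1) → ZFSet.{u}) => P T (fun j => w j.castSucc) (w (Fin.last n))) :
    D3 fun T (w : Fin (n + 2) → ZFSet.{u}) =>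
      P T (fun j => w j.castSucc.castSucc) (w (Fin.last (n + 1))) :=
  (h.comp (Fin.snoc (α := fun _ => Fin (n + 2)) (fun i : Fin n => i.castSucc.castSucc)
    (Fin.last (n + 1)))).congr fun T w => by simp

/-- `toEl` sends all non-members of T to ∅, so the graph of `f` must additionally say that the value
variable is in T. -/
theorem D3El.of_graph {f : ∀ T : AdjClosed.{u}, (Fin n → ZFSet.{u}) → T.El}
    (h : D3 fun T (w : Fin (n + 1) → ZFSet.{u}) =>
      T.toEl (w (Fin.last n)) = f T fun j => w j.castSucc) : D3El f := by
  constructor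
  have h1 : D3 fun T (w : Fin (n + 1) → ZFSet.{u}) => w (Fin.last n) ∈ T.base 0 := by
    have h : D0 fun w : Fin (3 + (n + 1)) → ZFSet.{u} =>
      (w (Fin.natAdd 3 (Fin.last n)) ∈ w (Fin.castAdd (n + 1) 0)) := inferInstance
    exact (D3.of_D0 h).congr fun T w => by simp only [Fin.append_right, Fin.append_left]
  refine (inferInstance : (D3 fun T (w : Fin (n + 1) → ZFSet.{u}) => w (Fin.last n) ∈ T.base 0 ∧
    T.toEl (w (Fin.last n)) = f T fun j => w j.castSucc)).congr fun T w => ?_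
  change (_ ∈ T.set ∧ _) ↔ _
  constructor
  · rintro ⟨h1, h2⟩
    rw [← h2, toEl_of_mem h1]
  · intro h
    rw [h]
    exact ⟨(f T fun j => w j.castSucc).2, toEl_val _⟩

theorem D3Set.of_mem {F : ∀ T : AdjClosed.{u}, (Fin n → ZFSet.{u}) → Set T.El}
    (h : D3 fun T (w : Fin (n + 1) → ZFSet.{u}) =>
      T.toEl (w (Fin.last n)) ∈ F T fun j => w j.castSucc) : D3Set F := by
  constructor
  have h1 : D3 fun T (w : Fin (n + 1) → ZFSet.{u}) => w (Fin.last n) ∈ T.base 1 := by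
    have h : D0 fun w : Fin (3 + (n + 1)) → ZFSet.{u} =>
      (w (Fin.natAdd 3 (Fin.last n)) ∈ w (Fin.castAdd (n + 1) 1)) := inferInstance
    exact (D3.of_D0 h).congr fun T w => by simp only [Fin.append_right, Fin.append_left]
  have h2 := D3.weaken_last (P := fun T w z => T.toEl z ∈ F T w) h
  have h3 : D3 fun T (w : Fin (n + 2) → ZFSet.{u}) =>
      (T.toEl (w (Fin.last (n + 1)))).1 ∈ w (Fin.last n).castSucc :=
    D3.raw2 (Q := fun a b => a ∈ b) inferInstance (D3El.term inferInstance) (.var _)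
  refine (inferInstance : (D3 fun T (w : Fin (n + 1) → ZFSet.{u}) => w (Fin.last n) ∈ T.base 1 ∧
    ∀ a : T.El, a.1 ∈ w (Fin.last n) ↔ a ∈ F T fun j => w j.castSucc)).congr fun T w => ?_
  change (_ ∈ T.set.powerset ∧ _) ↔ _
  constructor
  · rintro ⟨h1, h2⟩
    rw [ZFSet.mem_powerset] at h1
    ext z
    rw [mem_ofSet]
    exact ⟨fun hz => ⟨h1 hz, (h2 ⟨z, h1 hz⟩).1 hz⟩, fun ⟨h, hz⟩ => (h2 ⟨z, h⟩).2 hz⟩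
  · intro h
    rw [h]
    exact ⟨ofSet_mem _, fun a => by rw [← mem_toSet, toSet_ofSet]⟩

instance D3Set.var (i : Fin n) : D3Set fun (T : AdjClosed.{u}) w => T.toSet (w i) :=
  .of_mem <| D3.raw2 (Q := fun a b => a ∈ b) inferInstance (D3El.term inferInstance) (.var _)

instance D3Set.setOf {P : ∀ T : AdjClosed.{u}, (Fin n → ZFSet.{u}) → T.El → Prop}
    [hP : D3 fun T (w : Fin (n + 1) → ZFSet.{u}) =>
      P T (fun j => w j.castSucc) (T.toEl (w (Fin.last n)))] :
    D3Set fun T w => {a | P T w a} :=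
  .of_mem hP

instance D3Set.empty : D3Set fun (T : AdjClosed.{u}) (_ : Fin n → ZFSet.{u}) => (∅ : Set T.El) :=
  .of_mem D3.false

instance D3El.nt (k : ℕ) : D3El fun (T : AdjClosed.{u}) (_ : Fin n → ZFSet.{u}) => (nt k : T.El) :=
  ⟨D3.raw (m := 1) (f := ![fun _ w => w (Fin.last n)]) (Q := fun v => v 0 = natCode k) inferInstance
    fun i => by fin_cases i; exact .var _⟩

theorem D3El.op1 {F : ∀ T : AdjClosed.{u}, T.El → T.El}
    (h : D3 fun T (v : Fin 2 → ZFSet.{u}) => T.toEl (v 1) = F T (T.toEl (v 0)))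
    {f : ∀ T : AdjClosed.{u}, (Fin n → ZFSet.{u}) → T.El} [hf : D3El f] :
    D3El fun T w => F T (f T w) := by
  have : D3El fun T (w : Fin (n + 1) → ZFSet.{u}) => f T fun j => w j.castSucc :=
    ⟨D3.weaken_last (P := fun T w z => z = (f T w).1) hf.out⟩
  refine .of_graph ?_
  exact D3.el2 (Q := fun T a b => b = F T a) h (f := fun T w => f T fun j => w j.castSucc)

theorem D3El.op2 {F : ∀ T : AdjClosed.{u}, T.El → T.El → T.El}
    (h : D3 fun T (v : Fin 3 → ZFSet.{u}) => T.toEl (v 2) = F T (T.toEl (v 0)) (T.toEl (v 1)))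
    {f g : ∀ T : AdjClosed.{u}, (Fin n → ZFSet.{u}) → T.El} [hf : D3El f] [hg : D3El g] :
    D3El fun T w => F T (f T w) (g T w) := by
  have : D3El fun T (w : Fin (n + 1) → ZFSet.{u}) => f T fun j => w j.castSucc :=
    ⟨D3.weaken_last (P := fun T w z => z = (f T w).1) hf.out⟩
  have : D3El fun T (w : Fin (n + 1) → ZFSet.{u}) => g T fun j => w j.castSucc :=
    ⟨D3.weaken_last (P := fun T w z => z = (g T w).1) hg.out⟩
  refine .of_graph ?_
  exact D3.el3 (Q := fun T a b c => c = F T a b) h (f := fun T w => f T fun j => w j.castSucc)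
    (g := fun T w => g T fun j => w j.castSucc)

instance D3El.pr {f g : ∀ T : AdjClosed.{u}, (Fin n → ZFSet.{u}) → T.El} [hf : D3El f]
    [hg : D3El g] : D3El fun T w => pr (f T w) (g T w) :=
  .op2 (F := fun T a b => AdjClosed.pr a b) <|
    (D3.raw3 (Q := fun a b c => c = ZFSet.pair a b) inferInstance
      (f := fun T (v : Fin 3 → ZFSet.{u}) => (T.toEl (v 0)).1) (g := fun T v => (T.toEl (v 1)).1)
      (k := fun T v => (T.toEl (v 2)).1)
      (D3El.term inferInstance) (D3El.term inferInstance) (D3El.term inferInstance)).congr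
    fun T w => by rw [Subtype.ext_iff, pr_val]

/-- Predicates of one set and one element. -/
theorem D3.set_el {Q : ∀ T : AdjClosed.{u}, ZFSet.{u} → T.El → Set T.El → Prop}
    (h : D3 fun T (v : Fin 3 → ZFSet.{u}) => Q T (v 0) (T.toEl (v 1)) (T.toSet (v 2)))
    {f : ∀ T : AdjClosed.{u}, (Fin n → ZFSet.{u}) → T.El}
    {F : ∀ T : AdjClosed.{u}, (Fin n → ZFSet.{u}) → Set T.El} [hf : D3El f] [hF : D3Set F]
    (i : Fin n) : D3 fun T w => Q T (w i) (f T w) (F T w) :=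
  (h.subst (f := ![fun _ w => w i, fun T w => (f T w).1, fun T w => T.ofSet (F T w)]) fun i => by
    fin_cases i
    exacts [.var _, hf.term, hF.term]).congr fun T w => by simp

instance D3.rel {f : ∀ T : AdjClosed.{u}, (Fin n → ZFSet.{u}) → T.El}
    {F : ∀ T : AdjClosed.{u}, (Fin n → ZFSet.{u}) → Set T.El} [hf : D3El f] [hF : D3Set F]
    (i : Fin n) : D3 fun T w => T.toRel (w i) (f T w) (F T w) := by
  refine D3.set_el (Q := fun T z a X => T.toRel z a X) ?_ i
  have : D3Set fun T (v : Fin 3 → ZFSet.{u}) => ptSet (T.toEl (v 1)) (T.toSet (v 2)) := by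
    unfold ptSet
    infer_instance
  exact D3.raw2 (Q := fun a b => a ∈ b) inferInstance this.term (.var 0)

end terms

/-! ## Natural numbers and finite sequences -/

namespace AdjClosed

variable {T : AdjClosed.{u}}

def IsNat (a : T.El) : Prop := ∃ k, a = nt k

/-- `q` is a sequence of length `a`. -/
def IsSeq (a q : T.El) : Prop := ∃ (N : ℕ) (x : Fin N → T.El), a = nt N ∧ q = sq x

theorem mem_nt {i : T.El} {N : ℕ} : i.1 ∈ (nt N : T.El).1 ↔ ∃ k : Fin N, i = nt k := by
  rw [nt_val, mem_natCode]
  constructor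
  · rintro ⟨k, hk, h⟩
    exact ⟨⟨k, hk⟩, Subtype.ext h⟩
  · rintro ⟨k, rfl⟩
    exact ⟨k, k.2, rfl⟩

theorem pr_mem_sq {N : ℕ} {x : Fin N → T.El} {i a : T.El} :
    (pr i a).1 ∈ (sq x).1 ↔ ∃ k : Fin N, i = nt k ∧ a = x k := by
  rw [pr_val, sq_val, pair_mem_seqCode]
  exact exists_congr fun k => and_congr (by rw [Subtype.ext_iff, nt_val]) (by rw [Subtype.ext_iff])

/-- Subsets of T are available as objects, so the natural numbers can be taken as the intersection
of all inductive subsets of T. -/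
theorem isNat_iff (a : T.El) : IsNat a ↔ ∀ X : Set T.El, nt 0 ∈ X →
    (∀ i, i ∈ X → ∀ j : T.El, j.1 = insert i.1 i.1 → j ∈ X) → a ∈ X := by
  constructor
  · rintro ⟨k, rfl⟩ X h0 hs
    induction k with
    | zero => exact h0
    | succ k ih => exact hs _ ih _ rfl
  · intro h
    refine h {a | IsNat a} ⟨0, rfl⟩ ?_
    rintro _ ⟨k, rfl⟩ j hj
    exact ⟨k + 1, Subtype.ext hj⟩

theorem isSeq_iff (a q : T.El) : IsSeq a q ↔ IsNat a ∧
    (∀ e : T.El, e.1 ∈ q.1 → ∃ i b : T.El, i.1 ∈ a.1 ∧ e = pr i b) ∧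
    ∀ i : T.El, i.1 ∈ a.1 → ∃ b : T.El, (pr i b).1 ∈ q.1 ∧
      ∀ c : T.El, (pr i c).1 ∈ q.1 → c = b := by
  constructor
  · rintro ⟨N, x, rfl, rfl⟩
    refine ⟨⟨N, rfl⟩, fun e he => ?_, fun i hi => ?_⟩
    · rw [sq_val, mem_seqCode] at he
      obtain ⟨k, hk⟩ := he
      exact ⟨nt k, x k, mem_nt.2 ⟨k, rfl⟩, Subtype.ext hk⟩
    · obtain ⟨k, rfl⟩ := mem_nt.1 hi
      refine ⟨x k, pr_mem_sq.2 ⟨k, rfl, rfl⟩, fun c hc => ?_⟩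
      obtain ⟨l, hl, rfl⟩ := pr_mem_sq.1 hc
      rw [Fin.ext (nt_inj.1 hl)]
  · rintro ⟨⟨N, rfl⟩, h1, h2⟩
    have h3 := fun k : Fin N => h2 (nt k) (mem_nt.2 ⟨k, rfl⟩)
    choose x hx hu using h3
    refine ⟨N, x, rfl, Subtype.ext (ZFSet.ext fun z => ⟨fun hz => ?_, fun hz => ?_⟩)⟩
    · obtain ⟨i, b, hi, hb⟩ := h1 ⟨z, T.trans _ q.2 hz⟩ hz
      obtain ⟨k, rfl⟩ := mem_nt.1 hi
      have hz2 : (pr (nt k) b).1 ∈ q.1 := hb ▸ hz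
      have := hu k b hz2
      have hz3 : z = (pr (nt k) b).1 := congrArg Subtype.val hb
      rw [hz3]
      exact pr_mem_sq.2 ⟨k, rfl, this⟩
    · obtain ⟨k, rfl⟩ := mem_seqCode.1 hz
      exact hx k

def HasFst (a b : T.El) : Prop := ∃ c, a = pr b c

def HasSnd (a b : T.El) : Prop := ∃ c, a = pr c b

-- The value on non-pairs is arbitrary. It only makes the projections total; the first clause of
-- `IsStr` ensures that the components of a structure code are genuine.
open Classical in
def fst (a : T.El) : T.El := if h : ∃ b, HasFst a b then h.choose else a

open Classical in
def snd (a : T.El) : T.El := if h : ∃ b, HasSnd a b then h.choose else a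

@[simp] theorem fst_pr (a b : T.El) : fst (pr a b) = a := by
  have h : ∃ c, HasFst (pr a b) c := ⟨a, b, rfl⟩
  rw [fst, dif_pos h]
  obtain ⟨c, hc⟩ := h.choose_spec
  exact (pr_inj.1 hc).1.symm

@[simp] theorem snd_pr (a b : T.El) : snd (pr a b) = b := by
  have h : ∃ c, HasSnd (pr a b) c := ⟨b, a, rfl⟩
  rw [snd, dif_pos h]
  obtain ⟨c, hc⟩ := h.choose_spec
  exact (pr_inj.1 hc).2.symm

theorem eq_fst_iff (a b : T.El) : b = fst a ↔ HasFst a b ∨ (¬ ∃ c, HasFst a c) ∧ b = a := by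
  by_cases h : ∃ c d, a = pr c d
  · obtain ⟨c, d, rfl⟩ := h
    simp only [fst_pr, HasFst, pr_inj]
    constructor
    · rintro rfl
      exact Or.inl ⟨d, rfl, rfl⟩
    · rintro (⟨_, h, _⟩ | ⟨h, _⟩)
      · exact h.symm
      · exact (h ⟨c, d, rfl, rfl⟩).elim
  · have h2 : ¬ ∃ c, HasFst a c := h
    have h3 : ¬ HasFst a b := fun h => h2 ⟨_, h⟩
    rw [fst, dif_neg h2]
    tauto

theorem eq_snd_iff (a b : T.El) : b = snd a ↔ HasSnd a b ∨ (¬ ∃ c, HasSnd a c) ∧ b = a := by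
  by_cases h : ∃ c d, a = pr c d
  · obtain ⟨c, d, rfl⟩ := h
    simp only [snd_pr, HasSnd, pr_inj]
    constructor
    · rintro rfl
      exact Or.inl ⟨c, rfl, rfl⟩
    · rintro (⟨_, _, h⟩ | ⟨h, _⟩)
      · exact h.symm
      · exact (h ⟨d, c, rfl, rfl⟩).elim
  · have h2 : ¬ ∃ c, HasSnd a c := fun ⟨c, d, h3⟩ => h ⟨d, c, h3⟩
    have h3 : ¬ HasSnd a b := fun h => h2 ⟨_, h⟩
    rw [snd, dif_neg h2]
    tauto

end AdjClosed

section terms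

variable {n : ℕ} {f g : ∀ T : AdjClosed.{u}, (Fin n → ZFSet.{u}) → T.El}

instance D3.isNat [D3El f] : D3 fun T w => IsNat (f T w) :=
  D3.el1 (Q := fun T a => IsNat a) <|
    (inferInstance : (D3 fun T (v : Fin 1 → ZFSet.{u}) => ∀ X : Set T.El, nt 0 ∈ X →
      (∀ i, i ∈ X → ∀ j : T.El, j.1 = insert i.1 i.1 → j ∈ X) → T.toEl (v 0) ∈ X)).congr
    fun T w => (isNat_iff _).symm

instance D3.isSeq [D3El f] [D3El g] : D3 fun T w => IsSeq (f T w) (g T w) :=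
  D3.el2 (Q := fun T a q => IsSeq a q) <|
    (inferInstance : (D3 fun T (v : Fin 2 → ZFSet.{u}) => IsNat (T.toEl (v 0)) ∧
      (∀ e : T.El, e.1 ∈ (T.toEl (v 1)).1 → ∃ i b : T.El, i.1 ∈ (T.toEl (v 0)).1 ∧ e = pr i b) ∧
      ∀ i : T.El, i.1 ∈ (T.toEl (v 0)).1 → ∃ b : T.El, (pr i b).1 ∈ (T.toEl (v 1)).1 ∧
        ∀ c : T.El, (pr i c).1 ∈ (T.toEl (v 1)).1 → c = b)).congr
    fun T w => (isSeq_iff _ _).symm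

instance D3El.fst [D3El f] : D3El fun T w => fst (f T w) :=
  .op1 (F := fun T a => AdjClosed.fst a) <|
    (inferInstance : (D3 fun T (v : Fin 2 → ZFSet.{u}) => (∃ c, T.toEl (v 0) = AdjClosed.pr (T.toEl (v 1)) c) ∨
      (¬ ∃ b c, T.toEl (v 0) = AdjClosed.pr b c) ∧ T.toEl (v 1) = T.toEl (v 0))).congr
    fun T w => (eq_fst_iff _ _).symm

instance D3El.snd [D3El f] : D3El fun T w => snd (f T w) :=
  .op1 (F := fun T a => AdjClosed.snd a) <|
    (inferInstance : (D3 fun T (v : Fin 2 → ZFSet.{u}) => (∃ c, T.toEl (v 0) = AdjClosed.pr c (T.toEl (v 1))) ∨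
      (¬ ∃ b c, T.toEl (v 0) = AdjClosed.pr c b) ∧ T.toEl (v 1) = T.toEl (v 0))).congr
    fun T w => (eq_snd_iff _ _).symm

end terms

end BddSymb

namespace BddSymb

open Cardinal AdjClosed

namespace AdjClosed

/-! ## Structures and satisfaction inside `T` -/

section defs

variable {T : AdjClosed.{u}}

/-- The sorts of the vocabulary of the structure coded by `x`. -/
abbrev sortsOf (x : T.El) : T.El := fst (fst x)

abbrev relsOf (x : T.El) : T.El := fst (snd (fst x))

abbrev fnsOf (x : T.El) : T.El := snd (snd (fst x))

abbrev domsOf (x : T.El) : T.El := fst (snd x)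

abbrev relIntOf (x : T.El) : T.El := fst (snd (snd x))

abbrev fnIntOf (x : T.El) : T.El := snd (snd (snd x))

def IsProf (x q : T.El) : Prop :=
  ∃ m, IsSeq m q ∧ ∀ i s : T.El, (pr i s).1 ∈ q.1 → s.1 ∈ (sortsOf x).1

def IsTup (x q t : T.El) : Prop :=
  ∃ m, IsSeq m q ∧ IsSeq m t ∧ ∀ i s a : T.El, (pr i s).1 ∈ q.1 → (pr i a).1 ∈ t.1 →
    ∃ D : T.El, (pr s D).1 ∈ (domsOf x).1 ∧ a.1 ∈ D.1

def RelsOK (x : T.El) : Prop :=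
  (∀ e : T.El, e.1 ∈ (relsOf x).1 → ∃ r q : T.El, e = pr r q ∧ IsProf x q) ∧
  ∀ r q q' : T.El, (pr r q).1 ∈ (relsOf x).1 → (pr r q').1 ∈ (relsOf x).1 → q' = q

def FnsOK (x : T.El) : Prop :=
  (∀ e : T.El, e.1 ∈ (fnsOf x).1 → ∃ f q s : T.El, e = pr f (pr q s) ∧ IsProf x q ∧
    s.1 ∈ (sortsOf x).1) ∧
  ∀ f p p' : T.El, (pr f p).1 ∈ (fnsOf x).1 → (pr f p').1 ∈ (fnsOf x).1 → p' = p

def DomsOK (x : T.El) : Prop :=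
  (∀ e : T.El, e.1 ∈ (domsOf x).1 → ∃ s D : T.El, e = pr s D ∧ s.1 ∈ (sortsOf x).1 ∧
    ∃ a : T.El, a.1 ∈ D.1) ∧
  ∀ s : T.El, s.1 ∈ (sortsOf x).1 → ∃ D : T.El, (pr s D).1 ∈ (domsOf x).1 ∧
    ∀ D' : T.El, (pr s D').1 ∈ (domsOf x).1 → D' = D

def RelIntOK (x : T.El) : Prop :=
  (∀ e : T.El, e.1 ∈ (relIntOf x).1 → ∃ r X q : T.El, e = pr r X ∧ (pr r q).1 ∈ (relsOf x).1 ∧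
    ∀ t : T.El, t.1 ∈ X.1 → IsTup x q t) ∧
  ∀ r q : T.El, (pr r q).1 ∈ (relsOf x).1 → ∃ X : T.El, (pr r X).1 ∈ (relIntOf x).1 ∧
    ∀ X' : T.El, (pr r X').1 ∈ (relIntOf x).1 → X' = X

def FnGraphOK (x q s G : T.El) : Prop :=
  (∀ g : T.El, g.1 ∈ G.1 → ∃ t b : T.El, g = pr t b ∧ IsTup x q t ∧
    ∃ D : T.El, (pr s D).1 ∈ (domsOf x).1 ∧ b.1 ∈ D.1) ∧
  ∀ t : T.El, IsTup x q t → ∃ b : T.El, (pr t b).1 ∈ G.1 ∧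
    ∀ b' : T.El, (pr t b').1 ∈ G.1 → b' = b

def FnIntOK (x : T.El) : Prop :=
  (∀ e : T.El, e.1 ∈ (fnIntOf x).1 → ∃ f G q s : T.El, e = pr f G ∧
    (pr f (pr q s)).1 ∈ (fnsOf x).1 ∧ FnGraphOK x q s G) ∧
  ∀ f p : T.El, (pr f p).1 ∈ (fnsOf x).1 → ∃ G : T.El, (pr f G).1 ∈ (fnIntOf x).1 ∧
    ∀ G' : T.El, (pr f G').1 ∈ (fnIntOf x).1 → G' = G

/-- `x` is the code of a structure. -/
def IsStr (x : T.El) : Prop :=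
  x = pr (pr (sortsOf x) (pr (relsOf x) (fnsOf x))) (pr (domsOf x) (pr (relIntOf x) (fnIntOf x))) ∧
    RelsOK x ∧ FnsOK x ∧ DomsOK x ∧ RelIntOK x ∧ FnIntOK x

/-- The key of the first-order variable `x_n^s` in assignments. -/
abbrev key₁ (s n : T.El) : T.El := pr (nt 0) (pr s n)

/-- The key of the second-order variable `X_n^q` in assignments. -/
abbrev key₂ (q n : T.El) : T.El := pr (nt 1) (pr q n)

/-- The set `X` is closed under evaluation of terms: `(s, c, a) ∈ X` says that the term `c` of
sort `s` has the value `a` under the partial assignment `α`. -/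
def EvClosed (x : T.El) (α X : Set T.El) : Prop :=
  (∀ s n a : T.El, s.1 ∈ (sortsOf x).1 → IsNat n → pr (key₁ s n) a ∈ α →
    pr s (pr (pr (nt 0) (pr s n)) a) ∈ X) ∧
  ∀ f q s G m cs as b : T.El, (pr f (pr q s)).1 ∈ (fnsOf x).1 → (pr f G).1 ∈ (fnIntOf x).1 →
    IsSeq m q → IsSeq m cs → IsSeq m as →
    (∀ i s' c a : T.El, (pr i s').1 ∈ q.1 → (pr i c).1 ∈ cs.1 → (pr i a).1 ∈ as.1 →
      pr s' (pr c a) ∈ X) →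
    (pr as b).1 ∈ G.1 → pr s (pr (pr (nt 1) (pr f cs)) b) ∈ X

def Ev (x : T.El) (α : Set T.El) (s c a : T.El) : Prop :=
  ∀ X, EvClosed x α X → pr s (pr c a) ∈ X

def EvSeq (x : T.El) (α : Set T.El) (q cs as : T.El) : Prop :=
  ∃ m : T.El, IsSeq m q ∧ IsSeq m cs ∧ IsSeq m as ∧
    ∀ i s c a : T.El, (pr i s).1 ∈ q.1 → (pr i c).1 ∈ cs.1 → (pr i a).1 ∈ as.1 → Ev x α s c a

/-- The assignment `α` with the values at `k` replaced by `Y`. -/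
def upd (α : Set T.El) (k : T.El) (Y : Set T.El) : Set T.El :=
  {e | ∃ l a : T.El, e = pr l a ∧ ((l = k ∧ a ∈ Y) ∨ (l ≠ k ∧ pr l a ∈ α))}

/-- `Z` takes a formula together with a truth value, 1 or 0. Falsity is thus derived like truth and
never inferred from a failure to derive, so all clauses are positive in `Z`, including the one for
negation. -/
def SatEq (x : T.El) (Z : T.El → Set T.El → Prop) : Prop :=
  ∀ (α : Set T.El) (s c d a b : T.El), Ev x α s c a → Ev x α s d b →
    (a = b → Z (pr (pr (nt 0) (pr c d)) (nt 1)) α) ∧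
    (a ≠ b → Z (pr (pr (nt 0) (pr c d)) (nt 0)) α)

def SatRelSym (x : T.El) (Z : T.El → Set T.El → Prop) : Prop :=
  ∀ (α : Set T.El) (r q X cs as : T.El), (pr r q).1 ∈ (relsOf x).1 → (pr r X).1 ∈ (relIntOf x).1 →
    EvSeq x α q cs as →
    (as.1 ∈ X.1 → Z (pr (pr (nt 1) (pr r cs)) (nt 1)) α) ∧
    (as.1 ∉ X.1 → Z (pr (pr (nt 1) (pr r cs)) (nt 0)) α)

/-- The marker `nt 1` under the key of a relation variable says that the variable is assigned.
Without it an empty value could not be told from an unassigned variable. -/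
def SatRelVar (x : T.El) (Z : T.El → Set T.El → Prop) : Prop :=
  ∀ (α : Set T.El) (q n cs as : T.El), IsProf x q → IsNat n → pr (key₂ q n) (nt 1) ∈ α →
    EvSeq x α q cs as →
    (pr (key₂ q n) as ∈ α → Z (pr (pr (nt 2) (pr (pr q n) cs)) (nt 1)) α) ∧
    (pr (key₂ q n) as ∉ α → Z (pr (pr (nt 2) (pr (pr q n) cs)) (nt 0)) α)

def SatNeg (Z : T.El → Set T.El → Prop) : Prop :=
  ∀ (α : Set T.El) (c : T.El),
    (Z (pr c (nt 1)) α → Z (pr (pr (nt 3) c) (nt 0)) α) ∧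
    (Z (pr c (nt 0)) α → Z (pr (pr (nt 3) c) (nt 1)) α)

def SatAnd (Z : T.El → Set T.El → Prop) : Prop :=
  ∀ (α : Set T.El) (c d : T.El),
    (Z (pr c (nt 1)) α → Z (pr d (nt 1)) α → Z (pr (pr (nt 4) (pr c d)) (nt 1)) α) ∧
    (Z (pr c (nt 0)) α → Z (pr d (nt 0)) α → Z (pr (pr (nt 4) (pr c d)) (nt 0)) α) ∧
    (Z (pr c (nt 1)) α → Z (pr d (nt 0)) α → Z (pr (pr (nt 4) (pr c d)) (nt 0)) α) ∧
    (Z (pr c (nt 0)) α → Z (pr d (nt 1)) α → Z (pr (pr (nt 4) (pr c d)) (nt 0)) α)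

def SatAll₁ (x : T.El) (Z : T.El → Set T.El → Prop) : Prop :=
  ∀ (α : Set T.El) (s n c D : T.El), IsNat n → (pr s D).1 ∈ (domsOf x).1 →
    ((∀ a : T.El, a.1 ∈ D.1 → Z (pr c (nt 1)) (upd α (key₁ s n) {e | e = a})) →
      Z (pr (pr (nt 5) (pr (pr s n) c)) (nt 1)) α) ∧
    ∀ a : T.El, a.1 ∈ D.1 → Z (pr c (nt 0)) (upd α (key₁ s n) {e | e = a}) →
      Z (pr (pr (nt 5) (pr (pr s n) c)) (nt 0)) α

def SatAll₂ (x : T.El) (Z : T.El → Set T.El → Prop) : Prop :=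
  ∀ (α : Set T.El) (q n c : T.El), IsNat n → IsProf x q →
    ((∀ Y : Set T.El, (∀ t, t ∈ Y → IsTup x q t) →
        Z (pr c (nt 1)) (upd α (key₂ q n) {e | e = nt 1 ∨ e ∈ Y})) →
      Z (pr (pr (nt 6) (pr (pr q n) c)) (nt 1)) α) ∧
    ∀ Y : Set T.El, (∀ t, t ∈ Y → IsTup x q t) →
      Z (pr c (nt 0)) (upd α (key₂ q n) {e | e = nt 1 ∨ e ∈ Y}) →
        Z (pr (pr (nt 6) (pr (pr q n) c)) (nt 0)) α

/-- `Z (c, b) α` is closed under the clauses of the definition of satisfaction: it says that the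
formula `c` has the truth value `b` under the partial assignment `α`. -/
def SatClosed (x : T.El) (Z : T.El → Set T.El → Prop) : Prop :=
  SatEq x Z ∧ SatRelSym x Z ∧ SatRelVar x Z ∧ SatNeg Z ∧ SatAnd Z ∧ SatAll₁ x Z ∧ SatAll₂ x Z

/-- `y` is a sentence that is true in the structure `x`. -/
def SatIn (x y : T.El) : Prop :=
  IsStr x ∧ ∀ Z : T.El → Set T.El → Prop, SatClosed x Z → Z (pr y (nt 1)) ∅

end defs

end AdjClosed

/-! ### Definability of structure codes and satisfaction over T -/

section definability

set_option synthInstance.maxSize 100000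
set_option synthInstance.maxHeartbeats 400000

variable {n : ℕ} {f g h k l : ∀ T : AdjClosed.{u}, (Fin n → ZFSet.{u}) → T.El}

instance D3.isProf [D3El f] [D3El g] : D3 fun T w => IsProf (f T w) (g T w) :=
  D3.el2 (Q := fun T x q => IsProf x q) (by unfold IsProf; infer_instance)

instance D3.isTup [D3El f] [D3El g] [D3El h] : D3 fun T w => IsTup (f T w) (g T w) (h T w) :=
  D3.el3 (Q := fun T x q t => IsTup x q t) (by unfold IsTup; infer_instance)

theorem D3.isStr [D3El f] : D3 fun T w => IsStr (f T w) := by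
  refine D3.el1 (Q := fun T x => IsStr x) ?_
  have h1 : D3 fun T (v : Fin 1 → ZFSet.{u}) => RelsOK (T.toEl (v 0)) := by
    unfold RelsOK; infer_instance
  have h2 : D3 fun T (v : Fin 1 → ZFSet.{u}) => FnsOK (T.toEl (v 0)) := by
    unfold FnsOK; infer_instance
  have h3 : D3 fun T (v : Fin 1 → ZFSet.{u}) => DomsOK (T.toEl (v 0)) := by
    unfold DomsOK; infer_instance
  have h4 : D3 fun T (v : Fin 1 → ZFSet.{u}) => RelIntOK (T.toEl (v 0)) := by
    unfold RelIntOK; infer_instance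
  have h5 : D3 fun T (v : Fin 1 → ZFSet.{u}) => FnIntOK (T.toEl (v 0)) := by
    unfold FnIntOK FnGraphOK; infer_instance
  unfold IsStr
  infer_instance

variable {F : ∀ T : AdjClosed.{u}, (Fin n → ZFSet.{u}) → Set T.El}

instance D3.ev [D3El f] [D3Set F] [D3El g] [D3El h] [D3El k] :
    D3 fun T w => Ev (f T w) (F T w) (g T w) (h T w) (k T w) :=
  D3.el_set_el3 (Q := fun T x α s c a => Ev x α s c a) (by unfold Ev EvClosed; infer_instance)

instance D3.evSeq [D3El f] [D3Set F] [D3El g] [D3El h] [D3El k] :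
    D3 fun T w => EvSeq (f T w) (F T w) (g T w) (h T w) (k T w) :=
  D3.el_set_el3 (Q := fun T x α q c a => EvSeq x α q c a) (by unfold EvSeq; infer_instance)

theorem D3.satClosed (i j : Fin n) :
    D3 fun (T : AdjClosed.{u}) w => SatClosed (T.toEl (w i)) (T.toRel (w j)) := by
  have h1 : D3 fun (T : AdjClosed.{u}) w => SatEq (T.toEl (w i)) (T.toRel (w j)) := by
    unfold SatEq; infer_instance
  have h2 : D3 fun (T : AdjClosed.{u}) w => SatRelSym (T.toEl (w i)) (T.toRel (w j)) := by
    unfold SatRelSym; infer_instance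
  have h3 : D3 fun (T : AdjClosed.{u}) w => SatRelVar (T.toEl (w i)) (T.toRel (w j)) := by
    unfold SatRelVar; infer_instance
  have h4 : D3 fun (T : AdjClosed.{u}) (w : Fin n → ZFSet.{u}) => SatNeg (T.toRel (w j)) := by
    unfold SatNeg; infer_instance
  have h5 : D3 fun (T : AdjClosed.{u}) (w : Fin n → ZFSet.{u}) => SatAnd (T.toRel (w j)) := by
    unfold SatAnd; infer_instance
  have h6 : D3 fun (T : AdjClosed.{u}) w => SatAll₁ (T.toEl (w i)) (T.toRel (w j)) := by
    unfold SatAll₁ upd; infer_instance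
  have h7 : D3 fun (T : AdjClosed.{u}) w => SatAll₂ (T.toEl (w i)) (T.toRel (w j)) := by
    unfold SatAll₂ upd; infer_instance
  unfold SatClosed
  infer_instance

theorem D3.satIn (i j : Fin n) :
    D3 fun (T : AdjClosed.{u}) w => SatIn (T.toEl (w i)) (T.toEl (w j)) := by
  have h1 : D3 fun (T : AdjClosed.{u}) w => IsStr (T.toEl (w i)) := D3.isStr
  have h2 := D3.satClosed (n := n + 1) i.castSucc (Fin.last n)
  unfold SatIn
  infer_instance

end definability

end BddSymb

namespace BddSymb

open Cardinal AdjClosed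

/-! ## Unique readability -/

section readability

variable {τ : Vocab.{u}} (ν : Naming τ)

/-- An application has no separate entry for its sort in its code, so injectivity is proved across
sorts; the function symbol determines the sort. -/
theorem Term.code_inj_sigma {s s' : τ.Srt} (t : Term τ s) (t' : Term τ s')
    (h : t.code ν = t'.code ν) : (⟨s, t⟩ : Σ s, Term τ s) = ⟨s', t'⟩ := by
  induction t generalizing s' with
  | var s n =>
    cases t' with
    | var s' m =>
      simp only [Term.code, ZFSet.pair_inj, natCode_inj, ν.srt.injective.eq_iff] at h
      obtain ⟨-, rfl, rfl⟩ := h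
      rfl
    | app f ts => simp [Term.code, ZFSet.pair_inj] at h
  | app f ts ih =>
    cases t' with
    | var s' m => simp [Term.code, ZFSet.pair_inj] at h
    | app f' ts' =>
      simp only [Term.code, ZFSet.pair_inj, ν.fn.injective.eq_iff] at h
      obtain ⟨-, rfl, h⟩ := h
      rw [seqCode_inj] at h
      have : ts = ts' := by
        funext i
        have := ih i (ts' i) (congrFun h i)
        exact eq_of_heq (Sigma.mk.inj this).2
      rw [this]

theorem Term.code_injective {s : τ.Srt} {t t' : Term τ s} (h : t.code ν = t'.code ν) : t = t' :=
  eq_of_heq (Sigma.mk.inj (t.code_inj_sigma ν t' h)).2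

theorem Term.seq_injective {p : Profile τ.Srt} {ts ts' : ∀ i, Term τ (p.sort i)}
    (h : seqCode (fun i => (ts i).code ν) = seqCode fun i => (ts' i).code ν) : ts = ts' := by
  rw [seqCode_inj] at h
  funext i
  exact Term.code_injective ν (congrFun h i)

theorem Naming.profile_injective : Function.Injective ν.profile := by
  rintro ⟨n, p⟩ ⟨m, q⟩ h
  obtain rfl : n = m := seqCode_len h
  have := seqCode_inj.1 h
  have : p = q := by
    funext i
    exact ν.srt.injective (congrFun this i)
  rw [this]

/-- Needed for the quantifier clauses: each instance of the premise supplies some formula with the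
given code, and these must all be the same formula. -/
theorem Form.code_injective : Function.Injective (Form.code (τ := τ) ν) := by
  intro φ
  induction φ with
  | eq t₁ t₂ =>
    intro ψ h
    cases ψ <;> simp only [Form.code, ZFSet.pair_inj, natCode_inj] at h <;> try omega
    obtain ⟨-, h1, h2⟩ := h
    have h1 := Term.code_inj_sigma ν _ _ h1
    obtain ⟨rfl, h1⟩ := Sigma.mk.inj h1
    rw [eq_of_heq h1, Term.code_injective ν h2]
  | rel r ts =>
    intro ψ h
    cases ψ <;> simp only [Form.code, ZFSet.pair_inj, natCode_inj, ν.rel.injective.eq_iff] at h <;>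
      try omega
    obtain ⟨-, rfl, h2⟩ := h
    rw [Term.seq_injective ν h2]
  | rvar p n ts =>
    intro ψ h
    cases ψ <;> simp only [Form.code, ZFSet.pair_inj, natCode_inj, ν.profile_injective.eq_iff] at h <;>
      try omega
    obtain ⟨-, ⟨rfl, rfl⟩, h2⟩ := h
    rw [Term.seq_injective ν h2]
  | neg φ ih =>
    intro ψ h
    cases ψ <;> simp only [Form.code, ZFSet.pair_inj, natCode_inj] at h <;> try omega
    rw [ih h.2]
  | and φ χ ih1 ih2 =>
    intro ψ h
    cases ψ <;> simp only [Form.code, ZFSet.pair_inj, natCode_inj] at h <;> try omega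
    rw [ih1 h.2.1, ih2 h.2.2]
  | all₁ s n φ ih =>
    intro ψ h
    cases ψ <;> simp only [Form.code, ZFSet.pair_inj, natCode_inj, ν.srt.injective.eq_iff] at h <;>
      try omega
    obtain ⟨-, ⟨rfl, rfl⟩, h2⟩ := h
    rw [ih h2]
  | all₂ p n φ ih =>
    intro ψ h
    cases ψ <;> simp only [Form.code, ZFSet.pair_inj, natCode_inj, ν.profile_injective.eq_iff] at h <;>
      try omega
    obtain ⟨-, ⟨rfl, rfl⟩, h2⟩ := h
    rw [ih h2]

end readability

/-! ## The components of the code of a structure -/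

namespace AdjClosed

variable {T : AdjClosed.{u}}

theorem val_fst_snd {x : T.El} {a b : ZFSet.{u}} (h : x.1 = ZFSet.pair a b) :
    (fst x).1 = a ∧ (snd x).1 = b := by
  have h2 := T.mem_of_pair (h ▸ x.2)
  have : x = pr ⟨a, h2.1⟩ ⟨b, h2.2⟩ := Subtype.ext h
  rw [this]
  simp

section lookup

variable {τ : Vocab.{u}} {ν : Naming τ} {A : Str τ} {x : T.El} (hx : x.1 = A.code ν)

include hx

theorem mem_sortsOf {s : T.El} : s.1 ∈ (sortsOf x).1 ↔ ∃ σ, s.1 = ν.srt σ := by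
  rw [(val_fst_snd (val_fst_snd hx).1).1]
  simp [eq_comm]

theorem mem_relsOf {r q : T.El} : (pr r q).1 ∈ (relsOf x).1 ↔
    ∃ ρ, r.1 = ν.rel ρ ∧ q.1 = ν.profile (τ.relDom ρ) := by
  rw [(val_fst_snd (val_fst_snd (val_fst_snd hx).1).2).1]
  simp [ZFSet.pair_inj, eq_comm]

theorem mem_fnsOf {f q s : T.El} : (pr f (pr q s)).1 ∈ (fnsOf x).1 ↔
    ∃ g, f.1 = ν.fn g ∧ q.1 = ν.profile (τ.fnDom g) ∧ s.1 = ν.srt (τ.fnCod g) := by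
  rw [(val_fst_snd (val_fst_snd (val_fst_snd hx).1).2).2]
  simp [ZFSet.pair_inj, eq_comm]

theorem mem_domsOf {s D : T.El} : (pr s D).1 ∈ (domsOf x).1 ↔
    ∃ σ, s.1 = ν.srt σ ∧ D.1 = A.dom σ := by
  rw [(val_fst_snd (val_fst_snd hx).2).1]
  simp [ZFSet.pair_inj, eq_comm]

theorem mem_relIntOf {r X : T.El} : (pr r X).1 ∈ (relIntOf x).1 ↔ ∃ ρ, r.1 = ν.rel ρ ∧
    X.1 = ZFSet.range fun t : {t // t ∈ A.rel ρ} => tupleCode t.1 := by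
  rw [(val_fst_snd (val_fst_snd (val_fst_snd hx).2).2).1]
  simp [ZFSet.pair_inj, eq_comm]

theorem mem_fnIntOf {f G : T.El} : (pr f G).1 ∈ (fnIntOf x).1 ↔ ∃ g, f.1 = ν.fn g ∧
    G.1 = ZFSet.range fun t : Tuple A.dom (τ.fnDom g) => ZFSet.pair (tupleCode t) (A.fn g t).1 := by
  rw [(val_fst_snd (val_fst_snd (val_fst_snd hx).2).2).2]
  simp [ZFSet.pair_inj, eq_comm]

theorem srt_mem (σ : τ.Srt) : ν.srt σ ∈ T.set := by
  have h := (val_fst_snd (val_fst_snd hx).1).1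
  exact T.trans _ (sortsOf x).2 (by rw [h]; simp)

theorem rel_mem (ρ : τ.Rel) : ν.rel ρ ∈ T.set := by
  have h := (val_fst_snd (val_fst_snd (val_fst_snd hx).1).2).1
  exact (T.mem_of_pair (b := ν.profile (τ.relDom ρ))
    (T.trans _ (relsOf x).2 (by rw [h]; simp))).1

theorem fn_mem (g : τ.Fn) : ν.fn g ∈ T.set := by
  have h := (val_fst_snd (val_fst_snd (val_fst_snd hx).1).2).2
  exact (T.mem_of_pair (b := ZFSet.pair (ν.profile (τ.fnDom g)) (ν.srt (τ.fnCod g)))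
    (T.trans _ (fnsOf x).2 (by rw [h]; simp))).1

theorem dom_mem (σ : τ.Srt) : A.dom σ ∈ T.set := by
  have h := (val_fst_snd (val_fst_snd hx).2).1
  exact (T.mem_of_pair (a := ν.srt σ) (T.trans _ (domsOf x).2 (by rw [h]; simp))).2

theorem relInt_mem (ρ : τ.Rel) :
    (ZFSet.range fun t : {t // t ∈ A.rel ρ} => tupleCode t.1) ∈ T.set := by
  have h := (val_fst_snd (val_fst_snd (val_fst_snd hx).2).2).1
  exact (T.mem_of_pair (a := ν.rel ρ) (T.trans _ (relIntOf x).2 (by rw [h]; simp))).2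

theorem fnInt_mem (g : τ.Fn) : (ZFSet.range fun t : Tuple A.dom (τ.fnDom g) =>
    ZFSet.pair (tupleCode t) (A.fn g t).1) ∈ T.set := by
  have h := (val_fst_snd (val_fst_snd (val_fst_snd hx).2).2).2
  exact (T.mem_of_pair (a := ν.fn g) (T.trans _ (fnIntOf x).2 (by rw [h]; simp))).2

theorem elt_mem {σ : τ.Srt} (a : A.El σ) : a.1 ∈ T.set := T.trans _ (dom_mem hx σ) a.2

theorem profile_mem (p : Profile τ.Srt) : ν.profile p ∈ T.set :=
  T.seqCode_mem fun i => srt_mem hx _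

theorem tupleCode_mem {p : Profile τ.Srt} (t : Tuple A.dom p) : tupleCode t ∈ T.set :=
  T.seqCode_mem fun i => elt_mem hx (t i)

/-- Terms are built by finite sequences and pairs from symbols and natural numbers, so closure under
adjunction is enough to keep all syntax inside T once T contains the structure. -/
theorem termCode_mem {s : τ.Srt} (t : Term τ s) : t.code ν ∈ T.set := by
  induction t with
  | var s n => exact T.pair_mem (T.natCode_mem _) (T.pair_mem (srt_mem hx s) (T.natCode_mem _))
  | app f ts ih => exact T.pair_mem (T.natCode_mem _) (T.pair_mem (fn_mem hx f) (T.seqCode_mem ih))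

theorem formCode_mem (φ : Form τ) : φ.code ν ∈ T.set := by
  induction φ with
  | eq t₁ t₂ =>
    exact T.pair_mem (T.natCode_mem _) (T.pair_mem (termCode_mem hx t₁) (termCode_mem hx t₂))
  | rel r ts =>
    exact T.pair_mem (T.natCode_mem _) (T.pair_mem (rel_mem hx r)
      (T.seqCode_mem fun i => termCode_mem hx _))
  | rvar p n ts =>
    exact T.pair_mem (T.natCode_mem _) (T.pair_mem (T.pair_mem (profile_mem hx p) (T.natCode_mem _))
      (T.seqCode_mem fun i => termCode_mem hx _))
  | neg φ ih => exact T.pair_mem (T.natCode_mem _) ih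
  | and φ ψ ih1 ih2 => exact T.pair_mem (T.natCode_mem _) (T.pair_mem ih1 ih2)
  | all₁ s n φ ih =>
    exact T.pair_mem (T.natCode_mem _) (T.pair_mem (T.pair_mem (srt_mem hx s) (T.natCode_mem _)) ih)
  | all₂ p n φ ih =>
    exact T.pair_mem (T.natCode_mem _)
      (T.pair_mem (T.pair_mem (profile_mem hx p) (T.natCode_mem _)) ih)

end lookup

theorem isSeq_of_val {N : ℕ} {z : Fin N → ZFSet.{u}} {q m : T.El} (hq : q.1 = seqCode z) :
    IsSeq m q ↔ m = nt N := by
  constructor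
  · rintro ⟨M, y, rfl, rfl⟩
    rw [sq_val] at hq
    rw [seqCode_len hq]
  · rintro rfl
    have hz : ∀ i, z i ∈ T.set := fun i =>
      (T.mem_of_pair (T.trans _ q.2 (by rw [hq, mem_seqCode]; exact ⟨i, rfl⟩))).2
    exact ⟨N, fun i => ⟨z i, hz i⟩, rfl, Subtype.ext hq⟩

theorem pr_mem_of_val {N : ℕ} {z : Fin N → ZFSet.{u}} {q i a : T.El} (hq : q.1 = seqCode z) :
    (pr i a).1 ∈ q.1 ↔ ∃ k : Fin N, i = nt k ∧ a.1 = z k := by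
  rw [hq, pr_val, pair_mem_seqCode]
  exact exists_congr fun k => and_congr (by rw [Subtype.ext_iff, nt_val]) Iff.rfl

theorem isSeq_nt {N : ℕ} {q : T.El} : IsSeq (nt N) q ↔ ∃ y : Fin N → T.El, q = sq y := by
  constructor
  · rintro ⟨M, y, h, rfl⟩
    obtain rfl := nt_inj.1 h
    exact ⟨y, rfl⟩
  · rintro ⟨y, rfl⟩
    exact ⟨N, y, rfl, rfl⟩

/-- Only the sorts and the domain function enter, because this is also used while a structure is
still being reconstructed from `x`. -/
theorem isTup_iff_of_doms {S : Type u} {ι : S ↪ ZFSet.{u}} {dom : S → ZFSet.{u}} {x : T.El}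
    (hs : ∀ σ, ι σ ∈ T.set) (hd : ∀ σ, dom σ ∈ T.set)
    (hdoms : ∀ s D : T.El, (pr s D).1 ∈ (domsOf x).1 ↔ ∃ σ, s.1 = ι σ ∧ D.1 = dom σ)
    {p : Profile S} {q t : T.El} (hq : q.1 = seqCode fun i => ι (p.sort i)) :
    IsTup x q t ↔ ∃ t' : Tuple dom p, t.1 = tupleCode t' := by
  constructor
  · rintro ⟨m, h1, h2, h3⟩
    obtain rfl := (isSeq_of_val hq).1 h1
    obtain ⟨y, rfl⟩ := isSeq_nt.1 h2
    have h4 : ∀ i, (y i).1 ∈ dom (p.sort i) := by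
      intro i
      obtain ⟨D, hD, hy⟩ := h3 (nt i) ⟨_, hs (p.sort i)⟩ (y i)
        ((pr_mem_of_val hq).2 ⟨i, rfl, rfl⟩) (pr_mem_sq.2 ⟨i, rfl, rfl⟩)
      obtain ⟨σ, h5, h6⟩ := (hdoms _ _).1 hD
      rw [ι.injective h5, ← h6]
      exact hy
    exact ⟨fun i => ⟨_, h4 i⟩, rfl⟩
  · rintro ⟨t', ht⟩
    refine ⟨_, (isSeq_of_val hq).2 rfl, (isSeq_of_val ht).2 rfl, fun i s a h5 ha => ?_⟩
    obtain ⟨k, rfl, hk⟩ := (pr_mem_of_val hq).1 h5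
    obtain ⟨l, h1, hl⟩ := (pr_mem_of_val ht).1 ha
    obtain rfl : k = l := Fin.ext (nt_inj.1 h1)
    exact ⟨⟨_, hd (p.sort k)⟩, (hdoms _ _).2 ⟨_, hk, rfl⟩, hl ▸ (t' k).2⟩

section lookup

variable {τ : Vocab.{u}} {ν : Naming τ} {A : Str τ} {x : T.El} (hx : x.1 = A.code ν)

include hx

theorem isProf_iff {q : T.El} : IsProf x q ↔ ∃ p, q.1 = ν.profile p := by
  constructor
  · rintro ⟨m, ⟨N, y, rfl, rfl⟩, h⟩
    have h2 : ∀ i, ∃ σ, (y i).1 = ν.srt σ := fun i =>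
      (mem_sortsOf hx).1 (h (nt i) (y i) (pr_mem_sq.2 ⟨i, rfl, rfl⟩))
    choose σ hσ using h2
    refine ⟨⟨N, σ⟩, ?_⟩
    simp only [sq_val, Naming.profile, hσ]
  · rintro ⟨p, hp⟩
    refine ⟨_, (isSeq_of_val hp).2 rfl, fun i s his => ?_⟩
    obtain ⟨k, rfl, hk⟩ := (pr_mem_of_val hp).1 his
    exact (mem_sortsOf hx).2 ⟨_, hk⟩

theorem isTup_iff {p : Profile τ.Srt} {q t : T.El} (hq : q.1 = ν.profile p) :
    IsTup x q t ↔ ∃ t' : Tuple A.dom p, t.1 = tupleCode t' :=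
  isTup_iff_of_doms (srt_mem hx) (dom_mem hx) (fun _ _ => mem_domsOf hx) hq

end lookup

end AdjClosed

end BddSymb

namespace BddSymb

open Cardinal AdjClosed

/-! ### Correctness of the inductive definition of satisfaction -/

namespace AdjClosed

variable {T : AdjClosed.{u}}

/-- The set `α` codes the assignments `v` and `V`, restricted to the variables in `D₁` and `D₂`. -/
def Rep {τ : Vocab.{u}} (ν : Naming τ) {A : Str τ} (α : Set T.El) (v : ∀ y : τ.Srt × ℕ, A.El y.1)
    (V : ∀ X : Profile τ.Srt × ℕ, Set (Tuple A.dom X.1)) (D₁ : Set (τ.Srt × ℕ))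
    (D₂ : Set (Profile τ.Srt × ℕ)) : Prop :=
  (∀ σ n (s e : T.El), s.1 = ν.srt σ →
    (pr (key₁ s (nt n)) e ∈ α ↔ (σ, n) ∈ D₁ ∧ e.1 = (v (σ, n)).1)) ∧
  ∀ p n (q e : T.El), q.1 = ν.profile p →
    (pr (key₂ q (nt n)) e ∈ α ↔ (p, n) ∈ D₂ ∧ (e = nt 1 ∨ ∃ t ∈ V (p, n), e.1 = tupleCode t))

@[simp] theorem mem_upd {α : Set T.El} {k : T.El} {Y : Set T.El} {l a : T.El} :
    pr l a ∈ upd α k Y ↔ (l = k ∧ a ∈ Y) ∨ (l ≠ k ∧ pr l a ∈ α) := by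
  constructor
  · rintro ⟨l', a', h, h2⟩
    obtain ⟨rfl, rfl⟩ := pr_inj.1 h
    exact h2
  · intro h
    exact ⟨l, a, rfl, h⟩

/-- Keeps the marker apart from the members of a relation value: {∅} is no set of ordered pairs. The
numeral 0 could not serve as marker, since the empty tuple has code ∅. -/
theorem nt_one_ne_tupleCode {S : Type u} {dom : S → ZFSet.{u}} {p : Profile S} (t : Tuple dom p) :
    natCode 1 ≠ tupleCode t := by
  intro h
  have h1 : natCode 0 ∈ tupleCode t := by rw [← h, mem_natCode]; exact ⟨0, by simp, rfl⟩
  obtain ⟨i, hi⟩ := mem_seqCode.1 h1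
  have h2 : ({natCode i} : ZFSet) ∈ natCode.{u} 0 := by
    rw [hi]; simp [ZFSet.pair]
  exact ZFSet.notMem_empty _ h2

section rep

variable {τ : Vocab.{u}} {ν : Naming τ} {A : Str τ} {α : Set T.El}
  {v : ∀ y : τ.Srt × ℕ, A.El y.1} {V : ∀ X : Profile τ.Srt × ℕ, Set (Tuple A.dom X.1)}
  {D₁ : Set (τ.Srt × ℕ)} {D₂ : Set (Profile τ.Srt × ℕ)}

open Classical in
theorem Rep.upd₁ (h : Rep ν α v V D₁ D₂) {σ : τ.Srt} {n : ℕ} {s a : T.El} (hs : s.1 = ν.srt σ)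
    (a' : A.El σ) (ha : a.1 = a'.1) :
    Rep ν (upd α (key₁ s (nt n)) {e | e = a}) (Function.update v (σ, n) a') V
      (insert (σ, n) D₁) D₂ := by
  constructor
  · intro σ' n' s' e hs'
    rw [mem_upd, h.1 σ' n' s' e hs']
    have h1 : key₁ s' (nt n') = key₁ s (nt n) ↔ (σ', n') = (σ, n) := by
      rw [pr_inj, pr_inj, Subtype.ext_iff (a1 := s'), hs, hs', ν.srt.injective.eq_iff, nt_inj,
        Prod.mk.injEq]
      simp
    rw [Ne, h1]
    by_cases h2 : (σ', n') = (σ, n)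
    · obtain ⟨rfl, rfl⟩ := Prod.mk.inj h2
      simp [Subtype.ext_iff (a1 := e), ha]
    · rw [Function.update_of_ne h2]
      simp only [h2, false_and, not_false_iff, true_and, false_or, Set.mem_insert_iff]
  · intro p n' q e hq
    rw [mem_upd, h.2 p n' q e hq]
    have : key₂ q (nt n') ≠ key₁ s (nt n) := by simp
    simp [this]

open Classical in
theorem Rep.upd₂ (h : Rep ν α v V D₁ D₂) {p : Profile τ.Srt} {n : ℕ} {q : T.El} {Y : Set T.El}
    (hq : q.1 = ν.profile p) (Z : Set (Tuple A.dom p))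
    (hY : ∀ e : T.El, e ∈ Y ↔ ∃ t ∈ Z, e.1 = tupleCode t) :
    Rep ν (upd α (key₂ q (nt n)) {e | e = nt 1 ∨ e ∈ Y}) v (Function.update V (p, n) Z)
      D₁ (insert (p, n) D₂) := by
  constructor
  · intro σ n' s e hs
    rw [mem_upd, h.1 σ n' s e hs]
    have : key₁ s (nt n') ≠ key₂ q (nt n) := by simp
    simp [this]
  · intro p' n' q' e hq'
    rw [mem_upd, h.2 p' n' q' e hq']
    have h1 : key₂ q' (nt n') = key₂ q (nt n) ↔ (p', n') = (p, n) := by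
      rw [pr_inj, pr_inj, Subtype.ext_iff (a1 := q'), hq, hq', ν.profile_injective.eq_iff, nt_inj,
        Prod.mk.injEq]
      simp
    rw [Ne, h1]
    by_cases h2 : (p', n') = (p, n)
    · obtain ⟨rfl, rfl⟩ := Prod.mk.inj h2
      simp only [true_and, not_true_eq_false, false_and, or_false, Set.mem_insert_iff, true_or,
        Function.update_self]
      change e = nt 1 ∨ e ∈ Y ↔ _
      rw [hY]
    · rw [Function.update_of_ne h2]
      simp only [h2, false_and, not_false_iff, true_and, false_or, Set.mem_insert_iff]

/-- The empty set represents all assignments, with empty domains. A formula derived as true under ∅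
therefore has no free variables and holds under every assignment. -/
theorem rep_empty (v : ∀ y : τ.Srt × ℕ, A.El y.1)
    (V : ∀ X : Profile τ.Srt × ℕ, Set (Tuple A.dom X.1)) : Rep ν (∅ : Set T.El) v V ∅ ∅ :=
  ⟨by simp, by simp⟩

end rep

/-! ### Evaluation of terms -/

section terms

variable {τ : Vocab.{u}} {ν : Naming τ} {A : Str τ} {x : T.El} (hx : x.1 = A.code ν)

include hx

/-- Induction over the least closed set: the triples with the claimed property form a set closed
under evaluation. The conclusion shows not only the value but also that `c` is a genuine term whose
variables are assigned. -/
theorem exists_of_ev {α : Set T.El} {s c a : T.El} (h : Ev x α s c a) :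
    ∃ σ, ∃ t : Term τ σ, s.1 = ν.srt σ ∧ c.1 = t.code ν ∧
      ∀ (v : ∀ y : τ.Srt × ℕ, A.El y.1) V D₁ D₂, Rep ν α v V D₁ D₂ →
        t.vars ⊆ D₁ ∧ a.1 = (t.eval A v).1 := by
  have key := h {e | ∃ s c a : T.El, e = pr s (pr c a) ∧ ∃ σ, ∃ t : Term τ σ, s.1 = ν.srt σ ∧
    c.1 = t.code ν ∧ ∀ (v : ∀ y : τ.Srt × ℕ, A.El y.1) V D₁ D₂, Rep ν α v V D₁ D₂ →
        t.vars ⊆ D₁ ∧ a.1 = (t.eval A v).1} ?_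
  · obtain ⟨s', c', a', h1, h2⟩ := key
    obtain ⟨rfl, h3⟩ := pr_inj.1 h1
    obtain ⟨rfl, rfl⟩ := pr_inj.1 h3
    exact h2
  clear h s c a
  constructor
  · intro s n a hs hn ha
    obtain ⟨σ, hσ⟩ := (mem_sortsOf hx).1 hs
    obtain ⟨k, rfl⟩ := hn
    refine ⟨s, _, a, rfl, σ, .var σ k, hσ, ?_, fun v V D₁ D₂ hr => ?_⟩
    · simp [Term.code, hσ]
    · have h2 := (hr.1 σ k s a hσ).1 ha
      exact ⟨by simpa [Term.vars] using h2.1, h2.2⟩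
  · intro f q s G m cs as b hf hG hq hcs has hi hb
    refine ⟨s, _, b, rfl, ?_⟩
    obtain ⟨g, hfg, hqg, hsg⟩ := (mem_fnsOf hx).1 hf
    obtain ⟨g', hfg', hGg⟩ := (mem_fnIntOf hx).1 hG
    obtain rfl : g = g' := ν.fn.injective (hfg.symm.trans hfg')
    obtain rfl := (isSeq_of_val hqg).1 hq
    obtain ⟨y, rfl⟩ := isSeq_nt.1 hcs
    obtain ⟨z, rfl⟩ := isSeq_nt.1 has
    have h1 : ∀ i, ∃ t : Term τ ((τ.fnDom g).sort i), (y i).1 = t.code ν ∧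
        ∀ (v : ∀ y : τ.Srt × ℕ, A.El y.1) V D₁ D₂, Rep ν α v V D₁ D₂ →
          t.vars ⊆ D₁ ∧ (z i).1 = (t.eval A v).1 := by
      intro i
      obtain ⟨s', c', a', h1, σ, t, h2, h3, h4⟩ := hi (nt i) ⟨_, srt_mem hx ((τ.fnDom g).sort i)⟩
        (y i) (z i) ((pr_mem_of_val hqg).2 ⟨i, rfl, rfl⟩) (pr_mem_sq.2 ⟨i, rfl, rfl⟩)
        (pr_mem_sq.2 ⟨i, rfl, rfl⟩)
      obtain ⟨rfl, h5⟩ := pr_inj.1 h1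
      obtain ⟨rfl, rfl⟩ := pr_inj.1 h5
      obtain rfl := ν.srt.injective h2
      exact ⟨t, h3, h4⟩
    choose ts hts hev using h1
    refine ⟨_, .app g ts, hsg, ?_, fun v V D₁ D₂ hr => ⟨?_, ?_⟩⟩
    · simp only [pr_val, nt_val, sq_val, Term.code, hfg, hts]
    · exact Set.iUnion_subset fun i => (hev i v V D₁ D₂ hr).1
    · rw [hGg, ZFSet.mem_range] at hb
      obtain ⟨t, ht⟩ := hb
      rw [pr_val, ZFSet.pair_inj] at ht
      have h2 : t = fun i => (ts i).eval A v := by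
        rw [← tupleCode_inj, ht.1, sq_val, tupleCode, seqCode_inj]
        exact funext fun i => (hev i v V D₁ D₂ hr).2
      rw [← ht.2, h2, Term.eval]

theorem ev_of_rep {α : Set T.El} {v : ∀ y : τ.Srt × ℕ, A.El y.1} {V D₁ D₂}
    (hr : Rep ν α v V D₁ D₂) {σ : τ.Srt} (t : Term τ σ) (ht : t.vars ⊆ D₁) {s c a : T.El}
    (hs : s.1 = ν.srt σ) (hc : c.1 = t.code ν) (ha : a.1 = (t.eval A v).1) : Ev x α s c a := by
  intro X hX
  induction t generalizing s c a with
  | var σ n =>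
    have : c = pr (nt 0) (pr s (nt n)) := Subtype.ext (by rw [hc]; simp [Term.code, hs])
    rw [this]
    refine hX.1 s (nt n) a ((mem_sortsOf hx).2 ⟨σ, hs⟩) ⟨n, rfl⟩ ?_
    exact (hr.1 σ n s a hs).2 ⟨ht (by simp [Term.vars]), ha⟩
  | app g ts ih =>
    have hc' : c = pr (nt 1) (pr ⟨_, fn_mem hx g⟩ (sq fun i => ⟨_, termCode_mem hx (ts i)⟩)) :=
      Subtype.ext (by rw [hc]; simp [Term.code])
    rw [hc']
    refine hX.2 _ ⟨_, profile_mem hx (τ.fnDom g)⟩ s ⟨_, fnInt_mem hx g⟩ (nt (τ.fnDom g).len) _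
      (sq fun i => ⟨_, elt_mem hx ((ts i).eval A v)⟩) a
      ((mem_fnsOf hx).2 ⟨g, rfl, rfl, hs⟩) ((mem_fnIntOf hx).2 ⟨g, rfl, rfl⟩)
      ((isSeq_of_val rfl).2 rfl) (isSeq_nt.2 ⟨_, rfl⟩) (isSeq_nt.2 ⟨_, rfl⟩) ?_ ?_
    · intro i s' c' a' hs' hc' ha'
      obtain ⟨k, rfl, hk⟩ := (pr_mem_of_val rfl).1 hs'
      obtain ⟨l, hl, rfl⟩ := pr_mem_sq.1 hc'
      obtain rfl : k = l := Fin.ext (nt_inj.1 hl)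
      obtain ⟨l, hl, rfl⟩ := pr_mem_sq.1 ha'
      obtain rfl : k = l := Fin.ext (nt_inj.1 hl)
      exact ih k ((Set.subset_iUnion _ k).trans ht) hk rfl rfl
    · rw [ZFSet.mem_range]
      exact ⟨fun i => (ts i).eval A v, by rw [pr_val, ha]; rfl⟩

theorem exists_of_evSeq {α : Set T.El} {p : Profile τ.Srt} {q cs as : T.El}
    (hq : q.1 = ν.profile p) (h : EvSeq x α q cs as) :
    ∃ ts : ∀ i, Term τ (p.sort i), cs.1 = seqCode (fun i => (ts i).code ν) ∧
      ∀ (v : ∀ y : τ.Srt × ℕ, A.El y.1) V D₁ D₂, Rep ν α v V D₁ D₂ →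
        (⋃ i, (ts i).vars) ⊆ D₁ ∧
          as.1 = tupleCode (dom := A.dom) (p := p) fun i => (ts i).eval A v := by
  obtain ⟨m, h1, h2, h3, h4⟩ := h
  obtain rfl := (isSeq_of_val hq).1 h1
  obtain ⟨y, rfl⟩ := isSeq_nt.1 h2
  obtain ⟨z, rfl⟩ := isSeq_nt.1 h3
  have h5 : ∀ i, ∃ t : Term τ (p.sort i), (y i).1 = t.code ν ∧
      ∀ (v : ∀ y : τ.Srt × ℕ, A.El y.1) V D₁ D₂, Rep ν α v V D₁ D₂ →
        t.vars ⊆ D₁ ∧ (z i).1 = (t.eval A v).1 := by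
    intro i
    obtain ⟨σ, t, h6, h7, h8⟩ := exists_of_ev hx <| h4 (nt i) ⟨_, srt_mem hx (p.sort i)⟩ (y i) (z i)
      ((pr_mem_of_val hq).2 ⟨i, rfl, rfl⟩) (pr_mem_sq.2 ⟨i, rfl, rfl⟩) (pr_mem_sq.2 ⟨i, rfl, rfl⟩)
    obtain rfl := ν.srt.injective h6
    exact ⟨t, h7, h8⟩
  choose ts hts hev using h5
  refine ⟨ts, by simp only [sq_val, hts], fun v V D₁ D₂ hr => ⟨?_, ?_⟩⟩
  · exact Set.iUnion_subset fun i => (hev i v V D₁ D₂ hr).1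
  · rw [sq_val, tupleCode, seqCode_inj]
    exact funext fun i => (hev i v V D₁ D₂ hr).2

theorem evSeq_of_rep {α : Set T.El} {v : ∀ y : τ.Srt × ℕ, A.El y.1} {V D₁ D₂}
    (hr : Rep ν α v V D₁ D₂) {p : Profile τ.Srt} (ts : ∀ i, Term τ (p.sort i))
    (ht : (⋃ i, (ts i).vars) ⊆ D₁) {q cs as : T.El}
    (hq : q.1 = ν.profile p) (hc : cs.1 = seqCode (fun i => (ts i).code ν))
    (ha : as.1 = tupleCode (dom := A.dom) (p := p) fun i => (ts i).eval A v) :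
    EvSeq x α q cs as := by
  refine ⟨_, (isSeq_of_val hq).2 rfl, (isSeq_of_val hc).2 rfl, (isSeq_of_val ha).2 rfl, ?_⟩
  intro i s' c' a' hs' hc' ha'
  obtain ⟨k, rfl, hk⟩ := (pr_mem_of_val hq).1 hs'
  obtain ⟨l, hl, h1⟩ := (pr_mem_of_val hc).1 hc'
  obtain rfl : k = l := Fin.ext (nt_inj.1 hl)
  obtain ⟨l, hl, h2⟩ := (pr_mem_of_val ha).1 ha'
  obtain rfl : k = l := Fin.ext (nt_inj.1 hl)
  exact ev_of_rep hx hr (ts k) ((Set.subset_iUnion _ k).trans ht) hk h1 h2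

end terms

/-- The intended meaning of `SatClosed`. -/
def Sem {τ : Vocab.{u}} (ν : Naming τ) (A : Str τ) (k : T.El) (α : Set T.El) : Prop :=
  ∃ (φ : Form τ) (c : T.El) (b : ℕ), k = pr c (nt b) ∧ c.1 = φ.code ν ∧ (b = 0 ∨ b = 1) ∧
    ∀ (v : ∀ y : τ.Srt × ℕ, A.El y.1) V D₁ D₂, Rep ν α v V D₁ D₂ →
      φ.free₁ ⊆ D₁ ∧ φ.free₂ ⊆ D₂ ∧ (b = 1 ↔ φ.Realize A v V)

theorem Sem.one {τ : Vocab.{u}} {ν : Naming τ} {A : Str τ} {c : T.El} {α : Set T.El}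
    {φ : Form τ} (hc : c.1 = φ.code ν)
    (h : ∀ (v : ∀ y : τ.Srt × ℕ, A.El y.1) V D₁ D₂, Rep ν α v V D₁ D₂ →
      φ.free₁ ⊆ D₁ ∧ φ.free₂ ⊆ D₂ ∧ φ.Realize A v V) : Sem ν A (pr c (nt 1)) α :=
  ⟨φ, c, 1, rfl, hc, Or.inr rfl, by simpa using h⟩

theorem Sem.zero {τ : Vocab.{u}} {ν : Naming τ} {A : Str τ} {c : T.El} {α : Set T.El}
    {φ : Form τ} (hc : c.1 = φ.code ν)
    (h : ∀ (v : ∀ y : τ.Srt × ℕ, A.El y.1) V D₁ D₂, Rep ν α v V D₁ D₂ →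
      φ.free₁ ⊆ D₁ ∧ φ.free₂ ⊆ D₂ ∧ ¬ φ.Realize A v V) : Sem ν A (pr c (nt 0)) α :=
  ⟨φ, c, 0, rfl, hc, Or.inl rfl, by simpa using h⟩

theorem Sem.exists_one {τ : Vocab.{u}} {ν : Naming τ} {A : Str τ} {c : T.El} {α : Set T.El}
    (h : Sem ν A (pr c (nt 1)) α) : ∃ φ : Form τ, c.1 = φ.code ν ∧
    ∀ (v : ∀ y : τ.Srt × ℕ, A.El y.1) V D₁ D₂, Rep ν α v V D₁ D₂ →
      φ.free₁ ⊆ D₁ ∧ φ.free₂ ⊆ D₂ ∧ φ.Realize A v V := by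
  obtain ⟨φ, c', b, h1, h2, h3, h4⟩ := h
  obtain ⟨rfl, h5⟩ := pr_inj.1 h1
  obtain rfl := nt_inj.1 h5
  exact ⟨φ, h2, by simpa using h4⟩

theorem Sem.exists_zero {τ : Vocab.{u}} {ν : Naming τ} {A : Str τ} {c : T.El} {α : Set T.El}
    (h : Sem ν A (pr c (nt 0)) α) : ∃ φ : Form τ, c.1 = φ.code ν ∧
    ∀ (v : ∀ y : τ.Srt × ℕ, A.El y.1) V D₁ D₂, Rep ν α v V D₁ D₂ →
      φ.free₁ ⊆ D₁ ∧ φ.free₂ ⊆ D₂ ∧ ¬ φ.Realize A v V := by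
  obtain ⟨φ, c', b, h1, h2, h3, h4⟩ := h
  obtain ⟨rfl, h5⟩ := pr_inj.1 h1
  obtain rfl := nt_inj.1 h5
  exact ⟨φ, h2, by simpa using h4⟩

/-! ### Soundness and completeness of the satisfaction clauses -/

section forms

variable {τ : Vocab.{u}} {ν : Naming τ} {A : Str τ}

theorem sdiff_subset_of_subset_insert {β : Type*} {s t : Set β} {a : β} (h : s ⊆ insert a t) :
    s \ {a} ⊆ t := by
  rintro b ⟨hb, hba⟩
  exact (h hb).resolve_left hba

theorem satNeg_sem : SatNeg (T := T) (Sem ν A) := by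
  intro α c
  constructor
  · intro h
    obtain ⟨φ, hc, h⟩ := h.exists_one
    refine Sem.zero (φ := .neg φ) (by simp [hc, Form.code]) fun v V D₁ D₂ hr => ?_
    obtain ⟨h1, h2, h3⟩ := h v V D₁ D₂ hr
    exact ⟨h1, h2, fun h => h h3⟩
  · intro h
    obtain ⟨φ, hc, h⟩ := h.exists_zero
    refine Sem.one (φ := .neg φ) (by simp [hc, Form.code]) fun v V D₁ D₂ hr => ?_
    obtain ⟨h1, h2, h3⟩ := h v V D₁ D₂ hr
    exact ⟨h1, h2, h3⟩

theorem satAnd_sem : SatAnd (T := T) (Sem ν A) := by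
  intro α c d
  refine ⟨fun h h' => ?_, fun h h' => ?_, fun h h' => ?_, fun h h' => ?_⟩
  · obtain ⟨φ, hc, h⟩ := h.exists_one
    obtain ⟨ψ, hd, h'⟩ := h'.exists_one
    refine Sem.one (φ := .and φ ψ) (by simp [hc, hd, Form.code]) fun v V D₁ D₂ hr => ?_
    obtain ⟨h1, h2, h3⟩ := h v V D₁ D₂ hr
    obtain ⟨h4, h5, h6⟩ := h' v V D₁ D₂ hr
    exact ⟨Set.union_subset h1 h4, Set.union_subset h2 h5, h3, h6⟩
  all_goals
    first
    | obtain ⟨φ, hc, h⟩ := h.exists_one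
    | obtain ⟨φ, hc, h⟩ := h.exists_zero
    first
    | obtain ⟨ψ, hd, h'⟩ := h'.exists_one
    | obtain ⟨ψ, hd, h'⟩ := h'.exists_zero
    refine Sem.zero (φ := .and φ ψ) (by simp [hc, hd, Form.code]) fun v V D₁ D₂ hr => ?_
    obtain ⟨h1, h2, h3⟩ := h v V D₁ D₂ hr
    obtain ⟨h4, h5, h6⟩ := h' v V D₁ D₂ hr
    refine ⟨Set.union_subset h1 h4, Set.union_subset h2 h5, fun h => ?_⟩
    first
    | exact h3 h.1
    | exact h6 h.2

variable {x : T.El} (hx : x.1 = A.code ν)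

include hx

theorem satEq_sem : SatEq x (Sem ν A) := by
  intro α s c d a b h1 h2
  obtain ⟨σ, t, hs, hc, h1⟩ := exists_of_ev hx h1
  obtain ⟨σ', t', hs', hd, h2⟩ := exists_of_ev hx h2
  obtain rfl := ν.srt.injective (hs.symm.trans hs')
  constructor
  · rintro rfl
    refine Sem.one (φ := .eq t t') (by simp [hc, hd, Form.code]) fun v V D₁ D₂ hr => ?_
    obtain ⟨h3, h4⟩ := h1 v V D₁ D₂ hr
    obtain ⟨h5, h6⟩ := h2 v V D₁ D₂ hr
    exact ⟨Set.union_subset h3 h5, Set.empty_subset _, Subtype.ext (h4.symm.trans h6)⟩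
  · intro hab
    refine Sem.zero (φ := .eq t t') (by simp [hc, hd, Form.code]) fun v V D₁ D₂ hr => ?_
    obtain ⟨h3, h4⟩ := h1 v V D₁ D₂ hr
    obtain ⟨h5, h6⟩ := h2 v V D₁ D₂ hr
    refine ⟨Set.union_subset h3 h5, Set.empty_subset _, fun h => hab (Subtype.ext ?_)⟩
    change t.eval A v = t'.eval A v at h
    rw [h4, h6, h]

theorem satRelSym_sem : SatRelSym x (Sem ν A) := by
  intro α r q X cs as h1 h2 h3
  obtain ⟨ρ, hr, hq⟩ := (mem_relsOf hx).1 h1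
  obtain ⟨ρ', hr', hX⟩ := (mem_relIntOf hx).1 h2
  obtain rfl := ν.rel.injective (hr.symm.trans hr')
  obtain ⟨ts, hcs, h3⟩ := exists_of_evSeq hx hq h3
  have hmem : ∀ t : Tuple A.dom (τ.relDom ρ), tupleCode t ∈ X.1 ↔ t ∈ A.rel ρ := by
    intro t
    rw [hX, ZFSet.mem_range]
    constructor
    · rintro ⟨⟨t', ht'⟩, h⟩
      rw [tupleCode_inj] at h
      exact h ▸ ht'
    · intro h
      exact ⟨⟨t, h⟩, rfl⟩
  constructor
  · intro h
    refine Sem.one (φ := .rel ρ ts) (by simp [hcs, hr, Form.code]) fun v V D₁ D₂ hr => ?_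
    obtain ⟨h4, h5⟩ := h3 v V D₁ D₂ hr
    rw [h5, hmem] at h
    exact ⟨h4, Set.empty_subset _, h⟩
  · intro h
    refine Sem.zero (φ := .rel ρ ts) (by simp [hcs, hr, Form.code]) fun v V D₁ D₂ hr => ?_
    obtain ⟨h4, h5⟩ := h3 v V D₁ D₂ hr
    rw [h5, hmem] at h
    exact ⟨h4, Set.empty_subset _, h⟩

theorem satRelVar_sem : SatRelVar x (Sem ν A) := by
  rintro α q n cs as h1 ⟨k, rfl⟩ h2 h3
  obtain ⟨p, hq⟩ := (isProf_iff hx).1 h1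
  obtain ⟨ts, hcs, h3⟩ := exists_of_evSeq hx hq h3
  have hmem : ∀ (v : ∀ y : τ.Srt × ℕ, A.El y.1) V D₁ D₂, Rep ν α v V D₁ D₂ →
      (pr (key₂ q (nt k)) as ∈ α ↔ (Form.rvar p k ts).Realize A v V) ∧ (p, k) ∈ D₂ := by
    intro v V D₁ D₂ hr
    have h4 := (hr.2 p k q _ hq).1 h2
    refine ⟨?_, h4.1⟩
    rw [hr.2 p k q _ hq]
    have h5 := (h3 v V D₁ D₂ hr).2
    -- A tuple found under the key must come from the relation and cannot be the marker.
    have h6 : as ≠ nt 1 := by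
      rw [Ne, Subtype.ext_iff, h5, nt_val]
      exact (nt_one_ne_tupleCode _).symm
    simp only [h4.1, h6, true_and, false_or, h5, tupleCode_inj]
    constructor
    · rintro ⟨t, ht, rfl⟩
      exact ht
    · intro h
      exact ⟨_, h, rfl⟩
  constructor
  · intro h
    refine Sem.one (φ := .rvar p k ts) (by simp [hcs, hq, Form.code]) fun v V D₁ D₂ hr => ?_
    obtain ⟨h4, h5⟩ := h3 v V D₁ D₂ hr
    obtain ⟨h6, h7⟩ := hmem v V D₁ D₂ hr
    exact ⟨h4, by simpa [Form.free₂] using h7, h6.1 h⟩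
  · intro h
    refine Sem.zero (φ := .rvar p k ts) (by simp [hcs, hq, Form.code]) fun v V D₁ D₂ hr => ?_
    obtain ⟨h4, h5⟩ := h3 v V D₁ D₂ hr
    obtain ⟨h6, h7⟩ := hmem v V D₁ D₂ hr
    exact ⟨h4, by simpa [Form.free₂] using h7, fun h8 => h (h6.2 h8)⟩

theorem satAll₁_sem : SatAll₁ x (Sem ν A) := by
  rintro α s n c D ⟨k, rfl⟩ hD
  obtain ⟨σ, hs, hD⟩ := (mem_domsOf hx).1 hD
  have hmem : ∀ a : A.El σ, (⟨a.1, elt_mem hx a⟩ : T.El).1 ∈ D.1 := fun a => by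
    rw [hD]; exact a.2
  constructor
  · intro h
    -- The premise concerns instances only; since domains are non-empty there is one, from which the
    -- quantified formula is read off.
    obtain ⟨a₀, ha₀⟩ := A.dom_nonempty σ
    obtain ⟨φ, hc, -⟩ := (h _ (hmem ⟨a₀, ha₀⟩)).exists_one
    refine Sem.one (φ := .all₁ σ k φ) (by simp [hc, hs, Form.code]) fun v V D₁ D₂ hr => ?_
    have key : ∀ a : A.El σ, φ.free₁ ⊆ insert (σ, k) D₁ ∧ φ.free₂ ⊆ D₂ ∧
        φ.Realize A (open Classical in Function.update v (σ, k) a) V := by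
      intro a
      obtain ⟨φ', hc', h2⟩ := (h _ (hmem a)).exists_one
      -- A priori each instance could provide a different formula.
      obtain rfl := Form.code_injective ν (hc.symm.trans hc')
      exact h2 _ _ _ _ (hr.upd₁ hs a rfl)
    exact ⟨sdiff_subset_of_subset_insert (key ⟨a₀, ha₀⟩).1, (key ⟨a₀, ha₀⟩).2.1,
      fun a => (key a).2.2⟩
  · intro a ha h
    obtain ⟨φ, hc, h⟩ := h.exists_zero
    rw [hD] at ha
    refine Sem.zero (φ := .all₁ σ k φ) (by simp [hc, hs, Form.code]) fun v V D₁ D₂ hr => ?_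
    obtain ⟨h1, h2, h3⟩ := h _ _ _ _ (hr.upd₁ hs ⟨a.1, ha⟩ rfl)
    exact ⟨sdiff_subset_of_subset_insert h1, h2, fun h => h3 (h _)⟩

theorem mem_iff_tupleCode {p : Profile τ.Srt} {q : T.El} (hq : q.1 = ν.profile p) {Y : Set T.El}
    (hY : ∀ t ∈ Y, IsTup x q t) (e : T.El) :
    e ∈ Y ↔ ∃ t ∈ {t : Tuple A.dom p | (⟨_, tupleCode_mem hx t⟩ : T.El) ∈ Y},
      e.1 = tupleCode t := by
  have key : ∀ t : Tuple A.dom p, e.1 = tupleCode t → e = ⟨_, tupleCode_mem hx t⟩ :=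
    fun t h => Subtype.ext h
  constructor
  · intro he
    obtain ⟨t, ht⟩ := (isTup_iff hx hq).1 (hY e he)
    exact ⟨t, by rw [Set.mem_ofPred_eq, ← key t ht]; exact he, ht⟩
  · rintro ⟨t, ht, he⟩
    rw [key t he]
    exact ht

theorem satAll₂_sem : SatAll₂ x (Sem ν A) := by
  rintro α q n c ⟨k, rfl⟩ hq
  obtain ⟨p, hq⟩ := (isProf_iff hx).1 hq
  constructor
  · intro h
    have hY : ∀ Z : Set (Tuple A.dom p), ∀ t ∈ {e : T.El | ∃ t ∈ Z, e.1 = tupleCode t},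
        IsTup x q t := by
      rintro Z e ⟨t, -, he⟩
      exact (isTup_iff hx hq).2 ⟨t, he⟩
    -- The empty relation is an instance that always exists.
    obtain ⟨φ, hc, -⟩ := (h _ (hY ∅)).exists_one
    refine Sem.one (φ := .all₂ p k φ) (by simp [hc, hq, Form.code]) fun v V D₁ D₂ hr => ?_
    have key : ∀ Z : Set (Tuple A.dom p), φ.free₁ ⊆ D₁ ∧ φ.free₂ ⊆ insert (p, k) D₂ ∧
        φ.Realize A v (open Classical in Function.update V (p, k) Z) := by
      intro Z
      obtain ⟨φ', hc', h2⟩ := (h _ (hY Z)).exists_one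
      obtain rfl := Form.code_injective ν (hc.symm.trans hc')
      exact h2 _ _ _ _ (hr.upd₂ hq Z fun e => Iff.rfl)
    exact ⟨(key ∅).1, sdiff_subset_of_subset_insert (key ∅).2.1, fun a => (key a).2.2⟩
  · intro Y hY h
    obtain ⟨φ, hc, h⟩ := h.exists_zero
    refine Sem.zero (φ := .all₂ p k φ) (by simp [hc, hq, Form.code]) fun v V D₁ D₂ hr => ?_
    obtain ⟨h1, h2, h3⟩ := h _ _ _ _
      (hr.upd₂ hq {t | (⟨_, tupleCode_mem hx t⟩ : T.El) ∈ Y} fun e => mem_iff_tupleCode hx hq hY e)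
    exact ⟨h1, sdiff_subset_of_subset_insert h2, fun h => h3 (h _)⟩

theorem satClosed_sem : SatClosed x (Sem ν A) :=
  ⟨satEq_sem hx, satRelSym_sem hx, satRelVar_sem hx, satNeg_sem, satAnd_sem, satAll₁_sem hx,
    satAll₂_sem hx⟩

-- Every closed `Z` contains the true satisfaction relation. The induction on formulas carries both
-- truth values at once, because negation exchanges them. The domains of the represented assignment
-- must grow at quantifiers, so α, v, V and the domains are all generalised.
open Classical in
theorem sat_of_satClosed {Z : T.El → Set T.El → Prop} (hZ : SatClosed x Z) (φ : Form τ)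
    {α : Set T.El} {v : ∀ y : τ.Srt × ℕ, A.El y.1} {V D₁ D₂} (hr : Rep ν α v V D₁ D₂)
    (h₁ : φ.free₁ ⊆ D₁) (h₂ : φ.free₂ ⊆ D₂) {c : T.El} (hc : c.1 = φ.code ν) :
    (φ.Realize A v V → Z (pr c (nt 1)) α) ∧ (¬ φ.Realize A v V → Z (pr c (nt 0)) α) := by
  obtain ⟨z1, z2, z3, z4, z5, z6, z7⟩ := hZ
  induction φ generalizing α v V D₁ D₂ c with
  | @eq s t₁ t₂ =>
    have hc' : c = pr (nt 0) (pr ⟨_, termCode_mem hx t₁⟩ ⟨_, termCode_mem hx t₂⟩) :=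
      Subtype.ext (by rw [hc]; simp [Form.code])
    have := z1 α ⟨_, srt_mem hx s⟩ _ _ _ _
      (ev_of_rep hx hr t₁ (Set.subset_union_left.trans h₁) rfl (c := ⟨_, termCode_mem hx t₁⟩) rfl
        (a := ⟨_, elt_mem hx (t₁.eval A v)⟩) rfl)
      (ev_of_rep hx hr t₂ (Set.subset_union_right.trans h₁) rfl (c := ⟨_, termCode_mem hx t₂⟩) rfl
        (a := ⟨_, elt_mem hx (t₂.eval A v)⟩) rfl)
    rw [hc']
    refine ⟨fun h => this.1 ?_, fun h => this.2 fun h3 => h ?_⟩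
    · have h' : t₁.eval A v = t₂.eval A v := h
      rw [h']
    · have h4 := congrArg (fun e : T.El => e.1) h3
      exact Subtype.ext h4
  | rel r ts =>
    have hc' : c = pr (nt 1) (pr ⟨_, rel_mem hx r⟩ (sq fun i => ⟨_, termCode_mem hx (ts i)⟩)) :=
      Subtype.ext (by rw [hc]; simp [Form.code])
    have h := z2 α ⟨_, rel_mem hx r⟩ ⟨_, profile_mem hx (τ.relDom r)⟩ ⟨_, relInt_mem hx r⟩ _ _
      ((mem_relsOf hx).2 ⟨r, rfl, rfl⟩) ((mem_relIntOf hx).2 ⟨r, rfl, rfl⟩)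
      (evSeq_of_rep hx hr ts h₁ rfl (cs := sq fun i => ⟨_, termCode_mem hx (ts i)⟩) rfl
        (as := ⟨_, tupleCode_mem hx (fun i => (ts i).eval A v)⟩) rfl)
    rw [hc']
    refine ⟨fun h' => h.1 ?_, fun h' => h.2 fun h3 => h' ?_⟩
    · exact ZFSet.mem_range.2 ⟨⟨_, h'⟩, rfl⟩
    · obtain ⟨⟨t, ht⟩, h4⟩ := ZFSet.mem_range.1 h3
      rw [tupleCode_inj] at h4
      change _ ∈ A.rel r
      rw [← h4]
      exact ht
  | rvar p n ts =>
    have hc' : c = pr (nt 2) (pr (pr ⟨_, profile_mem hx p⟩ (nt n))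
        (sq fun i => ⟨_, termCode_mem hx (ts i)⟩)) :=
      Subtype.ext (by rw [hc]; simp [Form.code])
    have h4 := hr.2 p n ⟨_, profile_mem hx p⟩
    have h5 : (p, n) ∈ D₂ := h₂ (by simp [Form.free₂])
    have h := z3 α ⟨_, profile_mem hx p⟩ (nt n) _ _ ((isProf_iff hx).2 ⟨p, rfl⟩) ⟨n, rfl⟩
      ((h4 _ rfl).2 ⟨h5, Or.inl rfl⟩)
      (evSeq_of_rep hx hr ts h₁ rfl (cs := sq fun i => ⟨_, termCode_mem hx (ts i)⟩) rfl
        (as := ⟨_, tupleCode_mem hx (fun i => (ts i).eval A v)⟩) rfl)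
    rw [h4 _ rfl] at h
    rw [hc']
    refine ⟨fun h' => h.1 ⟨h5, Or.inr ⟨_, h', rfl⟩⟩, fun h' => h.2 ?_⟩
    rintro ⟨-, h6 | ⟨t, ht, h6⟩⟩
    · exact nt_one_ne_tupleCode _ (congrArg Subtype.val h6).symm
    · rw [tupleCode_inj] at h6
      rw [← h6] at ht
      exact h' ht
  | neg φ ih =>
    have hc' : c = pr (nt 3) ⟨_, formCode_mem hx φ⟩ := Subtype.ext (by rw [hc]; simp [Form.code])
    have h := ih hr h₁ h₂ (c := ⟨_, formCode_mem hx φ⟩) rfl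
    rw [hc']
    exact ⟨fun h' => (z4 _ _).2 (h.2 h'), fun h' => (z4 _ _).1 (h.1 (not_not.1 h'))⟩
  | and φ ψ ih1 ih2 =>
    have hc' : c = pr (nt 4) (pr ⟨_, formCode_mem hx φ⟩ ⟨_, formCode_mem hx ψ⟩) :=
      Subtype.ext (by rw [hc]; simp [Form.code])
    have h := ih1 hr (Set.subset_union_left.trans h₁) (Set.subset_union_left.trans h₂)
      (c := ⟨_, formCode_mem hx φ⟩) rfl
    have h' := ih2 hr (Set.subset_union_right.trans h₁) (Set.subset_union_right.trans h₂)
      (c := ⟨_, formCode_mem hx ψ⟩) rfl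
    rw [hc']
    obtain ⟨w1, w2, w3, w4⟩ := z5 α ⟨_, formCode_mem hx φ⟩ ⟨_, formCode_mem hx ψ⟩
    simp only [Form.Realize]
    by_cases a : φ.Realize A v V <;> by_cases b : ψ.Realize A v V
    · exact ⟨fun _ => w1 (h.1 a) (h'.1 b), fun h => (h ⟨a, b⟩).elim⟩
    · exact ⟨fun h => (b h.2).elim, fun _ => w3 (h.1 a) (h'.2 b)⟩
    · exact ⟨fun h => (a h.1).elim, fun _ => w4 (h.2 a) (h'.1 b)⟩
    · exact ⟨fun h => (a h.1).elim, fun _ => w2 (h.2 a) (h'.2 b)⟩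
  | all₁ s n φ ih =>
    have hc' : c = pr (nt 5) (pr (pr ⟨_, srt_mem hx s⟩ (nt n)) ⟨_, formCode_mem hx φ⟩) :=
      Subtype.ext (by rw [hc]; simp [Form.code])
    rw [hc']
    obtain ⟨w1, w2⟩ := z6 α ⟨_, srt_mem hx s⟩ (nt n) ⟨_, formCode_mem hx φ⟩ ⟨_, dom_mem hx s⟩
      ⟨n, rfl⟩ ((mem_domsOf hx).2 ⟨s, rfl, rfl⟩)
    have h1 : φ.free₁ ⊆ insert (s, n) D₁ := fun y hy => by
      by_cases h : y = (s, n)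
      · exact Or.inl h
      · exact Or.inr (h₁ ⟨hy, h⟩)
    constructor
    · intro h
      refine w1 fun a ha => ?_
      exact (ih (hr.upd₁ rfl ⟨a.1, ha⟩ rfl) h1 h₂ rfl).1 (h _)
    · intro h
      simp only [Form.Realize, not_forall] at h
      obtain ⟨a, ha⟩ := h
      exact w2 ⟨_, elt_mem hx a⟩ a.2 ((ih (hr.upd₁ rfl a rfl) h1 h₂ rfl).2 ha)
  | all₂ p n φ ih =>
    have hc' : c = pr (nt 6) (pr (pr ⟨_, profile_mem hx p⟩ (nt n)) ⟨_, formCode_mem hx φ⟩) :=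
      Subtype.ext (by rw [hc]; simp [Form.code])
    rw [hc']
    obtain ⟨w1, w2⟩ := z7 α ⟨_, profile_mem hx p⟩ (nt n) ⟨_, formCode_mem hx φ⟩
      ⟨n, rfl⟩ ((isProf_iff hx).2 ⟨p, rfl⟩)
    have h1 : φ.free₂ ⊆ insert (p, n) D₂ := fun y hy => by
      by_cases h : y = (p, n)
      · exact Or.inl h
      · exact Or.inr (h₂ ⟨hy, h⟩)
    constructor
    · intro h
      refine w1 fun Y hY => ?_
      exact (ih (hr.upd₂ rfl {t | (⟨_, tupleCode_mem hx t⟩ : T.El) ∈ Y}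
        fun e => mem_iff_tupleCode hx rfl hY e) h₁ h1 rfl).1 (h _)
    · intro h
      simp only [Form.Realize, not_forall] at h
      obtain ⟨Z, hZ⟩ := h
      refine w2 {e : T.El | ∃ t ∈ Z, e.1 = tupleCode t} ?_
        ((ih (hr.upd₂ rfl Z fun e => Iff.rfl) h₁ h1 rfl).2 hZ)
      rintro e ⟨t, -, he⟩
      exact (isTup_iff hx rfl).2 ⟨t, he⟩

/-- One direction instantiates `Z` by the intended meaning `Sem`, which is closed; the other is
`sat_of_satClosed`. Under the empty assignment `Sem` also forces `y` to be a sentence. -/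
theorem sat_iff {y : T.El} : (∀ Z : T.El → Set T.El → Prop, SatClosed x Z → Z (pr y (nt 1)) ∅) ↔
    ∃ φ : Form τ, φ.IsSentence ∧ y.1 = φ.code ν ∧ φ.Truth A := by
  constructor
  · intro h
    obtain ⟨φ, hc, h⟩ := (h _ (satClosed_sem hx)).exists_one
    have key := fun v V => h v V ∅ ∅ (rep_empty v V)
    have h0 := key (fun y => ⟨_, (A.dom_nonempty y.1).choose_spec⟩) fun _ => ∅
    exact ⟨φ, ⟨Set.subset_empty_iff.1 h0.1, Set.subset_empty_iff.1 h0.2.1⟩, hc,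
      fun v V => (key v V).2.2⟩
  · rintro ⟨φ, hs, hc, ht⟩ Z hZ
    let v : ∀ y : τ.Srt × ℕ, A.El y.1 := fun y => ⟨_, (A.dom_nonempty y.1).choose_spec⟩
    let V : ∀ X : Profile τ.Srt × ℕ, Set (Tuple A.dom X.1) := fun _ => ∅
    exact (sat_of_satClosed hx hZ φ (rep_empty v V) hs.1.subset hs.2.subset hc).1 (ht v V)

end forms

end AdjClosed

end BddSymb

namespace BddSymb

open Cardinal AdjClosed

/-! ## Codes of structures are recognised inside `T` -/

/-- The members of a set form a type one universe too high for a vocabulary; the shrunk type is in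
the right universe and comes with its naming. -/
theorem exists_embedding (D : ZFSet.{u}) :
    ∃ (S : Type u) (ι : S ↪ ZFSet.{u}), ∀ z, z ∈ D ↔ ∃ s, z = ι s := by
  let e := (equivShrink.{u} {z // z ∈ D}).symm
  refine ⟨_, ⟨fun s => (e s).1, fun a b h => e.injective (Subtype.ext h)⟩, fun z => ⟨fun h =>
    ⟨e.symm ⟨z, h⟩, congrArg Subtype.val (e.apply_symm_apply ⟨z, h⟩).symm⟩, ?_⟩⟩
  rintro ⟨s, rfl⟩
  exact (e s).2

/-- The index type consists of the members of `R`, named by their first coordinates; functionality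
of `R` makes the naming injective. -/
theorem exists_eq_graph {R : ZFSet.{u}} (h₁ : ∀ e ∈ R, ∃ r q, e = ZFSet.pair r q)
    (h₂ : ∀ r q q', ZFSet.pair r q ∈ R → ZFSet.pair r q' ∈ R → q' = q) :
    ∃ (S : Type u) (ι : S ↪ ZFSet.{u}) (f : S → ZFSet.{u}),
      R = ZFSet.range fun s => ZFSet.pair (ι s) (f s) := by
  obtain ⟨S, ι, hι⟩ := exists_embedding R
  have h : ∀ s, ∃ r q, ι s = ZFSet.pair r q := fun s => h₁ _ ((hι _).2 ⟨s, rfl⟩)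
  choose r q hrq using h
  have hR : ∀ s, ZFSet.pair (r s) (q s) ∈ R := fun s => hrq s ▸ (hι _).2 ⟨s, rfl⟩
  refine ⟨S, ⟨r, fun s s' h => ι.injective ?_⟩, q, ?_⟩
  · rw [hrq, hrq, h, h₂ (r s') (q s) (q s') (h ▸ hR s) (hR s')]
  · ext e
    rw [hι, ZFSet.mem_range]
    exact exists_congr fun s => by rw [hrq, eq_comm]; rfl

theorem eq_graph {S : Type u} (ι : S → ZFSet.{u}) {R : ZFSet.{u}}
    (h₁ : ∀ e ∈ R, ∃ s q, e = ZFSet.pair (ι s) q)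
    (h₂ : ∀ s, ∃ q, ZFSet.pair (ι s) q ∈ R ∧ ∀ q', ZFSet.pair (ι s) q' ∈ R → q' = q) :
    ∃ f : S → ZFSet.{u}, R = ZFSet.range fun s => ZFSet.pair (ι s) (f s) := by
  choose f hf hf' using h₂
  refine ⟨f, ?_⟩
  ext e
  rw [ZFSet.mem_range]
  constructor
  · intro he
    obtain ⟨s, q, rfl⟩ := h₁ e he
    exact ⟨s, by rw [hf' s q he]⟩
  · rintro ⟨s, rfl⟩
    exact hf s

namespace AdjClosed

variable {T : AdjClosed.{u}}

theorem exists_profile {S : Type u} {ι : S ↪ ZFSet.{u}} {x q : T.El}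
    (hS : ∀ z, z ∈ (sortsOf x).1 ↔ ∃ s, z = ι s) (h : IsProf x q) :
    ∃ p : Profile S, q.1 = seqCode fun i => ι (p.sort i) := by
  obtain ⟨m, ⟨N, y, rfl, rfl⟩, h⟩ := h
  have h2 : ∀ i, ∃ σ, (y i).1 = ι σ := fun i =>
    (hS _).1 (h (nt i) (y i) (pr_mem_sq.2 ⟨i, rfl, rfl⟩))
  choose σ hσ using h2
  refine ⟨⟨N, σ⟩, ?_⟩
  simp only [sq_val, hσ]

theorem exists_str_of_isStr {x : T.El} (h : IsStr x) :
    ∃ (τ : Vocab.{u}) (ν : Naming τ) (A : Str τ), x.1 = A.code ν := by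
  obtain ⟨hx, ⟨r1, r2⟩, ⟨f1, f2⟩, ⟨d1, d2⟩, ⟨i1, i2⟩, g1, g2⟩ := h
  -- Everything below `x` is in T by transitivity, so the conditions in `IsStr`, although quantified
  -- over T only, apply to all sets that occur here.
  have up : ∀ {z : ZFSet.{u}} {y : T.El}, z ∈ y.1 → z ∈ T.set := fun {z y} hz => T.trans _ y.2 hz
  obtain ⟨S, ιs, hS⟩ := exists_embedding (sortsOf x).1
  obtain ⟨Rl, ιr, fr, hR⟩ := exists_eq_graph (R := (relsOf x).1)
    (fun e he => by
      obtain ⟨r, q, h, -⟩ := r1 ⟨e, up he⟩ he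
      exact ⟨r.1, q.1, congrArg Subtype.val h⟩)
    (fun r q q' h h' => congrArg Subtype.val (r2 ⟨r, (T.mem_of_pair (up h)).1⟩
      ⟨q, (T.mem_of_pair (up h)).2⟩ ⟨q', (T.mem_of_pair (up h')).2⟩ h h'))
  obtain ⟨Fl, ιf, ff, hF⟩ := exists_eq_graph (R := (fnsOf x).1)
    (fun e he => by
      obtain ⟨f, q, s, h, -⟩ := f1 ⟨e, up he⟩ he
      exact ⟨f.1, _, congrArg Subtype.val h⟩)
    (fun r q q' h h' => congrArg Subtype.val (f2 ⟨r, (T.mem_of_pair (up h)).1⟩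
      ⟨q, (T.mem_of_pair (up h)).2⟩ ⟨q', (T.mem_of_pair (up h')).2⟩ h h'))
  have hsT : ∀ σ, ιs σ ∈ T.set := fun σ => up ((hS _).2 ⟨σ, rfl⟩)
  have hRm : ∀ ρ, ZFSet.pair (ιr ρ) (fr ρ) ∈ (relsOf x).1 := fun ρ => by
    rw [hR]; exact ZFSet.mem_range.2 ⟨ρ, rfl⟩
  have hFm : ∀ g, ZFSet.pair (ιf g) (ff g) ∈ (fnsOf x).1 := fun g => by
    rw [hF]; exact ZFSet.mem_range.2 ⟨g, rfl⟩
  have hp : ∀ ρ, ∃ p : Profile S, fr ρ = seqCode fun i => ιs (p.sort i) := by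
    intro ρ
    obtain ⟨r, q, h, hq⟩ := r1 ⟨_, up (hRm ρ)⟩ (hRm ρ)
    obtain ⟨p, hp⟩ := exists_profile hS hq
    exact ⟨p, by rw [← hp]; exact (ZFSet.pair_inj.1 (congrArg Subtype.val h)).2⟩
  choose pr' hpr using hp
  have hp : ∀ g, ∃ (p : Profile S) (σ : S),
      ff g = ZFSet.pair (seqCode fun i => ιs (p.sort i)) (ιs σ) := by
    intro g
    obtain ⟨f, q, s, h, hq, hs⟩ := f1 ⟨_, up (hFm g)⟩ (hFm g)
    obtain ⟨p, hp⟩ := exists_profile hS hq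
    obtain ⟨σ, hσ⟩ := (hS _).1 hs
    exact ⟨p, σ, by rw [← hp, ← hσ]; exact (ZFSet.pair_inj.1 (congrArg Subtype.val h)).2⟩
  choose pf cf hpf using hp
  let τ : Vocab.{u} := ⟨S, Rl, Fl, pr', pf, cf⟩
  let ν : Naming τ := ⟨ιs, ιr, ιf⟩
  obtain ⟨dom, hD⟩ := eq_graph ιs (R := (domsOf x).1)
    (fun e he => by
      obtain ⟨s, D, h, hs, -⟩ := d1 ⟨e, up he⟩ he
      obtain ⟨σ, hσ⟩ := (hS _).1 hs
      exact ⟨σ, D.1, by rw [← hσ]; exact congrArg Subtype.val h⟩)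
    (fun σ => by
      obtain ⟨D, h, h'⟩ := d2 ⟨_, hsT σ⟩ ((hS _).2 ⟨σ, rfl⟩)
      exact ⟨D.1, h, fun D' hD' =>
        congrArg Subtype.val (h' ⟨D', (T.mem_of_pair (up hD')).2⟩ hD')⟩)
  have hDm : ∀ σ, ZFSet.pair (ιs σ) (dom σ) ∈ (domsOf x).1 := fun σ => by
    rw [hD]; exact ZFSet.mem_range.2 ⟨σ, rfl⟩
  have hdoms : ∀ s D : T.El, (pr s D).1 ∈ (domsOf x).1 ↔ ∃ σ, s.1 = ιs σ ∧ D.1 = dom σ := by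
    intro s D
    rw [hD]
    simp [ZFSet.pair_inj, eq_comm]
  have hdT : ∀ σ, dom σ ∈ T.set := fun σ => (T.mem_of_pair (up (hDm σ))).2
  have hne : ∀ σ, (dom σ).Nonempty := by
    intro σ
    obtain ⟨s, D, h, -, a, ha⟩ := d1 ⟨_, up (hDm σ)⟩ (hDm σ)
    have : dom σ = D.1 := (ZFSet.pair_inj.1 (congrArg Subtype.val h)).2
    exact ⟨a.1, this ▸ ha⟩
  have tupT : ∀ {p : Profile S} (t : Tuple dom p), tupleCode t ∈ T.set := fun t =>
    T.seqCode_mem fun i => up (y := ⟨_, hdT _⟩) (t i).2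
  obtain ⟨X, hX⟩ := eq_graph ιr (R := (relIntOf x).1)
    (fun e he => by
      obtain ⟨r, X, q, h, hr, -⟩ := i1 ⟨e, up he⟩ he
      rw [hR] at hr
      obtain ⟨ρ, hρ⟩ := ZFSet.mem_range.1 hr
      refine ⟨ρ, X.1, ?_⟩
      rw [(ZFSet.pair_inj.1 hρ).1]
      exact congrArg Subtype.val h)
    (fun ρ => by
      have h3 := hRm ρ
      obtain ⟨X, h, h'⟩ := i2 ⟨ιr ρ, (T.mem_of_pair (up h3)).1⟩
        ⟨fr ρ, (T.mem_of_pair (up h3)).2⟩ h3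
      exact ⟨X.1, h, fun X' hX' =>
        congrArg Subtype.val (h' ⟨X', (T.mem_of_pair (up hX')).2⟩ hX')⟩)
  have hXt : ∀ ρ, ∀ e ∈ X ρ, ∃ t : Tuple dom (pr' ρ), e = tupleCode t := by
    intro ρ e he
    have hm : ZFSet.pair (ιr ρ) (X ρ) ∈ (relIntOf x).1 := by
      rw [hX]; exact ZFSet.mem_range.2 ⟨ρ, rfl⟩
    obtain ⟨r, X', q, h, hr, ht⟩ := i1 ⟨_, up hm⟩ hm
    have h5 := ZFSet.pair_inj.1 (congrArg Subtype.val h)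
    rw [hR] at hr
    obtain ⟨ρ', hρ'⟩ := ZFSet.mem_range.1 hr
    obtain ⟨h6, h7⟩ := ZFSet.pair_inj.1 hρ'
    obtain rfl : ρ' = ρ := ιr.injective (h6.trans h5.1.symm)
    have hX' : X ρ' = X'.1 := h5.2
    have he' : e ∈ X'.1 := hX' ▸ he
    exact (isTup_iff_of_doms hsT hdT hdoms (h7.symm.trans (hpr ρ'))).1 (ht ⟨e, up he'⟩ he')
  obtain ⟨G, hG⟩ := eq_graph ιf (R := (fnIntOf x).1)
    (fun e he => by
      obtain ⟨f, G, q, s, h, hf, -⟩ := g1 ⟨e, up he⟩ he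
      rw [hF] at hf
      obtain ⟨g, hg⟩ := ZFSet.mem_range.1 hf
      refine ⟨g, G.1, ?_⟩
      rw [(ZFSet.pair_inj.1 hg).1]
      exact congrArg Subtype.val h)
    (fun g => by
      have h3 := hFm g
      obtain ⟨X, h, h'⟩ := g2 ⟨ιf g, (T.mem_of_pair (up h3)).1⟩
        ⟨ff g, (T.mem_of_pair (up h3)).2⟩ h3
      exact ⟨X.1, h, fun X' hX' =>
        congrArg Subtype.val (h' ⟨X', (T.mem_of_pair (up hX')).2⟩ hX')⟩)
  have hGt : ∀ g, ∃ F : Tuple dom (pf g) → {a : ZFSet.{u} // a ∈ dom (cf g)},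
      G g = ZFSet.range fun t => ZFSet.pair (tupleCode t) (F t).1 := by
    intro g
    have hm : ZFSet.pair (ιf g) (G g) ∈ (fnIntOf x).1 := by
      rw [hG]; exact ZFSet.mem_range.2 ⟨g, rfl⟩
    obtain ⟨f, G', q, s, h, hf, k1, k2⟩ := g1 ⟨_, up hm⟩ hm
    have h5 := ZFSet.pair_inj.1 (congrArg Subtype.val h)
    rw [hF] at hf
    obtain ⟨g', hg'⟩ := ZFSet.mem_range.1 hf
    obtain ⟨h6, h7⟩ := ZFSet.pair_inj.1 hg'
    obtain rfl : g' = g := ιf.injective (h6.trans h5.1.symm)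
    have hG' : G g' = G'.1 := h5.2
    -- The profile and value sort named in the graph condition are those already chosen for the
    -- symbol, by uniqueness of its entry in the vocabulary.
    rw [hpf] at h7
    obtain ⟨h8, h9⟩ := ZFSet.pair_inj.1 h7
    have hval : ∀ t b : T.El, (pr t b).1 ∈ G'.1 → (∃ t' : Tuple dom (pf g'), t.1 = tupleCode t') ∧
        b.1 ∈ dom (cf g') := by
      intro t b hb
      obtain ⟨t₁, b₁, h10, h11, D, h12, h13⟩ := k1 _ hb
      obtain ⟨rfl, rfl⟩ := pr_inj.1 h10
      refine ⟨(isTup_iff_of_doms hsT hdT hdoms h8.symm).1 h11, ?_⟩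
      obtain ⟨σ, h14, h15⟩ := (hdoms _ _).1 h12
      rw [ιs.injective (h9.trans h14), ← h15]
      exact h13
    have hfun : ∀ t : Tuple dom (pf g'), ∃ b : {a : ZFSet.{u} // a ∈ dom (cf g')},
        ZFSet.pair (tupleCode t) b.1 ∈ G'.1 ∧
          ∀ b', ZFSet.pair (tupleCode t) b' ∈ G'.1 → b' = b.1 := by
      intro t
      obtain ⟨b, hb, hb'⟩ := k2 ⟨_, tupT t⟩
        ((isTup_iff_of_doms hsT hdT hdoms h8.symm).2 ⟨t, rfl⟩)
      exact ⟨⟨b.1, (hval _ _ hb).2⟩, hb, fun b' h =>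
        congrArg Subtype.val (hb' ⟨b', (T.mem_of_pair (up h)).2⟩ h)⟩
    choose F hF₁ hF₂ using hfun
    refine ⟨F, ?_⟩
    rw [hG']
    ext e
    rw [ZFSet.mem_range]
    constructor
    · intro he
      obtain ⟨t, b, h10, -⟩ := k1 ⟨e, up he⟩ he
      obtain rfl : e = ZFSet.pair t.1 b.1 := congrArg Subtype.val h10
      obtain ⟨t', ht'⟩ := (hval _ _ he).1
      rw [ht'] at he ⊢
      exact ⟨t', by rw [hF₂ t' b.1 he]⟩
    · rintro ⟨t, rfl⟩
      exact hF₁ t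
  choose F hFG using hGt
  let A : Str τ := ⟨dom, hne, fun ρ => {t | tupleCode t ∈ X ρ}, F⟩
  have e1 : (sortsOf x).1 = ZFSet.range ιs := by
    ext z
    rw [hS, ZFSet.mem_range]
    simp only [eq_comm]
  have e2 : (relsOf x).1 = ZFSet.range fun ρ => ZFSet.pair (ν.rel ρ) (ν.profile (τ.relDom ρ)) := by
    rw [hR]
    simp only [hpr]
    rfl
  have e3 : (fnsOf x).1 = ZFSet.range fun g => ZFSet.pair (ν.fn g)
      (ZFSet.pair (ν.profile (τ.fnDom g)) (ν.srt (τ.fnCod g))) := by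
    rw [hF]
    simp only [hpf]
    rfl
  have e4 : (relIntOf x).1 = ZFSet.range fun ρ => ZFSet.pair (ν.rel ρ)
      (ZFSet.range fun t : {t // t ∈ A.rel ρ} => tupleCode t.1) := by
    rw [hX]
    congr 1
    funext ρ
    congr 1
    ext e
    rw [ZFSet.mem_range]
    constructor
    · intro he
      obtain ⟨t, rfl⟩ := hXt ρ e he
      exact ⟨⟨t, he⟩, rfl⟩
    · rintro ⟨⟨t, ht⟩, rfl⟩
      exact ht
  have e5 : (fnIntOf x).1 = ZFSet.range fun g => ZFSet.pair (ν.fn g)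
      (ZFSet.range fun t : Tuple A.dom (τ.fnDom g) => ZFSet.pair (tupleCode t) (A.fn g t).1) := by
    rw [hG]
    simp only [hFG]
    rfl
  refine ⟨τ, ν, A, ?_⟩
  have hx' := congrArg Subtype.val hx
  simp only [pr_val] at hx'
  rw [hx', e1, e2, e3, hD, e4, e5]
  rfl

/-! ### Every code of a structure is recognised -/

section lookup

variable {τ : Vocab.{u}} {ν : Naming τ} {A : Str τ} {x : T.El} (hx : x.1 = A.code ν)

include hx

theorem isStr_of_eq_code : IsStr x := by
  have h1 := val_fst_snd hx
  have h2 := val_fst_snd h1.1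
  have h3 := val_fst_snd h2.2
  have h4 := val_fst_snd h1.2
  have h5 := val_fst_snd h4.2
  refine ⟨?_, ⟨fun e he => ?_, ?_⟩, ⟨fun e he => ?_, ?_⟩, ⟨fun e he => ?_, fun s hs => ?_⟩,
    ⟨fun e he => ?_, ?_⟩, fun e he => ?_, ?_⟩
  · apply Subtype.ext
    simp only [pr_val]
    rw [h2.1, h3.1, h3.2, h4.1, h5.1, h5.2]
    exact hx
  · rw [h3.1] at he
    obtain ⟨ρ, hρ⟩ := ZFSet.mem_range.1 he
    exact ⟨⟨_, rel_mem hx ρ⟩, ⟨_, profile_mem hx _⟩, Subtype.ext hρ.symm,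
      (isProf_iff hx).2 ⟨_, rfl⟩⟩
  · intro r q q' h h'
    obtain ⟨ρ, ha, hb⟩ := (mem_relsOf hx).1 h
    obtain ⟨ρ', ha', hb'⟩ := (mem_relsOf hx).1 h'
    obtain rfl := ν.rel.injective (ha.symm.trans ha')
    exact Subtype.ext (hb'.trans hb.symm)
  · rw [h3.2] at he
    obtain ⟨g, hg⟩ := ZFSet.mem_range.1 he
    exact ⟨⟨_, fn_mem hx g⟩, ⟨_, profile_mem hx _⟩, ⟨_, srt_mem hx (τ.fnCod g)⟩,
      Subtype.ext hg.symm, (isProf_iff hx).2 ⟨_, rfl⟩, (mem_sortsOf hx).2 ⟨_, rfl⟩⟩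
  · intro f p p' h h'
    rw [h3.2] at h h'
    obtain ⟨g, hg⟩ := ZFSet.mem_range.1 h
    obtain ⟨g', hg'⟩ := ZFSet.mem_range.1 h'
    obtain ⟨ha, hb⟩ := ZFSet.pair_inj.1 hg
    obtain ⟨ha', hb'⟩ := ZFSet.pair_inj.1 hg'
    obtain rfl := ν.fn.injective (ha.trans ha'.symm)
    exact Subtype.ext (hb'.symm.trans hb)
  · rw [h4.1] at he
    obtain ⟨σ, hσ⟩ := ZFSet.mem_range.1 he
    obtain ⟨a, ha⟩ := A.dom_nonempty σ
    exact ⟨⟨_, srt_mem hx σ⟩, ⟨_, dom_mem hx σ⟩, Subtype.ext hσ.symm,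
      (mem_sortsOf hx).2 ⟨_, rfl⟩, ⟨a, elt_mem hx ⟨a, ha⟩⟩, ha⟩
  · obtain ⟨σ, hσ⟩ := (mem_sortsOf hx).1 hs
    refine ⟨⟨_, dom_mem hx σ⟩, (mem_domsOf hx).2 ⟨σ, hσ, rfl⟩, fun D' h => ?_⟩
    obtain ⟨σ', ha, hb⟩ := (mem_domsOf hx).1 h
    obtain rfl := ν.srt.injective (hσ.symm.trans ha)
    exact Subtype.ext hb
  · rw [h5.1] at he
    obtain ⟨ρ, hρ⟩ := ZFSet.mem_range.1 he
    refine ⟨⟨_, rel_mem hx ρ⟩, ⟨_, relInt_mem hx ρ⟩, ⟨_, profile_mem hx (τ.relDom ρ)⟩,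
      Subtype.ext hρ.symm, (mem_relsOf hx).2 ⟨_, rfl, rfl⟩, fun t ht => ?_⟩
    obtain ⟨t', h⟩ := ZFSet.mem_range.1 ht
    exact (isTup_iff hx rfl).2 ⟨t'.1, h.symm⟩
  · intro r q h
    obtain ⟨ρ, ha, -⟩ := (mem_relsOf hx).1 h
    refine ⟨⟨_, relInt_mem hx ρ⟩, (mem_relIntOf hx).2 ⟨ρ, ha, rfl⟩, fun X h => ?_⟩
    obtain ⟨ρ', ha', hb⟩ := (mem_relIntOf hx).1 h
    obtain rfl := ν.rel.injective (ha.symm.trans ha')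
    exact Subtype.ext hb
  · rw [h5.2] at he
    obtain ⟨g, hg⟩ := ZFSet.mem_range.1 he
    refine ⟨⟨_, fn_mem hx g⟩, ⟨_, fnInt_mem hx g⟩, ⟨_, profile_mem hx (τ.fnDom g)⟩,
      ⟨_, srt_mem hx (τ.fnCod g)⟩, Subtype.ext hg.symm, (mem_fnsOf hx).2 ⟨_, rfl, rfl, rfl⟩,
      fun t ht => ?_, fun t ht => ?_⟩
    · obtain ⟨t', h⟩ := ZFSet.mem_range.1 ht
      exact ⟨⟨_, tupleCode_mem hx t'⟩, ⟨_, elt_mem hx (A.fn g t')⟩, Subtype.ext h.symm,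
        (isTup_iff hx rfl).2 ⟨t', rfl⟩, ⟨_, dom_mem hx _⟩, (mem_domsOf hx).2 ⟨_, rfl, rfl⟩,
        (A.fn g t').2⟩
    · obtain ⟨t', h⟩ := (isTup_iff hx rfl).1 ht
      refine ⟨⟨_, elt_mem hx (A.fn g t')⟩, ZFSet.mem_range.2 ⟨t', ?_⟩, fun b' hb' => ?_⟩
      · rw [pr_val, h]
      · obtain ⟨t'', h'⟩ := ZFSet.mem_range.1 hb'
        obtain ⟨ha, hb⟩ := ZFSet.pair_inj.1 h'
        rw [h] at ha
        have : t'' = t' := by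
          have := seqCode_inj.1 ha
          funext i
          exact Subtype.ext (congrFun this i)
        subst this
        exact Subtype.ext hb.symm
  · intro f p h
    rw [h3.2] at h
    obtain ⟨g, hg⟩ := ZFSet.mem_range.1 h
    refine ⟨⟨_, fnInt_mem hx g⟩, (mem_fnIntOf hx).2 ⟨g, (ZFSet.pair_inj.1 hg).1.symm, rfl⟩,
      fun G h => ?_⟩
    obtain ⟨g', ha', hb⟩ := (mem_fnIntOf hx).1 h
    obtain rfl := ν.fn.injective ((ZFSet.pair_inj.1 hg).1.trans ha')
    exact Subtype.ext hb

end lookup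

/-- The right-hand side does not mention T. Truth inside T is thus the same for all T that contain
the two arguments, and this is what makes the negation of satisfaction Σ₁ as well. -/
theorem satIn_iff (x y : T.El) : SatIn x y ↔ SatRel L2 ![x.1, y.1] := by
  constructor
  · rintro ⟨h, hy⟩
    obtain ⟨τ, ν, A, hx⟩ := exists_str_of_isStr h
    obtain ⟨φ, h1, h2, h3⟩ := (sat_iff hx).1 hy
    exact ⟨τ, ν, A, ⟨φ, h1⟩, hx, h2, h3⟩
  · rintro ⟨τ, ν, A, ⟨φ, h1⟩, hx, h2, h3⟩
    exact ⟨isStr_of_eq_code hx, (sat_iff hx).2 ⟨φ, h1, h2, h3⟩⟩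

end AdjClosed

end BddSymb

namespace BddSymb

open Cardinal AdjClosed

/-! ## `H`-ranks -/

theorem mem_HSet_succ {κ : Cardinal.{u}} {x : ZFSet.{u}} :
    x ∈ HSet (Order.succ κ) ↔ ∃ t : ZFSet.{u}, t.IsTransitive ∧ x ⊆ t ∧ t.card ≤ κ := by
  simp only [HSet, Set.mem_ofPred_eq, Order.lt_succ_iff]

theorem rhoH_le {κ : Cardinal.{u}} (hκ : ℵ₀ ≤ κ) {x t : ZFSet.{u}} (ht : t.IsTransitive)
    (hx : x ⊆ t) (hc : t.card ≤ κ) : rhoH x ≤ κ :=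
  csInf_le' ⟨hκ, mem_HSet_succ.2 ⟨t, ht, hx, hc⟩⟩

theorem rhoH_spec (x : ZFSet.{u}) :
    ℵ₀ ≤ rhoH x ∧ ∃ t : ZFSet.{u}, t.IsTransitive ∧ x ⊆ t ∧ t.card ≤ rhoH x := by
  have : ∃ κ : Cardinal.{u}, ℵ₀ ≤ κ ∧ x ∈ HSet (Order.succ κ) :=
    ⟨max ℵ₀ (ZFSet.vonNeumann x.rank).card, le_max_left _ _, mem_HSet_succ.2
      ⟨_, ZFSet.isTransitive_vonNeumann _, ZFSet.subset_vonNeumann.2 le_rfl, le_max_right _ _⟩⟩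
  obtain ⟨h1, h2⟩ := csInf_mem (s := {κ | ℵ₀ ≤ κ ∧ x ∈ HSet (Order.succ κ)}) this
  exact ⟨h1, mem_HSet_succ.1 h2⟩

theorem card_iUnion_le {κ : Cardinal.{u}} (hκ : ℵ₀ ≤ κ) {ι : Type u} {f : ι → ZFSet.{u}}
    (hι : #ι ≤ κ) (h : ∀ i, (f i).card ≤ κ) : (ZFSet.iUnion f).card ≤ κ := by
  have h1 := ZFSet.lift_card_iUnion_le_sum_card (f := f)
  rw [Cardinal.lift_id] at h1
  refine h1.trans ((Cardinal.sum_le_sum _ (fun _ => κ) h).trans ?_)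
  rw [Cardinal.sum_const']
  exact (mul_le_mul_left hι κ).trans (mul_eq_self hκ).le

theorem card_range_le {ι : Type u} (f : ι → ZFSet.{u}) : (ZFSet.range f).card ≤ #ι := by
  simpa using ZFSet.lift_card_range_le (f := f)

theorem aleph0_le_rhoTuple {n : ℕ} (x : Fin n → ZFSet.{u}) : ℵ₀ ≤ rhoTuple x := le_max_left _ _

/-- The finitely many transitive sets that include the entries are united, and the entries
themselves are adjoined as elements; the result is still transitive, as the members of the entries
are already there. -/
theorem rhoTuple_spec {n : ℕ} (x : Fin n → ZFSet.{u}) :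
    ∃ t : ZFSet.{u}, t.IsTransitive ∧ (∀ i, x i ∈ t) ∧ t.card ≤ rhoTuple x := by
  have h : ∀ i : ULift.{u} (Fin n), ∃ t : ZFSet.{u},
      t.IsTransitive ∧ x i.down ⊆ t ∧ t.card ≤ rhoTuple x := by
    intro i
    obtain ⟨-, t, h1, h2, h3⟩ := rhoH_spec (x i.down)
    exact ⟨t, h1, h2, h3.trans ((le_ciSup (Cardinal.bddAbove_of_small) i.down).trans
      (le_max_right _ _))⟩
  choose t h1 h2 h3 using h
  have hf : #(ULift.{u} (Fin n)) ≤ rhoTuple x :=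
    (Cardinal.lt_aleph0_of_finite _).le.trans (aleph0_le_rhoTuple x)
  refine ⟨ZFSet.iUnion t ∪ ZFSet.range fun i : ULift.{u} (Fin n) => x i.down, ?_, ?_, ?_⟩
  · intro a ha b hb
    rw [ZFSet.mem_union, ZFSet.mem_iUnion] at *
    left
    rcases ha with ⟨i, hi⟩ | ha
    · exact ⟨i, h1 i _ hi hb⟩
    · obtain ⟨i, rfl⟩ := ZFSet.mem_range.1 ha
      exact ⟨i, h2 i hb⟩
  · intro i
    exact ZFSet.mem_union.2 (Or.inr (ZFSet.mem_range.2 ⟨⟨i⟩, rfl⟩))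
  · refine ZFSet.card_union_le.trans ?_
    exact Cardinal.add_le_of_le (aleph0_le_rhoTuple x)
      (card_iUnion_le (aleph0_le_rhoTuple x) hf h3) ((card_range_le _).trans hf)

/-- The closure of `s ∪ {∅}` under adjunction is the set of values of finite binary trees with
leaves labelled by `s ∪ {∅}`, and there are at most κ such trees. Transitivity is an induction on
trees. -/
theorem exists_adjClosed {κ : Cardinal.{u}} (hκ : ℵ₀ ≤ κ) {s : ZFSet.{u}} (hs : s.IsTransitive)
    (hc : s.card ≤ κ) : ∃ T : AdjClosed.{u}, s ⊆ T.set ∧ T.set.card ≤ κ := by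
  obtain ⟨S, ι, hι⟩ := exists_embedding (insert ∅ s)
  -- `none` labels the binary nodes, which are evaluated as adjunction; `some a` labels a leaf with
  -- value `ι a`.
  let β : Option S → Type := fun o => o.elim Bool fun _ => Empty
  have hfin : ∀ o, Finite (β o) := by
    intro o
    cases o
    · exact inferInstanceAs (Finite Bool)
    · exact inferInstanceAs (Finite Empty)
  let f : (Σ o, β o → ZFSet.{u}) → ZFSet.{u} := fun p => match p with
    | ⟨none, g⟩ => insert (g true) (g false)
    | ⟨some a, _⟩ => ι a
  have hS : #S ≤ κ := by
    have e : #S = (insert ∅ s : ZFSet.{u}).card := by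
      refine Cardinal.mk_congr (Equiv.trans (Equiv.ofBijective
        (fun a => (⟨ι a, (hι _).2 ⟨a, rfl⟩⟩ : {z // z ∈ (insert ∅ s : ZFSet.{u})})) ⟨?_, ?_⟩)
        (equivShrink _))
      · exact fun a b h => ι.injective (congrArg Subtype.val h)
      · rintro ⟨z, hz⟩
        obtain ⟨a, rfl⟩ := (hι z).1 hz
        exact ⟨a, rfl⟩
    rw [e]
    exact ZFSet.card_insert_le.trans
      (Cardinal.add_le_of_le hκ hc (Cardinal.one_le_aleph0.trans hκ))
  have hval : ∀ w, WType.elim ZFSet.{u} f w ∈ ZFSet.range (WType.elim (β := β) ZFSet.{u} f) :=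
    fun w => ZFSet.mem_range.2 ⟨w, rfl⟩
  have hsub : ∀ z ∈ insert ∅ s, z ∈ ZFSet.range (WType.elim (β := β) ZFSet.{u} f) := by
    intro z hz
    obtain ⟨a, rfl⟩ := (hι z).1 hz
    exact hval (WType.mk (some a) Empty.elim)
  refine ⟨⟨ZFSet.range (WType.elim (β := β) ZFSet.{u} f), ?_, ?_, ?_⟩, ?_, ?_⟩
  · intro a ha b hb
    obtain ⟨w, rfl⟩ := ZFSet.mem_range.1 ha
    clear ha
    induction w with
    | mk o g ih =>
      cases o with
      | none =>
        rcases ZFSet.mem_insert_iff.1 hb with rfl | hb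
        · exact hval _
        · exact ih false hb
      | some a =>
        have hb' : b ∈ ι a := hb
        refine hsub b ?_
        rcases ZFSet.mem_insert_iff.1 ((hι _).2 ⟨a, rfl⟩) with h | h
        · rw [h] at hb'
          exact absurd hb' (ZFSet.notMem_empty _)
        · exact ZFSet.mem_insert_of_mem _ (hs _ h hb')
  · exact hsub _ (ZFSet.mem_insert _ _)
  · intro a b ha hb
    obtain ⟨w, rfl⟩ := ZFSet.mem_range.1 ha
    obtain ⟨w', rfl⟩ := ZFSet.mem_range.1 hb
    exact hval (WType.mk none fun i : Bool => if i then w else w')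
  · exact fun z hz => hsub z (ZFSet.mem_insert_of_mem _ hz)
  · refine (ZFSet.lift_card_range_le (α := WType β) (f := WType.elim ZFSet.{u} f)).trans' ?_ |>.trans ?_
    · simp
    · simp only [Cardinal.lift_id]
      refine WType.cardinalMk_le_max_aleph0_of_finite'.trans ?_
      refine max_le ?_ hκ
      rw [Cardinal.mk_option, Cardinal.lift_uzero]
      exact Cardinal.add_le_of_le hκ hS (Cardinal.one_le_aleph0.trans hκ)

/-! ## Relations that are definable over sets closed under adjunction -/

theorem D0.adjClosed (i : Fin 5) : D0 fun w : Fin 5 → ZFSet.{u} =>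
    (∀ a, a ∈ w i → ∀ b, b ∈ a → b ∈ w i) ∧ (∃ e, e ∈ w i ∧ e = ∅) ∧
      ∀ a, a ∈ w i → ∀ b, b ∈ w i → ∃ c, c ∈ w i ∧ c = insert a b := by
  infer_instance

/-- The witness is y = ℘(℘(T)). Both T and ℘(T) are members of y, so bounded quantifiers recover
them and `PwSt` verifies them. Every T containing the arguments gives the right answer by `hS`, and
T can be chosen no larger than the H-rank of the arguments. -/
theorem isSigma1_of_D3 {P : ∀ _ : AdjClosed.{u}, (Fin 2 → ZFSet.{u}) → Prop} (hP : D3 P)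
    {S : (Fin 2 → ZFSet.{u}) → Prop}
    (hS : ∀ (T : AdjClosed.{u}) w, (∀ i, w i ∈ T.set) → (P T w ↔ S w)) :
    IsSigma1 PwSt (fun α : Cardinal.{u} => 2 ^ (2 ^ α : Cardinal.{u})) S := by
  obtain ⟨ψ, hψ⟩ := hP.out
  -- The variables are x₀, x₁, y, p, t with t = T, p = ℘(t), y = ℘(p); the list `![4, 3, 2, 0, 1]`
  -- puts the parameters T, ℘(T), ℘(℘(T)) in front of the arguments, as `ψ` expects.
  let Q : (Fin 5 → ZFSet.{u}) → Prop := fun w => w 3 = (w 4).powerset ∧ w 2 = (w 3).powerset ∧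
    ((∀ a, a ∈ w 4 → ∀ b, b ∈ a → b ∈ w 4) ∧ (∃ e, e ∈ w 4 ∧ e = ∅) ∧
      ∀ a, a ∈ w 4 → ∀ b, b ∈ w 4 → ∃ c, c ∈ w 4 ∧ c = insert a b) ∧ w 0 ∈ w 4 ∧ w 1 ∈ w 4 ∧
    ψ.Holds PwSt fun i => w ((![4, 3, 2, 0, 1] : Fin (3 + 2) → Fin 5) i)
  have hQ : D0 Q := by
    have h1 : D0 fun w : Fin 5 → ZFSet.{u} => ψ.Holds PwSt fun i =>
        w ((![4, 3, 2, 0, 1] : Fin (3 + 2) → Fin 5) i) :=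
      ⟨ψ.rename ![4, 3, 2, 0, 1], fun w => Delta0.holds_rename _ _ _ _⟩
    have h2 := D0.adjClosed.{u} 4
    unfold Q
    infer_instance
  have hT : ∀ (T : AdjClosed.{u}) (x : Fin 2 → ZFSet.{u}),
      (fun i => (![x 0, x 1, T.set.powerset.powerset, T.set.powerset, T.set] : Fin 5 → ZFSet.{u})
        ((![4, 3, 2, 0, 1] : Fin (3 + 2) → Fin 5) i)) =
      Fin.append (α := ZFSet.{u}) T.base x := by
    intro T x
    funext i
    fin_cases i <;> rfl
  have hD : D0 fun w : Fin 3 → ZFSet.{u} =>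
      ∃ p, p ∈ w 2 ∧ ∃ t, t ∈ w 2 ∧ Q ![w 0, w 1, w 2, p, t] := by
    have : D0 fun w : Fin 5 → ZFSet.{u} => Q ![w 0, w 1, w 2, w 3, w 4] := hQ.congr fun w => by
      have : w = ![w 0, w 1, w 2, w 3, w 4] := by
        funext i
        fin_cases i <;> rfl
      rw [← this]
    have h2 : D0 fun w : Fin 4 → ZFSet.{u} => ∃ t, t ∈ w 2 ∧ Q ![w 0, w 1, w 2, w 3, t] :=
      D0.bex (n := 4) 2 (P := fun w t => Q ![w 0, w 1, w 2, w 3, t]) (hP := this)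
    exact D0.bex (n := 3) 2 (P := fun w p => ∃ t, t ∈ w 2 ∧ Q ![w 0, w 1, w 2, p, t]) (hP := h2)
  obtain ⟨χ, hχ⟩ := hD.out
  have key : ∀ x y, χ.Holds PwSt (Fin.snoc (α := fun _ => ZFSet.{u}) x y) ↔
      ∃ T : AdjClosed.{u}, y = T.set.powerset.powerset ∧ (∀ i, x i ∈ T.set) ∧ S x := by
    intro x y
    have e0 : (Fin.snoc (α := fun _ => ZFSet.{u}) x y : Fin 3 → ZFSet.{u}) 0 = x 0 :=
      Fin.snoc_castSucc (α := fun _ => ZFSet.{u}) (i := (0 : Fin 2)) ..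
    have e1 : (Fin.snoc (α := fun _ => ZFSet.{u}) x y : Fin 3 → ZFSet.{u}) 1 = x 1 :=
      Fin.snoc_castSucc (α := fun _ => ZFSet.{u}) (i := (1 : Fin 2)) ..
    have e2 : (Fin.snoc (α := fun _ => ZFSet.{u}) x y : Fin 3 → ZFSet.{u}) 2 = y :=
      Fin.snoc_last (α := fun _ => ZFSet.{u}) ..
    rw [hχ, e0, e1, e2]
    constructor
    · rintro ⟨p, -, t, -, h1, h2, ⟨h3, ⟨e, h4, h5⟩, h6⟩, h7, h8, h9⟩
      change p = t.powerset at h1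
      change y = p.powerset at h2
      subst h1 h2 h5
      let T : AdjClosed.{u} := ⟨t, fun a ha b hb => h3 a ha b hb, h4, fun {a b} ha hb => by
        obtain ⟨c, hc, rfl⟩ := h6 a ha b hb
        exact hc⟩
      have hx : ∀ i, x i ∈ T.set := by
        intro i
        fin_cases i
        · exact h7
        · exact h8
      refine ⟨T, rfl, hx, (hS T x hx).1 ?_⟩
      rw [← hψ, ← hT]
      exact h9
    · rintro ⟨T, rfl, hx, h⟩
      refine ⟨_, ZFSet.mem_powerset.2 fun z hz => hz, T.set,
        mem_pow2_of_mem_pow (ZFSet.mem_powerset.2 fun z hz => hz), rfl, rfl,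
        ⟨fun a ha b hb => T.trans a ha hb, ⟨_, T.empty_mem, rfl⟩, fun a ha b hb =>
          ⟨_, T.insert_mem ha hb, rfl⟩⟩, hx 0, hx 1, ?_⟩
      rw [hT, hψ]
      exact (hS T x hx).2 h
  have ex : ∀ x, S x → ∃ y, rhoH y ≤ 2 ^ (2 ^ rhoTuple x : Cardinal.{u}) ∧
      χ.Holds PwSt (Fin.snoc (α := fun _ => ZFSet.{u}) x y) := by
    intro x hx
    obtain ⟨s, h1, h2, h3⟩ := rhoTuple_spec x
    obtain ⟨T, h4, h5⟩ := exists_adjClosed (aleph0_le_rhoTuple x) h1 h3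
    refine ⟨T.set.powerset.powerset, ?_, (key _ _).2 ⟨T, rfl, fun i => h4 (h2 i), hx⟩⟩
    have h6 := aleph0_le_rhoTuple x
    refine rhoH_le (h6.trans ((cantor _).le.trans (cantor _).le)) T.trans.powerset.powerset
      (fun z hz => hz) ?_
    rw [ZFSet.card_powerset, ZFSet.card_powerset]
    exact power_le_power_left two_ne_zero (power_le_power_left two_ne_zero h5)
  refine ⟨χ, fun x => ⟨fun h => ?_, ?_⟩, ex⟩
  · obtain ⟨y, -, h⟩ := ex x h
    exact ⟨y, h⟩
  · rintro ⟨y, h⟩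
    obtain ⟨T, -, -, h⟩ := (key _ _).1 h
    exact h

theorem isDelta1_satRel_L2 : IsDelta1 PwSt (fun α : Cardinal.{u} => 2 ^ (2 ^ α : Cardinal.{u}))
    (SatRel L2.{u}) := by
  have h : ∀ (T : AdjClosed.{u}) (w : Fin 2 → ZFSet.{u}), (∀ i, w i ∈ T.set) →
      (SatIn (T.toEl (w 0)) (T.toEl (w 1)) ↔ SatRel L2 w) := by
    intro T w hw
    rw [satIn_iff, toEl_of_mem (hw 0), toEl_of_mem (hw 1)]
    have : ![w 0, w 1] = w := by
      funext i
      fin_cases i <;> rfl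
    rw [this]
  have hD := D3.satIn.{u} (n := 2) 0 1
  exact ⟨isSigma1_of_D3 hD h, isSigma1_of_D3 D3.not fun T w hw => not_congr (h T w hw)⟩

end BddSymb

namespace BddSymb

open Cardinal

/-! ## Classes defined by sentences -/

section definable

variable {τ : Vocab.{u}}

/-- The first-order assignments. -/
abbrev Str.Asg₁ (A : Str τ) : Type (u + 1) := ∀ x : τ.Srt × ℕ, A.El x.1

/-- The second-order assignments. -/
abbrev Str.Asg₂ (A : Str τ) : Type (u + 1) := ∀ X : Profile τ.Srt × ℕ, Set (Tuple A.dom X.1)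

instance (A : Str τ) (s : τ.Srt) : Nonempty (A.El s) := by
  obtain ⟨a, ha⟩ := A.dom_nonempty s
  exact ⟨⟨a, ha⟩⟩

theorem Term.finite_vars {s : τ.Srt} (t : Term τ s) : t.vars.Finite := by
  induction t with
  | var s n => exact Set.finite_singleton _
  | app f ts ih => exact Set.finite_iUnion ih

theorem Form.finite_free₁ (φ : Form τ) : φ.free₁.Finite := by
  induction φ with
  | eq t₁ t₂ => exact t₁.finite_vars.union t₂.finite_vars
  | rel r ts => exact Set.finite_iUnion fun i => (ts i).finite_vars
  | rvar p n ts => exact Set.finite_iUnion fun i => (ts i).finite_vars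
  | neg φ ih => exact ih
  | and φ ψ ih1 ih2 => exact ih1.union ih2
  | all₁ s n φ ih => exact ih.subset Set.sdiff_subset
  | all₂ p n φ ih => exact ih

theorem Form.finite_free₂ (φ : Form τ) : φ.free₂.Finite := by
  induction φ with
  | eq t₁ t₂ => exact Set.finite_empty
  | rel r ts => exact Set.finite_empty
  | rvar p n ts => exact Set.finite_singleton _
  | neg φ ih => exact ih
  | and φ ψ ih1 ih2 => exact ih1.union ih2
  | all₁ s n φ ih => exact ih
  | all₂ p n φ ih => exact ih.subset Set.sdiff_subset

theorem Form.IsFirstOrder.free₂_eq {φ : Form τ} (h : φ.IsFirstOrder) : φ.free₂ = ∅ := by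
  induction φ with
  | eq t₁ t₂ => rfl
  | rel r ts => rfl
  | rvar p n ts => exact h.elim
  | neg φ ih => exact ih h
  | and φ ψ ih1 ih2 => simp [Form.free₂, ih1 h.1, ih2 h.2]
  | all₁ s n φ ih => exact ih h
  | all₂ p n φ ih => exact h.elim

theorem Form.truth_all₁ (A : Str τ) (s : τ.Srt) (n : ℕ) (φ : Form τ) :
    (Form.all₁ s n φ).Truth A ↔ φ.Truth A := by
  classical
  constructor
  · intro h v V
    have := h v V (v (s, n))
    rwa [Function.update_eq_self] at this
  · exact fun h v V a => h _ _

theorem Form.truth_all₂ (A : Str τ) (p : Profile τ.Srt) (n : ℕ) (φ : Form τ) :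
    (Form.all₂ p n φ).Truth A ↔ φ.Truth A := by
  classical
  constructor
  · intro h v V
    have := h v V (V (p, n))
    rwa [Function.update_eq_self] at this
  · exact fun h v V a => h _ _

theorem Form.exists_close₁ {S : Set (τ.Srt × ℕ)} (hS : S.Finite) :
    ∀ φ : Form τ, φ.free₁ ⊆ S → ∃ φ' : Form τ, φ'.free₁ = ∅ ∧ (φ.IsFirstOrder → φ'.IsFirstOrder) ∧
      ∀ A, φ'.Truth A ↔ φ.Truth A := by
  induction S, hS using Set.Finite.induction_on with
  | empty => exact fun φ h => ⟨φ, Set.subset_empty_iff.1 h, id, fun A => Iff.rfl⟩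
  | @insert x S hx hS ih =>
    intro φ h
    obtain ⟨φ', h1, h2, h3⟩ := ih (.all₁ x.1 x.2 φ) (by
      rintro y ⟨hy, hne⟩
      exact (h hy).resolve_left hne)
    exact ⟨φ', h1, h2, fun A => (h3 A).trans (Form.truth_all₁ A _ _ _)⟩

theorem Form.exists_close₂ {S : Set (Profile τ.Srt × ℕ)} (hS : S.Finite) :
    ∀ φ : Form τ, φ.free₂ ⊆ S → φ.free₁ = ∅ → ∃ φ' : Form τ, φ'.IsSentence ∧
      ∀ A, φ'.Truth A ↔ φ.Truth A := by
  induction S, hS using Set.Finite.induction_on with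
  | empty => exact fun φ h h' => ⟨φ, ⟨h', Set.subset_empty_iff.1 h⟩, fun A => Iff.rfl⟩
  | @insert x S hx hS ih =>
    intro φ h h'
    obtain ⟨φ', h1, h2⟩ := ih (.all₂ x.1 x.2 φ) (by
      rintro y ⟨hy, hne⟩
      exact (h hy).resolve_left hne) h'
    exact ⟨φ', h1, fun A => (h2 A).trans (Form.truth_all₂ A _ _ _)⟩

/-- `Truth` quantifies over all assignments, so the universal closure over the finitely many free
variables has the same models. A first-order formula has no free relation variables, so its closure
stays first-order. -/
theorem Form.exists_sentence (φ : Form τ) : ∃ φ' : Form τ, φ'.IsSentence ∧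
    (φ.IsFirstOrder → φ'.IsFirstOrder) ∧ ∀ A, φ'.Truth A ↔ φ.Truth A := by
  obtain ⟨φ₁, h1, h2, h3⟩ := Form.exists_close₁ φ.finite_free₁ φ subset_rfl
  by_cases hφ : φ.IsFirstOrder
  · exact ⟨φ₁, ⟨h1, (h2 hφ).free₂_eq⟩, h2, h3⟩
  · obtain ⟨φ₂, h4, h5⟩ := Form.exists_close₂ φ₁.finite_free₂ φ₁ subset_rfl h1
    exact ⟨φ₂, h4, fun h => absurd h hφ, fun A => (h5 A).trans (h3 A)⟩

/-- `P` is defined by a formula, which is first-order if `fo` holds. -/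
def OpenDef (fo : Prop) (P : ∀ A : Str τ, A.Asg₁ → A.Asg₂ → Prop) : Prop :=
  ∃ φ : Form τ, (fo → φ.IsFirstOrder) ∧ ∀ A v V, φ.Realize A v V ↔ P A v V

namespace OpenDef

variable {fo : Prop} {P Q : ∀ A : Str τ, A.Asg₁ → A.Asg₂ → Prop}

theorem exists_sentence {K : Str τ → Prop} (h : OpenDef fo fun A _ _ => K A) :
    ∃ φ : Form τ, φ.IsSentence ∧ (fo → φ.IsFirstOrder) ∧ ∀ A, φ.Truth A ↔ K A := by
  obtain ⟨φ, h1, h2⟩ := h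
  obtain ⟨φ', h3, h4, h5⟩ := φ.exists_sentence
  refine ⟨φ', h3, fun h => h4 (h1 h), fun A => (h5 A).trans ⟨fun h => ?_, fun h v V => (h2 _ _ _).2 h⟩⟩
  exact (h2 A (fun _ => Classical.arbitrary _) fun _ => ∅).1 (h _ _)

theorem congr (hP : OpenDef fo P) (h : ∀ A v V, P A v V ↔ Q A v V) : OpenDef fo Q := by
  obtain ⟨φ, h1, h2⟩ := hP
  exact ⟨φ, h1, fun A v V => (h2 A v V).trans (h A v V)⟩

theorem not (hP : OpenDef fo P) : OpenDef fo fun A v V => ¬ P A v V := by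
  obtain ⟨φ, h1, h2⟩ := hP
  exact ⟨.neg φ, h1, fun A v V => not_congr (h2 A v V)⟩

theorem and (hP : OpenDef fo P) (hQ : OpenDef fo Q) : OpenDef fo fun A v V => P A v V ∧ Q A v V := by
  obtain ⟨φ, h1, h2⟩ := hP
  obtain ⟨ψ, h3, h4⟩ := hQ
  exact ⟨.and φ ψ, fun h => ⟨h1 h, h3 h⟩, fun A v V => and_congr (h2 A v V) (h4 A v V)⟩

theorem imp (hP : OpenDef fo P) (hQ : OpenDef fo Q) : OpenDef fo fun A v V => P A v V → Q A v V :=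
  (hP.and hQ.not).not.congr fun A v V => by tauto

theorem or (hP : OpenDef fo P) (hQ : OpenDef fo Q) : OpenDef fo fun A v V => P A v V ∨ Q A v V :=
  (hP.not.and hQ.not).not.congr fun A v V => by tauto

theorem iff (hP : OpenDef fo P) (hQ : OpenDef fo Q) :
    OpenDef fo fun A v V => (P A v V ↔ Q A v V) :=
  ((hP.imp hQ).and (hQ.imp hP)).congr fun A v V => by tauto

theorem eq {s : τ.Srt} (t₁ t₂ : Term τ s) :
    OpenDef fo fun A v V => t₁.eval A v = t₂.eval A v :=
  ⟨.eq t₁ t₂, fun _ => trivial, fun A v V => Iff.rfl⟩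

theorem rel (r : τ.Rel) (ts : ∀ i, Term τ ((τ.relDom r).sort i)) :
    OpenDef fo fun A v V => (fun i => (ts i).eval A v) ∈ A.rel r :=
  ⟨.rel r ts, fun _ => trivial, fun A v V => Iff.rfl⟩

theorem rvar (p : Profile τ.Srt) (n : ℕ) (ts : ∀ i, Term τ (p.sort i)) :
    OpenDef False fun A v V => (fun i => (ts i).eval A v) ∈ V (p, n) :=
  ⟨.rvar p n ts, False.elim, fun A v V => Iff.rfl⟩

theorem const_true (s : τ.Srt) : OpenDef fo fun (A : Str τ) _ _ => True :=
  (eq (.var s 0) (.var s 0)).congr fun A v V => by simp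

theorem finite_forall (s : τ.Srt) {ι : Type*} [Finite ι]
    {P : ι → ∀ A : Str τ, A.Asg₁ → A.Asg₂ → Prop} (h : ∀ i, OpenDef fo (P i)) :
    OpenDef fo fun A v V => ∀ i, P i A v V := by
  classical
  have := Fintype.ofFinite ι
  suffices H : ∀ S : Finset ι, OpenDef fo fun A v V => ∀ i ∈ S, P i A v V from
    (H Finset.univ).congr fun A v V => by simp
  intro S
  induction S using Finset.induction_on with
  | empty => exact (const_true s).congr fun A v V => by simp
  | insert a S _ ih => exact ((h a).and ih).congr fun A v V => by simp

theorem finite_exists (s : τ.Srt) {ι : Type*} [Finite ι]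
    {P : ι → ∀ A : Str τ, A.Asg₁ → A.Asg₂ → Prop} (h : ∀ i, OpenDef fo (P i)) :
    OpenDef fo fun A v V => ∃ i, P i A v V :=
  (finite_forall s fun i => (h i).not).not.congr fun A v V => by simp

-- The condition `hi` says that `P`, once its element argument is explicit, ignores the variable
-- `(s, n)`. It takes the place of a theory of capture: each use names a concrete variable and
-- checks that it is fresh.
open Classical in
theorem all₁ (s : τ.Srt) (n : ℕ) {P : ∀ A : Str τ, A.Asg₁ → A.Asg₂ → A.El s → Prop}
    (h : OpenDef fo fun A v V => P A v V (v (s, n)))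
    (hi : ∀ A v V a b, P A (Function.update v (s, n) b) V a ↔ P A v V a) :
    OpenDef fo fun A v V => ∀ a, P A v V a := by
  obtain ⟨φ, h1, h2⟩ := h
  refine ⟨.all₁ s n φ, h1, fun A v V => forall_congr' fun a => (h2 _ _ _).trans ?_⟩
  beta_reduce
  rw [Function.update_self, hi]

open Classical in
theorem ex₁ (s : τ.Srt) (n : ℕ) {P : ∀ A : Str τ, A.Asg₁ → A.Asg₂ → A.El s → Prop}
    (h : OpenDef fo fun A v V => P A v V (v (s, n)))
    (hi : ∀ A v V a b, P A (Function.update v (s, n) b) V a ↔ P A v V a) :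
    OpenDef fo fun A v V => ∃ a, P A v V a :=
  (all₁ (P := fun A v V a => ¬ P A v V a) s n h.not
    fun A v V a b => not_congr (hi A v V a b)).not.congr fun A v V => by
    simp only [not_forall, not_not]

open Classical in
theorem all₂ (p : Profile τ.Srt) (n : ℕ)
    {P : ∀ A : Str τ, A.Asg₁ → A.Asg₂ → Set (Tuple A.dom p) → Prop}
    (h : OpenDef False fun A v V => P A v V (V (p, n)))
    (hi : ∀ A v V a b, P A v (Function.update V (p, n) b) a ↔ P A v V a) :
    OpenDef False fun A v V => ∀ a, P A v V a := by
  obtain ⟨φ, h1, h2⟩ := h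
  refine ⟨.all₂ p n φ, False.elim, fun A v V => forall_congr' fun a => (h2 _ _ _).trans ?_⟩
  beta_reduce
  rw [Function.update_self, hi]

/-- A block of quantifiers is a quantifier over the assignments that differ from `v` only on the
block. This allows blocks whose length is not fixed, as needed for tuples of arguments. -/
theorem all_agree {S : Set (τ.Srt × ℕ)} (hS : S.Finite) (hP : OpenDef fo P) :
    OpenDef fo fun A v V => ∀ v' : A.Asg₁, (∀ x ∉ S, v' x = v x) → P A v' V := by
  classical
  induction S, hS using Set.Finite.induction_on with
  | empty =>
    refine hP.congr fun A v V => ⟨fun h v' hv => ?_, fun h => h v fun x _ => rfl⟩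
    rwa [show v' = v from funext fun x => hv x (Set.notMem_empty x)]
  | @insert x S hx hS ih =>
    obtain ⟨φ, h1, h2⟩ := ih
    refine ⟨.all₁ x.1 x.2 φ, h1, fun A v V => ?_⟩
    simp only [Form.Realize, h2]
    constructor
    · intro h v' hv
      refine h (v' x) v' fun y hy => ?_
      by_cases hyx : y = x
      · subst hyx
        rw [Function.update_self]
      · rw [Function.update_of_ne hyx]
        exact hv y fun h => h.elim hyx hy
    · intro h a v' hv
      refine h v' fun y hy => ?_
      rw [hv y fun h => hy (Or.inr h), Function.update_of_ne fun h => hy (Or.inl h)]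

theorem allTuple {ι : Type} [Finite ι] (x : ι → τ.Srt × ℕ) (hx : Function.Injective x)
    {P : ∀ A : Str τ, A.Asg₁ → A.Asg₂ → (∀ i, A.El (x i).1) → Prop}
    (h : OpenDef fo fun A v V => P A v V fun i => v (x i))
    (hi : ∀ A v V v' a, (∀ y, (∀ i, y ≠ x i) → v' y = v y) → (P A v' V a ↔ P A v V a)) :
    OpenDef fo fun A v V => ∀ a, P A v V a := by
  classical
  refine (all_agree (Set.finite_range x) h).congr fun A v V => ⟨fun H a => ?_, fun H v' hv => ?_⟩
  · let v' : A.Asg₁ := fun y => if h : ∃ i, y = x i then h.choose_spec ▸ a h.choose else v y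
    have h1 : ∀ y, (∀ i, y ≠ x i) → v' y = v y := fun y hy => dif_neg fun ⟨i, hi⟩ => hy i hi
    have h2 : (fun i => v' (x i)) = a := by
      funext i
      have hex : ∃ j, x i = x j := ⟨i, rfl⟩
      have : v' (x i) = hex.choose_spec ▸ a hex.choose := dif_pos hex
      rw [this]
      have hj : hex.choose = i := (hx hex.choose_spec).symm
      generalize_proofs p1
      revert p1
      generalize hex.choose = j at hj
      subst hj
      intro p1
      rfl
    have h3 := H v' fun y hy => h1 y fun i hi => hy ⟨i, hi.symm⟩
    rw [h2] at h3
    exact (hi _ _ _ _ _ h1).1 h3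
  · exact (hi _ _ _ _ _ fun y hy => hv y fun ⟨i, hi⟩ => hy i hi.symm).2 (H _)

theorem exTuple {ι : Type} [Finite ι] (x : ι → τ.Srt × ℕ) (hx : Function.Injective x)
    {P : ∀ A : Str τ, A.Asg₁ → A.Asg₂ → (∀ i, A.El (x i).1) → Prop}
    (h : OpenDef fo fun A v V => P A v V fun i => v (x i))
    (hi : ∀ A v V v' a, (∀ y, (∀ i, y ≠ x i) → v' y = v y) → (P A v' V a ↔ P A v V a)) :
    OpenDef fo fun A v V => ∃ a, P A v V a :=
  (allTuple (P := fun A v V a => ¬ P A v V a) x hx h.not fun A v V v' a hy => not_congr (hi A v V v' a hy)).not.congr fun A v V => by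
    simp only [not_forall, not_not]

end OpenDef

/-! ## Isomorphic copies -/

/-- The copy of `A` on other domains. -/
def Str.transport (A : Str τ) {D : τ.Srt → ZFSet.{u}} (e : ∀ s, A.El s ≃ {x : ZFSet.{u} // x ∈ D s}) :
    Str τ where
  dom := D
  dom_nonempty s := ⟨_, (e s (Classical.arbitrary _)).2⟩
  rel r := {t | (fun i => (e _).symm (t i)) ∈ A.rel r}
  fn f t := e _ (A.fn f fun i => (e _).symm (t i))

def Str.transportIso (A : Str τ) {D : τ.Srt → ZFSet.{u}}
    (e : ∀ s, A.El s ≃ {x : ZFSet.{u} // x ∈ D s}) : Iso A (A.transport e) where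
  map := e
  map_rel r t := by
    change _ ↔ (fun i => (e _).symm (e _ (t i))) ∈ A.rel r
    simp only [Equiv.symm_apply_apply]
  map_fn f t := by
    change _ = e _ (A.fn f fun i => (e _).symm (e _ (t i)))
    simp only [Equiv.symm_apply_apply]
    rfl

def Iso.symm {A B : Str τ} (i : Iso A B) : Iso B A where
  map s := (i.map s).symm
  map_rel r t := by
    rw [i.map_rel]
    simp
  map_fn f t := by
    rw [Equiv.symm_apply_eq, i.map_fn]
    simp

theorem Iso.eval {A B : Str τ} (i : Iso A B) (v : A.Asg₁) {s : τ.Srt} (t : Term τ s) :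
    t.eval B (fun x => i.map _ (v x)) = i.map s (t.eval A v) := by
  induction t with
  | var s n => rfl
  | app f ts ih =>
    simp only [Term.eval, ih]
    exact (i.map_fn f _).symm

/-- A first-order formula ignores relation variables, so the second-order assignments on the two
sides need not correspond. -/
theorem Iso.realize {A B : Str τ} (i : Iso A B) {φ : Form τ} (h : φ.IsFirstOrder) (v : A.Asg₁)
    (V : A.Asg₂) (V' : B.Asg₂) :
    φ.Realize B (fun x => i.map _ (v x)) V' ↔ φ.Realize A v V := by
  classical
  induction φ generalizing v with
  | eq t₁ t₂ => simp only [Form.Realize, i.eval, EmbeddingLike.apply_eq_iff_eq]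
  | rel r ts =>
    simp only [Form.Realize, i.eval]
    exact (i.map_rel r _).symm
  | rvar p n ts => exact h.elim
  | neg φ ih => exact not_congr (ih h v)
  | and φ ψ ih1 ih2 => exact and_congr (ih1 h.1 v) (ih2 h.2 v)
  | all₁ s n φ ih =>
    simp only [Form.Realize]
    rw [(i.map s).surjective.forall]
    refine forall_congr' fun a => ?_
    rw [← ih h]
    have : Function.update (fun x => i.map _ (v x)) (s, n) (i.map s a) =
        fun x : τ.Srt × ℕ => i.map x.1 (Function.update v (s, n) a x) := by
      funext x
      by_cases hx : x = (s, n)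
      · subst hx
        simp
      · simp [hx]
    rw [← this]
  | all₂ p n φ ih => exact h.elim

theorem Iso.truth {A B : Str τ} (i : Iso A B) {φ : Form τ} (h : φ.IsFirstOrder) (hA : φ.Truth A) :
    φ.Truth B := by
  intro v V
  have := (i.realize h (fun x => (i.map _).symm (v x)) (fun _ => ∅) V).2 (hA _ _)
  simpa using this

end definable

end BddSymb

namespace BddSymb

open Cardinal

/-! ## Binary relation symbols -/

section pairs

variable {S : Type u} {τ : Vocab.{u}}

def pairTuple {dom : S → ZFSet.{u}} {a b : S} (x : {z // z ∈ dom a}) (y : {z // z ∈ dom b}) :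
    Tuple dom ⟨2, ![a, b]⟩ := fun i => match i with
  | 0 => x
  | 1 => y

def pairTerm {a b : τ.Srt} (t₁ : Term τ a) (t₂ : Term τ b) (i : Fin 2) : Term τ (![a, b] i) :=
  match i with
  | 0 => t₁
  | 1 => t₂

theorem pairTerm_eval (A : Str τ) (v : A.Asg₁) {a b : τ.Srt} (t₁ : Term τ a) (t₂ : Term τ b) :
    (fun i => (pairTerm t₁ t₂ i).eval A v : Tuple A.dom ⟨2, ![a, b]⟩) =
      pairTuple (t₁.eval A v) (t₂.eval A v) := by
  funext i
  match i with
  | 0 => rfl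
  | 1 => rfl

end pairs

/-! ## The function `2 ^ 2 ^ α` is definably bounding -/

theorem card_le_of_injective {a : ZFSet.{u}} {Y : Type u} {f : {x // x ∈ a} → Y}
    (hf : Function.Injective f) : a.card ≤ #Y :=
  Cardinal.mk_le_of_injective (f := fun x => f ((equivShrink.{u} {x // x ∈ a}).symm x))
    (hf.comp (equivShrink.{u} {x // x ∈ a}).symm.injective)

theorem exists_injective_of_card_le {a b : ZFSet.{u}} (h : a.card ≤ b.card) :
    ∃ f : {x // x ∈ a} → {x // x ∈ b}, Function.Injective f := by
  obtain ⟨f⟩ := Cardinal.le_def _ _ |>.1 h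
  exact ⟨fun x => (equivShrink.{u} {x // x ∈ b}).symm (f (equivShrink.{u} {x // x ∈ a} x)),
    (equivShrink.{u} {x // x ∈ b}).symm.injective.comp
      (f.injective.comp (equivShrink.{u} {x // x ∈ a}).injective)⟩

/-- Extensionality of `R` makes y ↦ {x | R x y} injective. -/
theorem card_le_two_power {a b : ZFSet.{u}} {R : {x // x ∈ a} → {x // x ∈ b} → Prop}
    (h : ∀ y y', (∀ x, R x y ↔ R x y') → y = y') : b.card ≤ 2 ^ a.card := by
  have := card_le_of_injective (a := b) (Y := Set (Shrink.{u} {x // x ∈ a}))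
    (f := fun y => {x | R ((equivShrink.{u} {x // x ∈ a}).symm x) y}) (by
      intro y y' hy
      refine h y y' fun x => ?_
      have := Set.ext_iff.1 hy (equivShrink.{u} {x // x ∈ a} x)
      simpa only [Set.mem_ofPred_eq, Equiv.symm_apply_apply] using this)
  rwa [Cardinal.mk_set] at this

theorem sum_card_sum {S T : Type u} (d : S ⊕ T → ZFSet.{u}) :
    Cardinal.sum (fun s => (d s).card) =
      Cardinal.sum (fun s => (d (.inl s)).card) + Cardinal.sum fun s => (d (.inr s)).card := by
  simp only [← Cardinal.mk_sigma, ZFSet.card, Cardinal.add_def]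
  exact Cardinal.mk_congr (Equiv.sumSigmaDistrib _)

theorem Str.card_ext {τ : Vocab.{u}} {E : VocabExt τ} (B : Str E.vocab) :
    B.card = B.reduct.card + Cardinal.sum fun s => (B.dom (Sum.inr s)).card :=
  sum_card_sum (S := τ.Srt) (T := E.Srt) B.dom

/-- One new sort for `℘(A)`, and two membership relations. -/
def powExt : VocabExt twoSorts.{u} where
  Srt := PUnit
  Rel := ULift Bool
  Fn := PEmpty
  relDom r := if r.down then ⟨2, ![Sum.inr ⟨⟩, Sum.inl ⟨true⟩]⟩
    else ⟨2, ![Sum.inl ⟨false⟩, Sum.inr ⟨⟩]⟩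
  fnDom := PEmpty.elim
  fnCod := PEmpty.elim

def powSrtA : powExt.{u}.vocab.Srt := Sum.inl ⟨false⟩

def powSrtB : powExt.{u}.vocab.Srt := Sum.inl ⟨true⟩

def powSrtP : powExt.{u}.vocab.Srt := Sum.inr ⟨⟩

def powMem₁ (B : Str powExt.{u}.vocab) (a : B.El powSrtA) (p : B.El powSrtP) : Prop :=
  (pairTuple a p : Tuple B.dom ⟨2, ![powSrtA, powSrtP]⟩) ∈ B.rel (Sum.inr ⟨false⟩)

def powMem₂ (B : Str powExt.{u}.vocab) (p : B.El powSrtP) (b : B.El powSrtB) : Prop :=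
  (pairTuple p b : Tuple B.dom ⟨2, ![powSrtP, powSrtB]⟩) ∈ B.rel (Sum.inr ⟨true⟩)

theorem openDef_powMem₁ {fo : Prop} (t₁ : Term powExt.{u}.vocab powSrtA)
    (t₂ : Term powExt.{u}.vocab powSrtP) :
    OpenDef fo fun B v V => powMem₁ B (t₁.eval B v) (t₂.eval B v) :=
  (OpenDef.rel (τ := powExt.{u}.vocab) (Sum.inr ⟨false⟩) (pairTerm t₁ t₂)).congr fun B v V =>
    Iff.of_eq (congrArg (· ∈ B.rel (Sum.inr ⟨false⟩)) (pairTerm_eval B v t₁ t₂))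

theorem openDef_powMem₂ {fo : Prop} (t₁ : Term powExt.{u}.vocab powSrtP)
    (t₂ : Term powExt.{u}.vocab powSrtB) :
    OpenDef fo fun B v V => powMem₂ B (t₁.eval B v) (t₂.eval B v) :=
  (OpenDef.rel (τ := powExt.{u}.vocab) (Sum.inr ⟨true⟩) (pairTerm t₁ t₂)).congr fun B v V =>
    Iff.of_eq (congrArg (· ∈ B.rel (Sum.inr ⟨true⟩)) (pairTerm_eval B v t₁ t₂))

/-- Nothing says that the new sort is the full power set. Extensionality alone gives the upper
bounds that are wanted, both for B and for the new sort itself. -/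
def PowAxiom (B : Str powExt.{u}.vocab) : Prop :=
  (∀ p p', (∀ a, powMem₁ B a p ↔ powMem₁ B a p') → p = p') ∧
    ∀ b b', (∀ p, powMem₂ B p b ↔ powMem₂ B p b') → b = b'

theorem openDef_powAxiom : OpenDef True fun (B : Str powExt.{u}.vocab) _ _ => PowAxiom B := by
  refine .and (.all₁ powSrtP 0 (.all₁ powSrtP 1 (.imp (.all₁ powSrtA 2
    (.iff (openDef_powMem₁ (.var _ 2) (.var _ 0)) (openDef_powMem₁ (.var _ 2) (.var _ 1))) ?_)
    (.eq (.var powSrtP 0) (.var powSrtP 1))) ?_) ?_) (.all₁ powSrtB 0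
    (.all₁ powSrtB 1 (.imp (.all₁ powSrtP 2
    (.iff (openDef_powMem₂ (.var _ 2) (.var _ 0)) (openDef_powMem₂ (.var _ 2) (.var _ 1))) ?_)
    (.eq (.var powSrtB 0) (.var powSrtB 1))) ?_) ?_)
  all_goals intros; simp

theorem PowAxiom.card_le {B : Str powExt.{u}.vocab} (h : PowAxiom B) :
    (B.dom (Sum.inr ⟨⟩)).card ≤ 2 ^ (B.dom (Sum.inl ⟨false⟩)).card ∧
      (B.dom (Sum.inl ⟨true⟩)).card ≤ 2 ^ (B.dom (Sum.inr ⟨⟩)).card :=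
  ⟨card_le_two_power h.1, card_le_two_power h.2⟩

/-- For the converse the new sort is the true ℘(A) with true membership, and the second relation is
membership pulled back along an injection of B into ℘(℘(A)). -/
theorem exists_powAxiom (S : Str twoSorts.{u})
    (h : (S.dom ⟨true⟩).card ≤ 2 ^ (2 ^ (S.dom ⟨false⟩).card : Cardinal.{u})) :
    ∃ B : Str powExt.{u}.vocab, PowAxiom B ∧ S = B.reduct := by
  rw [← ZFSet.card_powerset, ← ZFSet.card_powerset] at h
  obtain ⟨f, hf⟩ := exists_injective_of_card_le h
  let dom : twoSorts.{u}.Srt ⊕ PUnit → ZFSet.{u} :=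
    Sum.elim S.dom fun _ => (S.dom ⟨false⟩).powerset
  let B : Str powExt.{u}.vocab :=
    { dom := dom
      dom_nonempty := fun s => match s with
        | Sum.inl s => S.dom_nonempty s
        | Sum.inr _ => ⟨_, ZFSet.mem_powerset.2 fun z hz => hz⟩
      rel := fun r => match r with
        | Sum.inl r => S.rel r
        | Sum.inr ⟨false⟩ => {t : Tuple dom ⟨2, ![Sum.inl ⟨false⟩, Sum.inr ⟨⟩]⟩ |
            (t (0 : Fin 2)).1 ∈ (t (1 : Fin 2)).1}
        | Sum.inr ⟨true⟩ => {t : Tuple dom ⟨2, ![Sum.inr ⟨⟩, Sum.inl ⟨true⟩]⟩ |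
            (t (0 : Fin 2)).1 ∈ (f (t (1 : Fin 2))).1}
      fn := fun g => match g with
        | Sum.inl g => S.fn g
        | Sum.inr g => g.elim }
  refine ⟨B, ⟨fun p p' hp => Subtype.ext ?_, fun b b' hb => hf (Subtype.ext ?_)⟩, rfl⟩
  · have h1 : ∀ a ∈ S.dom ⟨false⟩, a ∈ p.1 ↔ a ∈ p'.1 := fun a ha => hp ⟨a, ha⟩
    ext a
    exact ⟨fun ha => (h1 a (ZFSet.mem_powerset.1 p.2 ha)).1 ha,
      fun ha => (h1 a (ZFSet.mem_powerset.1 p'.2 ha)).2 ha⟩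
  · have h1 : ∀ a ∈ (S.dom ⟨false⟩).powerset, a ∈ (f b).1 ↔ a ∈ (f b').1 := fun a ha => hb ⟨a, ha⟩
    ext a
    exact ⟨fun ha => (h1 a (ZFSet.mem_powerset.1 (f b).2 ha)).1 ha,
      fun ha => (h1 a (ZFSet.mem_powerset.1 (f b').2 ha)).2 ha⟩

theorem definablyBounding_two_power :
    DefinablyBounding fun α : Cardinal.{u} => 2 ^ (2 ^ α : Cardinal.{u}) := by
  have pow_mono : ∀ {α β : Cardinal.{u}}, α ≤ β → (2 ^ α : Cardinal.{u}) ≤ 2 ^ β :=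
    fun h => power_le_power_left two_ne_zero h
  obtain ⟨φ, h1, h2, h3⟩ := openDef_powAxiom.{u}.exists_sentence
  refine ⟨fun α β h => pow_mono (pow_mono h), powExt, ⟨φ, h1, h2 trivial⟩, fun S => ?_, fun S => ?_⟩
  · constructor
    · intro h
      obtain ⟨B, hB, hS⟩ := exists_powAxiom S h
      exact ⟨B, (h3 B).2 hB, hS⟩
    · rintro ⟨B, hB, rfl⟩
      have h4 := ((h3 B).1 hB).card_le
      exact h4.2.trans (pow_mono h4.1)
  · refine ⟨S.card + 2 ^ (S.dom ⟨false⟩).card, ?_⟩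
    rintro B hB rfl
    rw [B.card_ext]
    gcongr
    have h4 := ((h3 B).1 hB).card_le
    have h5 : Cardinal.sum (fun s : PUnit => (B.dom (Sum.inr s)).card) ≤ _ :=
      (Cardinal.sum_le_sum _ (fun _ => (B.dom (Sum.inr ⟨⟩)).card) fun _ => le_rfl)
    refine h5.trans ?_
    rw [Cardinal.sum_const']
    rw [Cardinal.mk_punit, one_mul]
    exact h4.1

end BddSymb

namespace BddSymb

open Cardinal

/-! ## Well-founded extensional relations -/

section collapse

universe v

variable {X : Type v} (E : X → X → Prop)

def IsExt : Prop := ∀ a b, (∀ z, E z a ↔ E z b) → a = b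

/-- `b` is the power set of `a` in the sense of `E`. -/
def EPow (a b : X) : Prop := ∀ z, E z b ↔ ∀ w, E w z → E w a

/-- Power sets in the sense of `E` are full. -/
def ECorrect : Prop :=
  ∀ a b, EPow E a b → ∀ Y : Set X, (∀ y, y ∈ Y → E y a) → ∃ z, ∀ w, E w z ↔ w ∈ Y

/-- `c` is an isomorphism of `(X, E)` and a transitive class. -/
structure IsCollapse (c : X → ZFSet.{u}) : Prop where
  inj : Function.Injective c
  mem_iff : ∀ a b, c b ∈ c a ↔ E b a
  trans : ∀ a, ∀ z ∈ c a, ∃ b, c b = z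

variable {E}

/-- Mostowski collapse: c(a) = {c(b) | b E a} by recursion on E; extensionality yields injectivity
by induction on the first argument. -/
theorem exists_isCollapse [Small.{u} X] (hE : WellFounded E) (hx : IsExt E) :
    ∃ c : X → ZFSet.{u}, IsCollapse E c := by
  let c : X → ZFSet.{u} := hE.fix fun a ih => ZFSet.range fun b : {b // E b a} => ih b.1 b.2
  have hc : ∀ a, c a = ZFSet.range fun b : {b // E b a} => c b.1 := fun a => hE.fix_eq _ a
  have mem : ∀ a z, z ∈ c a ↔ ∃ b, E b a ∧ c b = z := by
    intro a z
    rw [hc, ZFSet.mem_range]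
    simp
  have inj : ∀ a b, c a = c b → a = b := by
    intro a
    induction a using hE.induction with
    | _ a ih =>
      intro b hab
      refine hx a b fun z => ⟨fun h => ?_, fun h => ?_⟩
      · obtain ⟨y, hy, h2⟩ := (mem b _).1 (hab ▸ (mem a _).2 ⟨z, h, rfl⟩)
        rwa [ih z h y h2.symm]
      · obtain ⟨y, hy, h2⟩ := (mem a _).1 (hab ▸ (mem b _).2 ⟨z, h, rfl⟩)
        rwa [← ih y hy z h2]
  refine ⟨c, fun a b => inj a b, fun a b => ⟨fun h => ?_, fun h => (mem _ _).2 ⟨b, h, rfl⟩⟩, fun a z hz => ?_⟩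
  · obtain ⟨y, hy, h2⟩ := (mem a _).1 h
    rwa [← inj _ _ h2]
  · obtain ⟨b, -, h⟩ := (mem a z).1 hz
    exact ⟨b, h⟩

namespace IsCollapse

variable {c : X → ZFSet.{u}} (hc : IsCollapse E c)

include hc

theorem mem {a : X} {z : ZFSet.{u}} : z ∈ c a ↔ ∃ b, E b a ∧ c b = z := by
  constructor
  · intro h
    obtain ⟨b, rfl⟩ := hc.trans a z h
    exact ⟨b, (hc.mem_iff _ _).1 h, rfl⟩
  · rintro ⟨b, h, rfl⟩
    exact (hc.mem_iff _ _).2 h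

theorem subset_iff {a b : X} : c b ⊆ c a ↔ ∀ w, E w b → E w a := by
  constructor
  · exact fun h w hw => (hc.mem_iff _ _).1 (h ((hc.mem_iff _ _).2 hw))
  · intro h z hz
    obtain ⟨w, hw, rfl⟩ := hc.mem.1 hz
    exact (hc.mem_iff _ _).2 (h w hw)

theorem isExt : IsExt E := by
  intro a b h
  apply hc.inj
  ext z
  simp only [hc.mem, h]

theorem wellFounded : WellFounded E := by
  have : E = InvImage (· ∈ ·) c := by
    funext b a
    exact propext (hc.mem_iff a b).symm
  rw [this]
  exact InvImage.wf c ZFSet.mem_wf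

theorem ePow_of_eq {a b : X} (h : c b = (c a).powerset) : EPow E a b := by
  intro z
  rw [← hc.mem_iff, h, ZFSet.mem_powerset, hc.subset_iff]

/-- Without `ECorrect` the model could miss subsets of a. Correctness, applied to the preimage of an
arbitrary subset z of c(a), provides the element that collapses to z. -/
theorem ePow_iff (hE : ECorrect E) {a b : X} : EPow E a b ↔ c b = (c a).powerset := by
  refine ⟨fun h => ?_, hc.ePow_of_eq⟩
  ext z
  rw [ZFSet.mem_powerset]
  constructor
  · intro hz
    obtain ⟨y, hy, rfl⟩ := hc.mem.1 hz
    exact hc.subset_iff.2 ((h y).1 hy)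
  · intro hz
    obtain ⟨y, hy⟩ := hE a b h {w | c w ∈ z} fun w hw => (hc.mem_iff _ _).1 (hz hw)
    have : z = c y := by
      ext w
      rw [hc.mem]
      constructor
      · intro hw
        obtain ⟨x, -, rfl⟩ := hc.mem.1 (hz hw)
        exact ⟨x, (hy x).2 hw, rfl⟩
      · rintro ⟨x, hx, rfl⟩
        exact (hy x).1 hx
    rw [this, hc.mem_iff, h y]
    rw [this] at hz
    exact hc.subset_iff.1 hz

theorem eCorrect (h : ∀ a b, EPow E a b → c b = (c a).powerset) : ECorrect E := by
  intro a b hab Y hY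
  have : (c a).sep (fun z => ∃ w ∈ Y, c w = z) ∈ c b := by
    rw [h a b hab, ZFSet.mem_powerset]
    exact ZFSet.sep_subset
  obtain ⟨y, -, hy⟩ := hc.mem.1 this
  refine ⟨y, fun w => ?_⟩
  rw [← hc.mem_iff, hy, ZFSet.mem_sep]
  constructor
  · rintro ⟨-, x, hx, h⟩
    rwa [← hc.inj h]
  · exact fun hw => ⟨(hc.mem_iff _ _).2 (hY w hw), w, hw, rfl⟩

end IsCollapse

variable (E) in
/-- Truth of a `Δ₀(PwSt)`-formula in `(X, E)`. -/
def HoldsE : {n : ℕ} → Delta0 2 n → (Fin n → X) → Prop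
  | _, .mem i j, v => E (v i) (v j)
  | _, .eq i j, v => v i = v j
  | _, .pred i, v => EPow E (v (i 0)) (v (i 1))
  | _, .neg φ, v => ¬ HoldsE φ v
  | _, .and φ ψ, v => HoldsE φ v ∧ HoldsE ψ v
  | _, .ball i φ, v => ∀ z, E z (v i) → HoldsE φ (Fin.snoc (α := fun _ => X) v z)

/-- Transitivity of the range takes care of the bounded quantifiers, and correctness of the atoms
`PwSt`; so Δ₀(`PwSt`)-formulas are absolute. -/
theorem IsCollapse.holdsE_iff {c : X → ZFSet.{u}} (hc : IsCollapse E c) (hE : ECorrect E) {n : ℕ}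
    (ψ : Delta0 2 n) (v : Fin n → X) : HoldsE E ψ v ↔ ψ.Holds PwSt fun i => c (v i) := by
  induction ψ with
  | mem i j => exact (hc.mem_iff _ _).symm
  | eq i j => exact hc.inj.eq_iff.symm
  | pred i => exact (hc.ePow_iff hE).trans (PwSt_holds fun l => c (v (i l))).symm
  | neg φ ih => exact not_congr (ih v)
  | and φ ψ ih1 ih2 => exact and_congr (ih1 v) (ih2 v)
  | ball i φ ih =>
    have h : ∀ z, (fun i => c ((Fin.snoc (α := fun _ => X) v z : Fin _ → X) i)) =
        Fin.snoc (α := fun _ => ZFSet.{u}) (fun i => c (v i)) (c z) := by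
      intro z
      funext i
      refine Fin.lastCases ?_ (fun i => ?_) i <;> simp
    simp only [HoldsE, Delta0.Holds, ih, h]
    constructor
    · intro H z hz
      obtain ⟨b, hb, rfl⟩ := hc.mem.1 hz
      exact H b hb
    · exact fun H z hz => H _ ((hc.mem_iff _ _).2 hz)

end collapse

/-! ## Sentences about a binary relation -/

namespace OpenDef

variable {τ : Vocab.{u}} {M : τ.Srt} {E : ∀ A : Str τ, A.El M → A.El M → Prop} {fo : Prop}

theorem isExt (hE : ∀ t₁ t₂ : Term τ M, OpenDef fo fun A v V => E A (t₁.eval A v) (t₂.eval A v)) :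
    OpenDef fo fun A _ _ => IsExt (E A) := by
  refine .all₁ M 0 (.all₁ M 1 (.imp (.all₁ M 2 (.iff (hE (.var M 2) (.var M 0))
    (hE (.var M 2) (.var M 1))) ?_) (.eq (.var M 0) (.var M 1))) ?_) ?_
  all_goals intros; simp

theorem ePow (hE : ∀ t₁ t₂ : Term τ M, OpenDef fo fun A v V => E A (t₁.eval A v) (t₂.eval A v))
    (i j : ℕ) : OpenDef fo fun A v V => EPow (E A) (v (M, i)) (v (M, j)) := by
  have hv : ∀ k l, OpenDef fo fun A v V => E A (v (M, k)) (v (M, l)) :=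
    fun k l => hE (.var M k) (.var M l)
  -- The numbers i + j + 1 and i + j + 2 are chosen as fresh variables.
  have h1 : i + j + 1 ≠ i := by omega
  have h2 : i + j + 1 ≠ j := by omega
  have h3 : i + j + 2 ≠ i := by omega
  refine .all₁ M (i + j + 1) (.iff (hv (i + j + 1) j) (.all₁ M (i + j + 2)
    (.imp (hv (i + j + 2) (i + j + 1)) (hv (i + j + 2) i)) ?_)) ?_
  all_goals intros; simp [h1.symm, h2.symm, h3.symm]

/-- The variable x_i becomes the variable number i of sort `M`. A bounded quantifier over `Fin n`
binds x_n, which is different from all variables in use. -/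
theorem holdsE (hE : ∀ t₁ t₂ : Term τ M, OpenDef fo fun A v V => E A (t₁.eval A v) (t₂.eval A v))
    {n : ℕ} (ψ : Delta0 2 n) :
    OpenDef fo fun A v V => HoldsE (E A) ψ fun i => v (M, i) := by
  classical
  induction ψ with
  | mem i j => exact hE (.var M i) (.var M j)
  | eq i j => exact .eq (.var M i) (.var M j)
  | pred i => exact ePow hE _ _
  | neg φ ih => exact ih.not
  | and φ ψ ih1 ih2 => exact ih1.and ih2
  | @ball n i φ ih =>
    refine .all₁ M n (P := fun A v V z => E A z (v (M, i)) →
      HoldsE (E A) φ (Fin.snoc (α := fun _ => A.El M) (fun i : Fin n => v (M, i)) z))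
      (.imp (hE (.var M n) (.var M i)) (ih.congr fun A v V => Iff.of_eq ?_)) ?_
    · congr 1
      funext i
      refine Fin.lastCases ?_ (fun i => ?_) i <;> simp
    · intro A v V a b
      have h : ∀ j : Fin n, (j : ℕ) ≠ n := fun j => j.2.ne
      simp [h]

/-- Well-foundedness is expressed as induction for all unary relations; applied to the accessible
part, induction returns well-foundedness. -/
theorem wellFounded
    (hE : ∀ t₁ t₂ : Term τ M, OpenDef False fun A v V => E A (t₁.eval A v) (t₂.eval A v)) :
    OpenDef False fun A _ _ => WellFounded (E A) := by
  have hZ : ∀ i, OpenDef False fun (A : Str τ) v V => (fun _ => v (M, i) : Tuple A.dom ⟨1, fun _ => M⟩) ∈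
      V (⟨1, fun _ => M⟩, 0) := fun i => .rvar ⟨1, fun _ => M⟩ 0 fun _ => .var M i
  have : OpenDef False fun (A : Str τ) _ _ => ∀ Z : Set (Tuple A.dom ⟨1, fun _ => M⟩),
      (∀ a, (∀ b, E A b a → (fun _ => b : Tuple A.dom ⟨1, fun _ => M⟩) ∈ Z) →
        (fun _ => a : Tuple A.dom ⟨1, fun _ => M⟩) ∈ Z) →
      ∀ a : A.El M, (fun _ => a : Tuple A.dom ⟨1, fun _ => M⟩) ∈ Z := by
    refine .all₂ _ 0 (.imp (.all₁ M 0 (.imp (.all₁ M 1 (.imp (hE (.var M 1) (.var M 0)) (hZ 1)) ?_)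
      (hZ 0)) ?_) (.all₁ M 0 (hZ 0) ?_)) ?_
    all_goals intros; simp
  refine this.congr fun A v V => ⟨fun h => ⟨fun a => ?_⟩, fun h Z hZ a => ?_⟩
  · exact h {t | Acc (E A) (t (0 : Fin 1))} (fun a ih => Acc.intro a ih) a
  · induction a using h.induction with
    | _ a ih => exact hZ a ih

theorem eCorrect
    (hE : ∀ t₁ t₂ : Term τ M, OpenDef False fun A v V => E A (t₁.eval A v) (t₂.eval A v)) :
    OpenDef False fun A _ _ => ECorrect (E A) := by
  have hZ : ∀ i, OpenDef False fun (A : Str τ) v V => (fun _ => v (M, i) : Tuple A.dom ⟨1, fun _ => M⟩) ∈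
      V (⟨1, fun _ => M⟩, 0) := fun i => .rvar ⟨1, fun _ => M⟩ 0 fun _ => .var M i
  have : OpenDef False fun (A : Str τ) _ _ => ∀ a b, EPow (E A) a b →
      ∀ Z : Set (Tuple A.dom ⟨1, fun _ => M⟩),
      (∀ y, (fun _ => y : Tuple A.dom ⟨1, fun _ => M⟩) ∈ Z → E A y a) →
      ∃ z, ∀ w, E A w z ↔ (fun _ => w : Tuple A.dom ⟨1, fun _ => M⟩) ∈ Z := by
    refine .all₁ M 0 (.all₁ M 1 (.imp (ePow hE 0 1) (.all₂ _ 0 (.imp (.all₁ M 2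
      (.imp (hZ 2) (hE (.var M 2) (.var M 0))) ?_) (.ex₁ M 2 (.all₁ M 3
      (.iff (hE (.var M 3) (.var M 2)) (hZ 3)) ?_) ?_)) ?_)) ?_) ?_
    all_goals intros; simp
  refine this.congr fun A v V => forall_congr' fun a => forall_congr' fun b =>
    forall_congr' fun _ => ⟨fun h Y hY => ?_, fun h Z hZ => ?_⟩
  · exact h {t | t (0 : Fin 1) ∈ Y} hY
  · exact h {y | (fun _ => y : Tuple A.dom ⟨1, fun _ => M⟩) ∈ Z} hZ

end OpenDef

/-! ## The class of transitive correct models -/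

def binRel (A : Str binVocab.{u}) (a b : A.El PUnit.unit) : Prop :=
  (![a, b] : Tuple A.dom ⟨2, fun _ => PUnit.unit⟩) ∈ A.rel PUnit.unit

theorem openDef_binRel {fo : Prop} (t₁ t₂ : Term binVocab.{u} PUnit.unit) :
    OpenDef fo fun A v V => binRel A (t₁.eval A v) (t₂.eval A v) := by
  refine (OpenDef.rel (τ := binVocab.{u}) PUnit.unit
    (![t₁, t₂] : Fin 2 → Term binVocab.{u} PUnit.unit)).congr fun A v V => Iff.of_eq ?_
  refine congrArg (· ∈ A.rel PUnit.unit) ?_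
  funext i
  match i with
  | (0 : Fin 2) => rfl
  | (1 : Fin 2) => rfl

theorem isCollapse_of_iso {A : Str binVocab.{u}} {M : ZFSet.{u}} (hM : M.Nonempty)
    (ht : M.IsTransitive) (i : Iso A (memStr M hM)) :
    IsCollapse (binRel A) fun a => ((i.map PUnit.unit a : {z // z ∈ M}) : ZFSet.{u}) where
  inj a b h := (i.map _).injective (Subtype.ext h)
  mem_iff a b := by
    refine Iff.trans ?_ (i.map_rel PUnit.unit (![b, a] : Tuple A.dom ⟨2, fun _ => PUnit.unit⟩)).symm
    exact Iff.rfl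
  trans a z hz := by
    have h : z ∈ M := ht _ (i.map PUnit.unit a).2 hz
    exact ⟨(i.map PUnit.unit).symm ⟨z, h⟩, by rw [Equiv.apply_symm_apply]⟩

/-- After the collapse only one half of correctness is a restriction, namely that what the model
takes for a power set is one. The other half holds in every transitive set, since true power sets
satisfy the defining formula there. -/
theorem qClass_iff (A : Str binVocab.{u}) :
    QClass PwSt A ↔ IsExt (binRel A) ∧ WellFounded (binRel A) ∧ ECorrect (binRel A) := by
  have key : ∀ {M : ZFSet.{u}} (c : A.El PUnit.unit → ZFSet.{u}), IsCollapse (binRel A) c →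
      (∀ z, z ∈ M ↔ ∃ a, c a = z) →
      (IsCorrect PwSt M ↔ ∀ a b, EPow (binRel A) a b → c b = (c a).powerset) := by
    intro M c hc hM
    have h1 : ∀ a b, PwSt.HoldsIn {z | z ∈ M} ![c a, c b] ↔ EPow (binRel A) a b := by
      intro a b
      rw [PwSt_holdsIn]
      simp only [Set.mem_ofPred_eq, hM, forall_exists_index, forall_apply_eq_imp_iff,
        Matrix.cons_val_one, Matrix.cons_val_zero, hc.mem_iff, EPow]
    have h2 : ∀ a b, PwSt.Holds ![c a, c b] ↔ c b = (c a).powerset := fun a b => PwSt_holds _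
    constructor
    · intro h a b hab
      rw [← h2, ← h ![c a, c b] (fun i => ?_), h1]
      · exact hab
      · refine (hM _).2 ?_
        fin_cases i
        · exact ⟨a, rfl⟩
        · exact ⟨b, rfl⟩
    · intro h m hm
      obtain ⟨a, ha⟩ := (hM _).1 (hm 0)
      obtain ⟨b, hb⟩ := (hM _).1 (hm 1)
      have : m = ![c a, c b] := by
        funext i
        fin_cases i
        · exact ha.symm
        · exact hb.symm
      rw [this, h1, h2]
      exact ⟨h a b, hc.ePow_of_eq⟩
  constructor
  · rintro ⟨M, hM, ht, hcor, ⟨i⟩⟩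
    have hc := isCollapse_of_iso hM ht i
    refine ⟨hc.isExt, hc.wellFounded, hc.eCorrect ((key _ hc fun z => ⟨fun hz => ?_, ?_⟩).1 hcor)⟩
    · exact ⟨(i.map PUnit.unit).symm ⟨z, hz⟩, by rw [Equiv.apply_symm_apply]⟩
    · rintro ⟨a, rfl⟩
      exact (i.map PUnit.unit a).2
  · rintro ⟨h1, h2, h3⟩
    obtain ⟨c, hc⟩ := exists_isCollapse h2 h1
    have hM : ∀ z, z ∈ ZFSet.range c ↔ ∃ a, c a = z := fun z => ZFSet.mem_range
    let e : A.El PUnit.unit ≃ {z // z ∈ ZFSet.range c} :=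
      Equiv.ofBijective (fun a => ⟨c a, (hM _).2 ⟨a, rfl⟩⟩)
        ⟨fun a b h => hc.inj (congrArg Subtype.val h), by
          rintro ⟨z, hz⟩
          obtain ⟨a, rfl⟩ := (hM _).1 hz
          exact ⟨a, rfl⟩⟩
    refine ⟨ZFSet.range c, ⟨_, (e ⟨_, (A.dom_nonempty PUnit.unit).choose_spec⟩).2⟩, fun a ha z hz => ?_,
      (key c hc hM).2 fun a b => (hc.ePow_iff h3).1, ⟨⟨fun _ => e, fun r t => ?_, fun f => f.elim⟩⟩⟩
    · obtain ⟨a, rfl⟩ := (hM _).1 ha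
      exact (hM _).2 (hc.trans a z hz)
    · have : t = (![t (0 : Fin 2), t (1 : Fin 2)] : Tuple A.dom ⟨2, fun _ => PUnit.unit⟩) := by
        funext i
        match i with
        | (0 : Fin 2) => rfl
        | (1 : Fin 2) => rfl
      conv_lhs => rw [this]
      exact (hc.mem_iff (t (1 : Fin 2)) (t (0 : Fin 2))).symm

theorem isAxiomatisable_qClass : IsAxiomatisable L2.{u} (QClass.{u} PwSt) := by
  obtain ⟨φ, h1, -, h2⟩ := ((OpenDef.isExt openDef_binRel).and
    ((OpenDef.wellFounded openDef_binRel).and (OpenDef.eCorrect openDef_binRel))).exists_sentence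
  exact ⟨⟨φ, h1⟩, fun A => (qClass_iff A).trans (h2 A).symm⟩

end BddSymb

namespace BddSymb

open Cardinal

/-! ## Codes of structures as `Δ₀`-definable functions of their components -/

/-- The code of a structure with the domains `D`, the relations `R` and the function graphs `G`. -/
def codeExpr {τ : Vocab.{u}} (ν : Naming τ) (D : τ.Srt → ZFSet.{u}) (R : τ.Rel → ZFSet.{u})
    (G : τ.Fn → ZFSet.{u}) : ZFSet.{u} :=
  ZFSet.pair ν.vocab (ZFSet.pair (ZFSet.range fun s => ZFSet.pair (ν.srt s) (D s))
    (ZFSet.pair (ZFSet.range fun r => ZFSet.pair (ν.rel r) (R r))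
      (ZFSet.range fun f => ZFSet.pair (ν.fn f) (G f))))

section codeExpr

variable {τ : Vocab.{u}} {ν : Naming τ} {n : ℕ}

theorem D0Fun.profile (hν : ν.IsNatural) (p : Profile τ.Srt) :
    D0Fun fun _ : Fin n → ZFSet.{u} => ν.profile p := by
  refine D0Fun.seqCode (f := fun i _ => ν.srt (p.sort i)) fun i => ?_
  obtain ⟨k, hk⟩ := hν.1 (p.sort i)
  rw [hk]
  exact .natCode k

variable [Finite τ.Srt] [Finite τ.Rel] [Finite τ.Fn]

/-- The defining formula may not use parameters. Natural numbers as names make every symbol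
definable, and finiteness of the vocabulary makes the code a finite expression in its components. -/
theorem D0Fun.codeExpr (hν : ν.IsNatural) {D : τ.Srt → (Fin n → ZFSet.{u}) → ZFSet.{u}}
    {R : τ.Rel → (Fin n → ZFSet.{u}) → ZFSet.{u}} {G : τ.Fn → (Fin n → ZFSet.{u}) → ZFSet.{u}}
    (hD : ∀ s, D0Fun (D s)) (hR : ∀ r, D0Fun (R r)) (hG : ∀ f, D0Fun (G f)) :
    D0Fun fun w => codeExpr ν (fun s => D s w) (fun r => R r w) fun f => G f w := by
  have h1 : ∀ s, D0Fun fun _ : Fin n → ZFSet.{u} => ν.srt s := fun s => by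
    obtain ⟨k, hk⟩ := hν.1 s
    rw [hk]
    exact .natCode k
  have h2 : ∀ r, D0Fun fun _ : Fin n → ZFSet.{u} => ν.rel r := fun r => by
    obtain ⟨k, hk⟩ := hν.2.1 r
    rw [hk]
    exact .natCode k
  have h3 : ∀ f, D0Fun fun _ : Fin n → ZFSet.{u} => ν.fn f := fun f => by
    obtain ⟨k, hk⟩ := hν.2.2 f
    rw [hk]
    exact .natCode k
  have h4 : D0Fun fun _ : Fin n → ZFSet.{u} => ν.vocab :=
    .pair (.range (f := fun s _ => ν.srt s) h1)
      (.pair (.range (f := fun r _ => ZFSet.pair (ν.rel r) (ν.profile (τ.relDom r)))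
        fun r => (h2 r).pair (.profile hν _))
        (.range (f := fun f _ => ZFSet.pair (ν.fn f)
          (ZFSet.pair (ν.profile (τ.fnDom f)) (ν.srt (τ.fnCod f)))) fun f =>
            (h3 f).pair ((profile hν _).pair (h1 _))))
  exact h4.pair ((range fun s => (h1 s).pair (hD s)).pair
    ((range fun r => (h2 r).pair (hR r)).pair (range fun f => (h3 f).pair (hG f))))

end codeExpr

/-- By foundation, every member is reached from ∅ by successors, so all members are natural numbers.
This is what later bounds the constant for ω by ℵ₀. -/
def IsOmega (w : ZFSet.{u}) : Prop :=
  (∃ e, e ∈ w ∧ e = ∅) ∧ (∀ a, a ∈ w → ∃ b, b ∈ w ∧ b = insert a a) ∧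
    ∀ a, a ∈ w → a = ∅ ∨ ∃ b, b ∈ w ∧ a = insert b b

instance D0.isOmega {n : ℕ} (i : Fin n) : D0 fun w : Fin n → ZFSet.{u} => IsOmega (w i) := by
  unfold IsOmega
  infer_instance

theorem IsOmega.exists_natCode {w : ZFSet.{u}} (h : IsOmega w) : ∀ z ∈ w, ∃ n, z = natCode n := by
  intro z
  induction z using ZFSet.inductionOn with
  | _ z ih =>
    intro hz
    rcases h.2.2 z hz with rfl | ⟨b, hb, rfl⟩
    · exact ⟨0, rfl⟩
    · obtain ⟨n, rfl⟩ := ih b (ZFSet.mem_insert _ _) hb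
      exact ⟨n + 1, rfl⟩

theorem isOmega_range_natCode : IsOmega (ZFSet.range natCode.{u}) := by
  refine ⟨⟨_, ZFSet.mem_range.2 ⟨0, rfl⟩, rfl⟩, fun a ha => ?_, fun a ha => ?_⟩
  · obtain ⟨n, rfl⟩ := ZFSet.mem_range.1 ha
    exact ⟨_, ZFSet.mem_range.2 ⟨n + 1, rfl⟩, rfl⟩
  · obtain ⟨n, rfl⟩ := ZFSet.mem_range.1 ha
    cases n with
    | zero => exact Or.inl rfl
    | succ n => exact Or.inr ⟨_, ZFSet.mem_range.2 ⟨n, rfl⟩, rfl⟩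

theorem isTransitive_range_natCode : (ZFSet.range natCode.{u}).IsTransitive := by
  intro a ha b hb
  obtain ⟨n, rfl⟩ := ZFSet.mem_range.1 ha
  obtain ⟨k, -, h⟩ := mem_natCode.1 hb
  exact ZFSet.mem_range.2 ⟨k, h.symm⟩

theorem aleph0_le_card_range_natCode : ℵ₀ ≤ (ZFSet.range natCode.{u}).card := by
  rw [← Cardinal.lift_le.{u + 1}, ← ZFSet.cardinalMk_coe_sort, Cardinal.lift_aleph0,
    Cardinal.aleph0_le_mk_iff]
  exact Infinite.of_injective (fun n : ℕ => (⟨natCode n, ZFSet.mem_range.2 ⟨n, rfl⟩⟩ :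
    {z // z ∈ ZFSet.range natCode.{u}})) fun m n h => natCode_inj.1 (congrArg Subtype.val h)

/-! ## Coded relations -/

section graph

universe v w

variable {X : Type v} {E : X → X → Prop}

/-- `C` is, in the sense of `E`, the set of all codes (defined by `χ`) of tuples `u` such that `u i`
is an element of `d i` and `Q` holds for the tuple of the values of the `u i`. -/
def IsGraph (E : X → X → Prop) {n : ℕ} {α : Fin n → Type w} (d : Fin n → X)
    (val : ∀ i, X → α i) (Q : (∀ i, α i) → Prop) (χ : Delta0 2 (n + 1)) (C : X) : Prop :=
  (∀ u : Fin n → X, (∀ i, E (u i) (d i)) → Q (fun i => val i (u i)) →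
    ∃ z, E z C ∧ HoldsE E χ (Fin.snoc (α := fun _ => X) u z)) ∧
  ∀ z, E z C → ∃ u : Fin n → X, ((∀ i, E (u i) (d i)) ∧ Q fun i => val i (u i)) ∧
    HoldsE E χ (Fin.snoc (α := fun _ => X) u z)

/-- `IsGraph` refers to the surrounding structure only through the decoding maps `val`. When the `e
i` invert them on the coded domains, the collapse of `C` is the true set of codes. The parameter
`code` lets the lemma serve for relations and for function graphs. -/
theorem isGraph_iff {c : X → ZFSet.{u}} (hc : IsCollapse E c) (hE : ECorrect E) {n : ℕ}
    {α : Fin n → Type w} {d : Fin n → X} {val : ∀ i, X → α i} {Q : (∀ i, α i) → Prop}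
    {χ : Delta0 2 (n + 1)} {code : (Fin n → ZFSet.{u}) → ZFSet.{u}}
    (hχ : ∀ w, χ.Holds PwSt w ↔ w (Fin.last n) = code fun j => w j.castSucc) {C : X}
    {D : Fin n → ZFSet.{u}} (hD : ∀ i, c (d i) = D i) (e : ∀ i, α i ≃ {x // x ∈ D i})
    (he : ∀ i b, E b (d i) → (e i (val i b)).1 = c b) :
    IsGraph E d val Q χ C ↔
      ∀ z, z ∈ c C ↔ ∃ x : ∀ i, α i, Q x ∧ z = code fun i => (e i (x i)).1 := by
  have h1 : ∀ (u : Fin n → X) z, HoldsE E χ (Fin.snoc (α := fun _ => X) u z) ↔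
      c z = code fun i => c (u i) := by
    intro u z
    rw [hc.holdsE_iff hE, hχ]
    simp
  have h2 : ∀ x : ∀ i, α i, ∃ u : Fin n → X, (∀ i, E (u i) (d i)) ∧ (∀ i, val i (u i) = x i) ∧
      ∀ i, c (u i) = (e i (x i)).1 := by
    intro x
    have : ∀ i, ∃ u, E u (d i) ∧ c u = (e i (x i)).1 := fun i =>
      hc.mem.1 (by rw [hD]; exact (e i (x i)).2)
    choose u hu hu' using this
    exact ⟨u, hu, fun i => (e i).injective (Subtype.ext ((he i _ (hu i)).trans (hu' i))), hu'⟩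
  simp only [IsGraph, h1]
  constructor
  · rintro ⟨h3, h4⟩ z
    constructor
    · intro hz
      obtain ⟨b, hb, rfl⟩ := hc.mem.1 hz
      obtain ⟨u, ⟨hu, hQ⟩, h⟩ := h4 b hb
      exact ⟨_, hQ, h.trans (congrArg code (funext fun i => (he i _ (hu i)).symm))⟩
    · rintro ⟨x, hx, rfl⟩
      obtain ⟨u, hu, hv, hcu⟩ := h2 x
      obtain ⟨b, hb, h⟩ := h3 u hu (by simpa only [hv] using hx)
      rw [← funext hcu, ← h]
      exact (hc.mem_iff _ _).2 hb
  · intro h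
    refine ⟨fun u hu hQ => ?_, fun z hz => ?_⟩
    · obtain ⟨b, hb, h3⟩ := hc.mem.1 ((h _).2 ⟨_, hQ, rfl⟩)
      exact ⟨b, hb, h3.trans (congrArg code (funext fun i => he i _ (hu i)))⟩
    · obtain ⟨x, hx, h3⟩ := (h _).1 ((hc.mem_iff _ _).2 hz)
      obtain ⟨u, hu, hv, hcu⟩ := h2 x
      exact ⟨u, ⟨hu, by simpa only [hv] using hx⟩, h3.trans (congrArg code (funext hcu).symm)⟩

end graph

/-- The code of a tuple of arguments with the value in front. -/
def graphCode {n : ℕ} (w : Fin (n + 1) → ZFSet.{u}) : ZFSet.{u} :=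
  ZFSet.pair (seqCode fun i => w i.succ) (w 0)

theorem exists_seqCode_formula (n : ℕ) : ∃ χ : Delta0 2 (n + 1), ∀ w : Fin (n + 1) → ZFSet.{u},
    χ.Holds PwSt w ↔ w (Fin.last n) = seqCode fun j => w j.castSucc :=
  (D0Fun.seqCode fun i => D0Fun.of_eq i).out.out

theorem exists_graphCode_formula (n : ℕ) : ∃ χ : Delta0 2 (n + 1 + 1),
    ∀ w : Fin (n + 1 + 1) → ZFSet.{u},
      χ.Holds PwSt w ↔ w (Fin.last (n + 1)) = graphCode fun j => w j.castSucc :=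
  ((D0Fun.seqCode fun i : Fin n => D0Fun.of_eq i.succ).pair (D0Fun.of_eq 0)).out.out

/-! ### Codes of isomorphic copies -/

section transport

variable {τ : Vocab.{u}} (A : Str τ) {D : τ.Srt → ZFSet.{u}}
  (e : ∀ s, A.El s ≃ {x : ZFSet.{u} // x ∈ D s})

theorem mem_transport_rel (r : τ.Rel) (z : ZFSet.{u}) :
    z ∈ ZFSet.range (fun t : {t // t ∈ (A.transport e).rel r} => tupleCode t.1) ↔
      ∃ x : Tuple A.dom (τ.relDom r), x ∈ A.rel r ∧ z = seqCode fun i => (e _ (x i)).1 := by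
  rw [ZFSet.mem_range]
  constructor
  · rintro ⟨⟨t, ht⟩, rfl⟩
    exact ⟨_, ht, congrArg seqCode (funext fun i =>
      congrArg Subtype.val ((e _).apply_symm_apply (t i)).symm)⟩
  · rintro ⟨x, hx, rfl⟩
    exact ⟨⟨fun i => e _ (x i), ((A.transportIso e).map_rel r x).1 hx⟩, rfl⟩

/-- Sorts of a function value and its arguments. -/
abbrev Vocab.graphSrt (τ : Vocab.{u}) (f : τ.Fn) : Fin ((τ.fnDom f).len + 1) → τ.Srt :=
  Fin.cons (α := fun _ => τ.Srt) (τ.fnCod f) (τ.fnDom f).sort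

theorem mem_transport_fn (f : τ.Fn) (z : ZFSet.{u}) :
    z ∈ ZFSet.range (fun t : Tuple (A.transport e).dom (τ.fnDom f) =>
        ZFSet.pair (tupleCode t) ((A.transport e).fn f t).1) ↔
      ∃ x : ∀ i, A.El (τ.graphSrt f i),
        A.fn f (fun i => x i.succ) = x 0 ∧ z = graphCode fun i => (e _ (x i)).1 := by
  rw [ZFSet.mem_range]
  constructor
  · rintro ⟨t, rfl⟩
    refine ⟨Fin.cons (α := fun i => A.El (τ.graphSrt f i)) (A.fn f fun i => (e _).symm (t i))
      (fun i => (e _).symm (t i)), rfl, ?_⟩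
    simp only [graphCode]
    congr 1
    simp only [tupleCode]
    congr 1
    funext i
    exact congrArg Subtype.val ((e _).apply_symm_apply (t i)).symm
  · rintro ⟨x, hx, rfl⟩
    refine ⟨fun i => e _ (x i.succ), ?_⟩
    have h := (A.transportIso e).map_fn f fun i => x i.succ
    rw [hx] at h
    exact congrArg₂ ZFSet.pair rfl (congrArg Subtype.val h.symm)

theorem code_transport (ν : Naming τ) {R : τ.Rel → ZFSet.{u}} {G : τ.Fn → ZFSet.{u}}
    (hR : ∀ r z, z ∈ R r ↔
      ∃ x : Tuple A.dom (τ.relDom r), x ∈ A.rel r ∧ z = seqCode fun i => (e _ (x i)).1)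
    (hG : ∀ f z, z ∈ G f ↔ ∃ x : ∀ i, A.El (τ.graphSrt f i),
      A.fn f (fun i => x i.succ) = x 0 ∧ z = graphCode fun i => (e _ (x i)).1) :
    (A.transport e).code ν = codeExpr ν D R G := by
  have h1 : R = fun r => ZFSet.range (fun t : {t // t ∈ (A.transport e).rel r} => tupleCode t.1) := by
    funext r
    ext z
    rw [hR, mem_transport_rel]
  have h2 : G = fun f => ZFSet.range (fun t : Tuple (A.transport e).dom (τ.fnDom f) =>
        ZFSet.pair (tupleCode t) ((A.transport e).fn f t).1) := by
    funext f
    ext z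
    rw [hG, mem_transport_fn]
  rw [h1, h2]
  rfl

end transport

end BddSymb

namespace BddSymb

open Cardinal

/-! ## The vocabulary for coded structures -/

/-- `cst` and `val` carry the coding of the structure. The maps `embU`, `embW` and `key` serve only
to bound the size of the expansion: the first two for the model, the third for the sort `U`. -/
inductive CodeFn (τ : Vocab.{u}) (N : ℕ) : Type u
  | cst (k : Fin N)
  | val (s : τ.Srt)
  | embU
  | embW
  | key

/-- The symbols of `ε`, a sort for a set-theoretic model with its membership relation, constants,
evaluation maps from the model to the sorts of `τ`, and maps from the sorts `U` and `W` of `ε` to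
the model. -/
def codeExt (τ ε : Vocab.{u}) (U W : ε.Srt) (N : ℕ) : VocabExt τ where
  Srt := ε.Srt ⊕ PUnit
  Rel := ε.Rel ⊕ PUnit
  Fn := ε.Fn ⊕ CodeFn τ N
  relDom r := match r with
    | .inl r => (ε.relDom r).map fun s => .inr (.inl s)
    | .inr _ => ⟨2, fun _ => .inr (.inr ⟨⟩)⟩
  fnDom f := match f with
    | .inl f => (ε.fnDom f).map fun s => .inr (.inl s)
    | .inr (.cst _) => ⟨0, fun _ => .inr (.inr ⟨⟩)⟩
    | .inr (.val _) => ⟨1, fun _ => .inr (.inr ⟨⟩)⟩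
    | .inr .embU => ⟨1, fun _ => .inr (.inl U)⟩
    | .inr .embW => ⟨1, fun _ => .inr (.inl W)⟩
    | .inr .key => ⟨1, fun _ => .inr (.inl U)⟩
  fnCod f := match f with
    | .inl f => .inr (.inl (ε.fnCod f))
    | .inr (.val s) => .inl s
    | .inr (.cst _) => .inr (.inr ⟨⟩)
    | .inr .embU => .inr (.inr ⟨⟩)
    | .inr .embW => .inr (.inr ⟨⟩)
    | .inr .key => .inr (.inr ⟨⟩)

section codeVocab

variable {τ ε : Vocab.{u}} {U W : ε.Srt} {N : ℕ}

def srtM : (codeExt τ ε U W N).vocab.Srt := .inr (.inr ⟨⟩)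

def srtExt (s : ε.Srt) : (codeExt τ ε U W N).vocab.Srt := .inr (.inl s)

def srtOld (s : τ.Srt) : (codeExt τ ε U W N).vocab.Srt := .inl s

/-- The reduct to `ε`. -/
def Str.sub (B : Str (codeExt τ ε U W N).vocab) : Str ε where
  dom s := B.dom (srtExt s)
  dom_nonempty s := B.dom_nonempty (srtExt s)
  rel r := B.rel (.inr (.inl r))
  fn f := B.fn (.inr (.inl f))

def Term.toExt : {s : ε.Srt} → Term ε s → Term (codeExt τ ε U W N).vocab (srtExt s)
  | _, .var s n => .var (srtExt s) n
  | _, .app f ts => .app (τ := (codeExt τ ε U W N).vocab) (.inr (.inl f)) fun i => (ts i).toExt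

def Form.toExt : Form ε → Form (codeExt τ ε U W N).vocab
  | .eq t₁ t₂ => .eq t₁.toExt t₂.toExt
  | .rel r ts => .rel (τ := (codeExt τ ε U W N).vocab) (.inr (.inl r)) fun i => (ts i).toExt
  | .rvar p n ts => .rvar (p.map srtExt) n fun i => (ts i).toExt
  | .neg φ => .neg φ.toExt
  | .and φ ψ => .and φ.toExt ψ.toExt
  | .all₁ s n φ => .all₁ (srtExt s) n φ.toExt
  | .all₂ p n φ => .all₂ (p.map srtExt) n φ.toExt

theorem Term.eval_toExt (B : Str (codeExt τ ε U W N).vocab) (v : B.Asg₁) {s : ε.Srt}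
    (t : Term ε s) : t.toExt.eval B v = t.eval B.sub fun x => v (srtExt x.1, x.2) := by
  induction t with
  | var s n => rfl
  | app f ts ih =>
    exact congrArg (B.fn (.inr (.inl f))) (funext fun i => ih i)

theorem srtExt_injective :
    Function.Injective (srtExt : ε.Srt → (codeExt τ ε U W N).vocab.Srt) :=
  fun a b h => Sum.inl_injective (Sum.inr_injective h)

theorem Form.realize_toExt (B : Str (codeExt τ ε U W N).vocab) {φ : Form ε} (h : φ.IsFirstOrder)
    (v : B.Asg₁) (V : B.Asg₂) (V' : B.sub.Asg₂) :
    φ.toExt.Realize B v V ↔ φ.Realize B.sub (fun x => v (srtExt x.1, x.2)) V' := by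
  classical
  induction φ generalizing v with
  | eq t₁ t₂ =>
    simp only [Form.toExt, Form.Realize, Term.eval_toExt]
    exact Iff.rfl
  | rel r ts =>
    have : (fun i => (ts i).toExt.eval B v) = fun i => (ts i).eval B.sub fun x =>
      v (srtExt x.1, x.2) := funext fun i => Term.eval_toExt B v _
    exact Iff.of_eq (congrArg (· ∈ B.sub.rel r) this)
  | rvar p n ts => exact h.elim
  | neg φ ih => exact not_congr (ih h v)
  | and φ ψ ih1 ih2 => exact and_congr (ih1 h.1 v) (ih2 h.2 v)
  | all₁ s n φ ih =>
    refine forall_congr' fun a => ?_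
    refine (ih h _).trans (Iff.of_eq ?_)
    congr 1
    funext x
    by_cases hx : x = (s, n)
    · subst hx
      exact (Function.update_self (srtExt s, n) a v).trans
        (Function.update_self (β := fun x : ε.Srt × ℕ => B.sub.El x.1) (s, n) a _).symm
    · have hx' : ((srtExt x.1, x.2) : (codeExt τ ε U W N).vocab.Srt × ℕ) ≠ (srtExt s, n) := by
        intro h
        obtain ⟨h1, h2⟩ := Prod.mk.inj h
        exact hx (Prod.ext (srtExt_injective h1) h2)
      exact (Function.update_of_ne hx' a v).trans
        (Function.update_of_ne (β := fun x : ε.Srt × ℕ => B.sub.El x.1) hx a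
          fun x => v (srtExt x.1, x.2)).symm
  | all₂ p n φ ih => exact h.elim

theorem Form.truth_toExt (B : Str (codeExt τ ε U W N).vocab) {φ : Form ε} (h : φ.IsFirstOrder) :
    φ.toExt.Truth B ↔ φ.Truth B.sub := by
  constructor
  · intro H v V
    let v' : B.Asg₁ := fun x => match x with
      | (.inr (.inl s), n) => v (s, n)
      | (.inl s, n) => ⟨_, (B.dom_nonempty (.inl s)).choose_spec⟩
      | (.inr (.inr s), n) => ⟨_, (B.dom_nonempty (.inr (.inr s))).choose_spec⟩
    exact (Form.realize_toExt B h v' (fun _ => ∅) V).1 (H _ _)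
  · exact fun H v V => (Form.realize_toExt B h v V fun _ => ∅).2 (H _ _)

/-! ## Symbols of the vocabulary -/

def codeE (B : Str (codeExt τ ε U W N).vocab) (a b : B.El srtM) : Prop :=
  (![a, b] : Tuple B.dom ⟨2, fun _ => srtM⟩) ∈ B.rel (.inr (.inr ⟨⟩))

def codeCst (B : Str (codeExt τ ε U W N).vocab) (k : Fin N) : B.El srtM :=
  B.fn (.inr (.inr (.cst k))) fun i => i.elim0

def codeVal (B : Str (codeExt τ ε U W N).vocab) (s : τ.Srt) (a : B.El srtM) : B.reduct.El s :=
  B.fn (.inr (.inr (.val s))) fun _ => a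

def codeEmbU (B : Str (codeExt τ ε U W N).vocab) (a : B.El (srtExt U)) : B.El srtM :=
  B.fn (.inr (.inr .embU)) fun _ => a

def codeEmbW (B : Str (codeExt τ ε U W N).vocab) (a : B.El (srtExt W)) : B.El srtM :=
  B.fn (.inr (.inr .embW)) fun _ => a

def codeKey (B : Str (codeExt τ ε U W N).vocab) (a : B.El (srtExt U)) : B.El srtM :=
  B.fn (.inr (.inr .key)) fun _ => a

def valTerm (s : τ.Srt) (t : Term (codeExt τ ε U W N).vocab srtM) :
    Term (codeExt τ ε U W N).vocab (srtOld s) :=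
  .app (τ := (codeExt τ ε U W N).vocab) (.inr (.inr (.val s))) fun _ => t

def embUTerm (t : Term (codeExt τ ε U W N).vocab (srtExt U)) :
    Term (codeExt τ ε U W N).vocab srtM :=
  .app (τ := (codeExt τ ε U W N).vocab) (.inr (.inr .embU)) fun _ => t

def embWTerm (t : Term (codeExt τ ε U W N).vocab (srtExt W)) :
    Term (codeExt τ ε U W N).vocab srtM :=
  .app (τ := (codeExt τ ε U W N).vocab) (.inr (.inr .embW)) fun _ => t

def keyTerm (t : Term (codeExt τ ε U W N).vocab (srtExt U)) :
    Term (codeExt τ ε U W N).vocab srtM :=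
  .app (τ := (codeExt τ ε U W N).vocab) (.inr (.inr .key)) fun _ => t

def cstTerm (k : Fin N) : Term (codeExt τ ε U W N).vocab srtM :=
  .app (τ := (codeExt τ ε U W N).vocab) (.inr (.inr (.cst k))) fun i => i.elim0

theorem cstTerm_eval (B : Str (codeExt τ ε U W N).vocab) (v : B.Asg₁) (k : Fin N) :
    (cstTerm k).eval B v = codeCst B k :=
  congrArg (B.fn (.inr (.inr (.cst k)))) (funext fun i => i.elim0)

variable {fo : Prop}

theorem openDef_codeE (t₁ t₂ : Term (codeExt τ ε U W N).vocab srtM) :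
    OpenDef fo fun B v V => codeE B (t₁.eval B v) (t₂.eval B v) := by
  refine (OpenDef.rel (τ := (codeExt τ ε U W N).vocab) (.inr (.inr ⟨⟩))
    (![t₁, t₂] : Fin 2 → Term (codeExt τ ε U W N).vocab srtM)).congr fun B v V => Iff.of_eq ?_
  refine congrArg (· ∈ B.rel (.inr (.inr ⟨⟩))) ?_
  funext i
  match i with
  | (0 : Fin 2) => rfl
  | (1 : Fin 2) => rfl

theorem openDef_codeE_cst (t : Term (codeExt τ ε U W N).vocab srtM) (k : Fin N) :
    OpenDef fo fun B v V => codeE B (t.eval B v) (codeCst B k) :=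
  (openDef_codeE t (cstTerm k)).congr fun B v V => by rw [cstTerm_eval]

/-- The translation of Δ₀-formulas speaks about variables, so the constants are passed to it by
quantifying over a tuple forced to equal them. -/
theorem openDef_holdsE_cst (θ : Delta0 2 N) :
    OpenDef fo fun (B : Str (codeExt τ ε U W N).vocab) _ _ => HoldsE (codeE B) θ (codeCst B) := by
  have : OpenDef fo fun (B : Str (codeExt τ ε U W N).vocab) _ _ =>
      ∀ a : Fin N → B.El srtM, (∀ i, a i = codeCst B i) → HoldsE (codeE B) θ a := by
    refine .allTuple (fun i : Fin N => (srtM, (i : ℕ)))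
      (fun i j h => Fin.ext (Prod.mk.inj h).2)
      (.imp (.finite_forall srtM fun i => (OpenDef.eq (.var srtM i) (cstTerm i)).congr
        fun B v V => by rw [cstTerm_eval]; exact Iff.rfl) (.holdsE openDef_codeE θ))
      fun B v V v' a h => Iff.rfl
  refine this.congr fun B v V => ⟨fun h => h _ fun _ => rfl, fun h a ha => ?_⟩
  rwa [show a = codeCst B from funext ha]

theorem openDef_isGraph {n : ℕ} (d : Fin n → Fin N) (σ : Fin n → τ.Srt)
    {Q : ∀ B : Str (codeExt τ ε U W N).vocab, (∀ i, B.reduct.El (σ i)) → Prop}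
    (hQ : OpenDef fo fun B v V => Q B fun i => codeVal B (σ i) (v (srtM, i)))
    (χ : Delta0 2 (n + 1)) (C : Fin N) :
    OpenDef fo fun B _ _ => IsGraph (codeE B) (fun i => codeCst B (d i)) (fun i => codeVal B (σ i))
      (Q B) χ (codeCst B C) := by
  classical
  have hx : Function.Injective fun i : Fin n =>
      ((srtM, (i : ℕ)) : (codeExt τ ε U W N).vocab.Srt × ℕ) :=
    fun i j h => Fin.ext (Prod.mk.inj h).2
  have hE : ∀ k l, OpenDef fo fun (B : Str (codeExt τ ε U W N).vocab) v V =>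
      codeE B (v (srtM, k)) (codeCst B l) := fun k l => openDef_codeE_cst (.var srtM k) l
  have hχ : OpenDef fo fun (B : Str (codeExt τ ε U W N).vocab) v V => HoldsE (codeE B) χ
      (Fin.snoc (α := fun _ => B.El srtM) (fun i : Fin n => v (srtM, i)) (v (srtM, n))) := by
    refine (OpenDef.holdsE openDef_codeE χ).congr fun B v V => Iff.of_eq ?_
    congr 1
    funext i
    refine Fin.lastCases ?_ (fun i => ?_) i <;> simp
  have hn : ∀ j : Fin n, (j : ℕ) ≠ n := fun j => j.2.ne
  refine .and (.allTuple (fun i : Fin n => (srtM, (i : ℕ))) hx (P := fun B v V u =>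
    (∀ i, codeE B (u i) (codeCst B (d i))) → Q B (fun i => codeVal B (σ i) (u i)) →
      ∃ z, codeE B z (codeCst B C) ∧ HoldsE (codeE B) χ (Fin.snoc (α := fun _ => B.El srtM) u z))
    (.imp (.finite_forall srtM fun i => hE i (d i)) (.imp hQ (.ex₁ srtM n (.and (hE n C) hχ) ?_)))
    fun B v V v' a h => Iff.rfl) (.all₁ srtM n (P := fun B v V z => codeE B z (codeCst B C) →
      ∃ u : Fin n → B.El srtM, ((∀ i, codeE B (u i) (codeCst B (d i))) ∧
        Q B fun i => codeVal B (σ i) (u i)) ∧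
        HoldsE (codeE B) χ (Fin.snoc (α := fun _ => B.El srtM) u z)) (.imp (hE n C) (.exTuple
      (fun i : Fin n => (srtM, (i : ℕ))) hx
      (.and (.and (.finite_forall srtM fun i => hE i (d i)) hQ) hχ) ?_)) fun B v V a b => Iff.rfl)
  · intro B v V a b
    simp [hn]
  · intro B v V v' a h
    rw [h (srtM, n) fun i hi => hn i (Prod.mk.inj hi).2.symm]

def seqFormula (n : ℕ) : Delta0 2 (n + 1) := (exists_seqCode_formula.{u} n).choose

def graphFormula (n : ℕ) : Delta0 2 (n + 1 + 1) := (exists_graphCode_formula.{u} n).choose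

/-- The positions of the constants for domains, relations, graphs and `ω`. -/
structure CodeIdx (τ : Vocab.{u}) (N : ℕ) : Type u where
  dom : τ.Srt → Fin N
  rel : τ.Rel → Fin N
  fn : τ.Fn → Fin N
  omega : Fin N

/-- The model in `B` contains a code of a copy of the reduct of `B`, and its constants satisfy
`θ`. -/
structure CodeAx (k : CodeIdx τ N) (θ : Delta0 2 N) (B : Str (codeExt τ ε U W N).vocab) : Prop where
  ext : IsExt (codeE B)
  wf : WellFounded (codeE B)
  correct : ECorrect (codeE B)
  holds : HoldsE (codeE B) θ (codeCst B)
  val_inj : ∀ s a, codeE B a (codeCst B (k.dom s)) → ∀ b, codeE B b (codeCst B (k.dom s)) →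
    codeVal B s a = codeVal B s b → a = b
  val_surj : ∀ s x, ∃ a, codeE B a (codeCst B (k.dom s)) ∧ codeVal B s a = x
  rel : ∀ r, IsGraph (codeE B) (fun i => codeCst B (k.dom ((τ.relDom r).sort i)))
    (fun i => codeVal B ((τ.relDom r).sort i)) (fun x => x ∈ B.reduct.rel r)
    (seqFormula.{u} (τ.relDom r).len) (codeCst B (k.rel r))
  fn : ∀ f, IsGraph (codeE B) (fun i => codeCst B (k.dom (τ.graphSrt f i)))
    (fun i => codeVal B (τ.graphSrt f i)) (fun x => B.reduct.fn f (fun i => x i.succ) = x 0)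
    (graphFormula.{u} (τ.fnDom f).len) (codeCst B (k.fn f))
  key_inj : ∀ a b, codeKey B a = codeKey B b → a = b
  key_mem : ∀ a, codeE B (codeKey B a) (codeCst B k.omega) ∨
    ∃ s, codeE B (codeKey B a) (codeCst B (k.dom s))
  sep : ∀ a b, (∀ x, codeE B (codeEmbU B x) a ↔ codeE B (codeEmbU B x) b) →
    (∀ x, codeE B (codeEmbW B x) a ↔ codeE B (codeEmbW B x) b) → a = b

theorem codeAx_iff (k : CodeIdx τ N) (θ : Delta0 2 N) (B : Str (codeExt τ ε U W N).vocab) :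
    CodeAx k θ B ↔ IsExt (codeE B) ∧ WellFounded (codeE B) ∧ ECorrect (codeE B) ∧
    HoldsE (codeE B) θ (codeCst B) ∧
    (∀ s a, codeE B a (codeCst B (k.dom s)) → ∀ b, codeE B b (codeCst B (k.dom s)) →
      codeVal B s a = codeVal B s b → a = b) ∧
    (∀ s x, ∃ a, codeE B a (codeCst B (k.dom s)) ∧ codeVal B s a = x) ∧
    (∀ r, IsGraph (codeE B) (fun i => codeCst B (k.dom ((τ.relDom r).sort i)))
      (fun i => codeVal B ((τ.relDom r).sort i)) (fun x => x ∈ B.reduct.rel r)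
      (seqFormula.{u} (τ.relDom r).len) (codeCst B (k.rel r))) ∧
    (∀ f, IsGraph (codeE B) (fun i => codeCst B (k.dom (τ.graphSrt f i)))
      (fun i => codeVal B (τ.graphSrt f i)) (fun x => B.reduct.fn f (fun i => x i.succ) = x 0)
      (graphFormula.{u} (τ.fnDom f).len) (codeCst B (k.fn f))) ∧
    (∀ a b, codeKey B a = codeKey B b → a = b) ∧
    (∀ a, codeE B (codeKey B a) (codeCst B k.omega) ∨
      ∃ s, codeE B (codeKey B a) (codeCst B (k.dom s))) ∧
    (∀ a b, (∀ x, codeE B (codeEmbU B x) a ↔ codeE B (codeEmbU B x) b) →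
      (∀ x, codeE B (codeEmbW B x) a ↔ codeE B (codeEmbW B x) b) → a = b) :=
  ⟨fun ⟨h1, h2, h3, h4, h5, h6, h7, h8, h9, h10, h11⟩ =>
    ⟨h1, h2, h3, h4, h5, h6, h7, h8, h9, h10, h11⟩,
  fun ⟨h1, h2, h3, h4, h5, h6, h7, h8, h9, h10, h11⟩ =>
    ⟨h1, h2, h3, h4, h5, h6, h7, h8, h9, h10, h11⟩⟩

theorem openDef_codeAx [Finite τ.Srt] [Finite τ.Rel] [Finite τ.Fn] (k : CodeIdx τ N)
    (θ : Delta0 2 N) :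
    OpenDef False fun (B : Str (codeExt τ ε U W N).vocab) _ _ => CodeAx k θ B := by
  have hE : ∀ m l, OpenDef False fun (B : Str (codeExt τ ε U W N).vocab) v V =>
      codeE B (v (srtM, m)) (codeCst B l) := fun m l => openDef_codeE_cst (.var srtM m) l
  have h5 : OpenDef False fun (B : Str (codeExt τ ε U W N).vocab) _ _ =>
      ∀ s a, codeE B a (codeCst B (k.dom s)) → ∀ b, codeE B b (codeCst B (k.dom s)) →
      codeVal B s a = codeVal B s b → a = b := by
    refine .finite_forall srtM fun s => .all₁ srtM 0 (.imp (hE 0 _) (.all₁ srtM 1 (.imp (hE 1 _)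
      (.imp (.eq (valTerm s (.var srtM 0)) (valTerm s (.var srtM 1)))
        (.eq (.var srtM 0) (.var srtM 1)))) ?_)) ?_
    all_goals intros; simp
  have h6 : OpenDef False fun (B : Str (codeExt τ ε U W N).vocab) _ _ =>
      ∀ s x, ∃ a, codeE B a (codeCst B (k.dom s)) ∧ codeVal B s a = x := by
    refine .finite_forall srtM fun s => .all₁ (srtOld s) 0 (.ex₁ srtM 1 (.and (hE 1 _)
      (.eq (valTerm s (.var srtM 1)) (.var (srtOld s) 0))) ?_) ?_
    all_goals intros; simp
  have h7 : OpenDef False fun (B : Str (codeExt τ ε U W N).vocab) _ _ =>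
      ∀ r, IsGraph (codeE B) (fun i => codeCst B (k.dom ((τ.relDom r).sort i)))
      (fun i => codeVal B ((τ.relDom r).sort i)) (fun x => x ∈ B.reduct.rel r)
      (seqFormula.{u} (τ.relDom r).len) (codeCst B (k.rel r)) :=
    .finite_forall srtM fun r => openDef_isGraph (fun i => k.dom ((τ.relDom r).sort i))
      (τ.relDom r).sort (Q := fun B x => x ∈ B.reduct.rel r)
      (.rel (τ := (codeExt τ ε U W N).vocab) (.inl r)
        fun i => valTerm ((τ.relDom r).sort i) (.var srtM i)) _ _
  have h8 : OpenDef False fun (B : Str (codeExt τ ε U W N).vocab) _ _ =>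
      ∀ f, IsGraph (codeE B) (fun i => codeCst B (k.dom (τ.graphSrt f i)))
      (fun i => codeVal B (τ.graphSrt f i)) (fun x => B.reduct.fn f (fun i => x i.succ) = x 0)
      (graphFormula.{u} (τ.fnDom f).len) (codeCst B (k.fn f)) :=
    .finite_forall srtM fun f => openDef_isGraph (fun i => k.dom (τ.graphSrt f i))
      (τ.graphSrt f) (Q := fun B x => B.reduct.fn f (fun i => x i.succ) = x 0)
      (.eq (.app (τ := (codeExt τ ε U W N).vocab) (.inl f)
        fun i => valTerm ((τ.fnDom f).sort i) (.var srtM i.succ))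
        (valTerm (τ.fnCod f) (.var srtM 0))) _ _
  have h9 : OpenDef False fun (B : Str (codeExt τ ε U W N).vocab) _ _ =>
      ∀ a b, codeKey B a = codeKey B b → a = b := by
    refine .all₁ (srtExt U) 0 (.all₁ (srtExt U) 1 (.imp (.eq (keyTerm (.var (srtExt U) 0))
      (keyTerm (.var (srtExt U) 1))) (.eq (.var (srtExt U) 0) (.var (srtExt U) 1))) ?_) ?_
    all_goals intros; simp
  have h10 : OpenDef False fun (B : Str (codeExt τ ε U W N).vocab) _ _ =>
      ∀ a, codeE B (codeKey B a) (codeCst B k.omega) ∨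
      ∃ s, codeE B (codeKey B a) (codeCst B (k.dom s)) := by
    refine .all₁ (srtExt U) 0 (.or (openDef_codeE_cst (keyTerm (.var (srtExt U) 0)) _)
      (.finite_exists srtM fun s => openDef_codeE_cst (keyTerm (.var (srtExt U) 0)) _)) ?_
    all_goals intros; simp
  have h11 : OpenDef False fun (B : Str (codeExt τ ε U W N).vocab) _ _ =>
      ∀ a b, (∀ x, codeE B (codeEmbU B x) a ↔ codeE B (codeEmbU B x) b) →
      (∀ x, codeE B (codeEmbW B x) a ↔ codeE B (codeEmbW B x) b) → a = b := by
    refine .all₁ srtM 0 (.all₁ srtM 1 (.imp (.all₁ (srtExt U) 2 (.iff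
      (openDef_codeE (embUTerm (.var (srtExt U) 2)) (.var srtM 0))
      (openDef_codeE (embUTerm (.var (srtExt U) 2)) (.var srtM 1))) ?_) (.imp
      (.all₁ (srtExt W) 2 (.iff
      (openDef_codeE (embWTerm (.var (srtExt W) 2)) (.var srtM 0))
      (openDef_codeE (embWTerm (.var (srtExt W) 2)) (.var srtM 1))) ?_)
      (.eq (.var srtM 0) (.var srtM 1)))) ?_) ?_
    all_goals intros; simp
  exact ((OpenDef.isExt openDef_codeE).and ((OpenDef.wellFounded openDef_codeE).and
    ((OpenDef.eCorrect openDef_codeE).and ((openDef_holdsE_cst θ).and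
    (h5.and (h6.and (h7.and (h8.and (h9.and (h10.and h11)))))))))).congr
    fun B v V => (codeAx_iff k θ B).symm

theorem exists_codeAx_sentence [Finite τ.Srt] [Finite τ.Rel] [Finite τ.Fn] (k : CodeIdx τ N)
    (θ : Delta0 2 N) {φ : Form ε} (hφ : φ.IsFirstOrder) :
    ∃ χ : Form (codeExt τ ε U W N).vocab, χ.IsSentence ∧
      ∀ B, χ.Truth B ↔ CodeAx k θ B ∧ φ.Truth B.sub := by
  obtain ⟨χ₁, h1, -, h2⟩ := (openDef_codeAx (U := U) (W := W) k θ).exists_sentence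
  obtain ⟨χ₂, h3, -, h4⟩ := (Form.toExt (τ := τ) (U := U) (W := W) (N := N) φ).exists_sentence
  refine ⟨.and χ₁ χ₂, ⟨?_, ?_⟩, fun B => ?_⟩
  · simp [Form.free₁, h1.1, h3.1]
  · simp [Form.free₂, h1.2, h3.2]
  · rw [← h2, ← Form.truth_toExt B hφ, ← h4]
    exact ⟨fun h => ⟨fun v V => (h v V).1, fun v V => (h v V).2⟩, fun h v V => ⟨h.1 v V, h.2 v V⟩⟩

end codeVocab

end BddSymb

namespace BddSymb

open Cardinal

/-! ## Models of the axioms for coded structures -/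

theorem exists_equiv_of_card_eq {a b : ZFSet.{u}} (h : a.card = b.card) :
    Nonempty ({x // x ∈ a} ≃ {x // x ∈ b}) := by
  obtain ⟨f⟩ := Cardinal.eq.1 h
  exact ⟨(equivShrink.{u} _).trans (f.trans (equivShrink.{u} _).symm)⟩

theorem exists_cover_of_card_le {a b : ZFSet.{u}} (h : b.card ≤ a.card) {Y : Type*} [Nonempty Y]
    (j : {x // x ∈ b} → Y) : ∃ f : {x // x ∈ a} → Y, ∀ z, ∃ x, f x = j z := by
  obtain ⟨g, hg⟩ := exists_injective_of_card_le h
  exact ⟨Function.extend g j fun _ => Classical.arbitrary Y, fun z => ⟨g z, hg.extend_apply _ _ _⟩⟩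

theorem card_ord_toZFSet (κ : Cardinal.{u}) : κ.ord.toZFSet.card = κ := by
  rw [Ordinal.card_toZFSet, Cardinal.card_ord]

theorem Str.twoSorts_ext {S S' : Str twoSorts.{u}} (h : S.dom = S'.dom) : S = S' := by
  cases S
  cases S'
  obtain rfl : _ = _ := h
  congr
  · funext r
    exact r.elim
  · funext r
    exact r.elim

/-- The structure with the domains `d ⟨false⟩` and `d ⟨true⟩`. -/
def twoSets (d : ULift.{u} Bool → ZFSet.{u}) (h : ∀ s, (d s).Nonempty) : Str twoSorts.{u} where
  dom := d
  dom_nonempty := h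
  rel r := r.elim
  fn f := f.elim

/-- The canonical copy of the two domains. -/
def ordSets (α β : Cardinal.{u}) (s : ULift.{u} Bool) : ZFSet.{u} :=
  match s with
  | ⟨true⟩ => β.ord.toZFSet
  | ⟨false⟩ => α.ord.toZFSet

/-- The hypothesis gives a bound for each two-sorted structure separately, with no uniformity over
isomorphic ones. Moving the two old domains to initial ordinals leaves only a set of structures
below α and β, and the supremum of their bounds works. The copy is still a model because the
sentence is first-order. -/
theorem exists_uniform_bound {E : VocabExt twoSorts.{u}} {φ : Form E.vocab} (hφ : φ.IsFirstOrder)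
    (h : ∀ S : Str twoSorts.{u}, ∃ c : Cardinal.{u}, ∀ B : Str E.vocab, φ.Truth B → S = B.reduct →
      B.card ≤ c) (α β : Cardinal.{u}) :
    ∃ c : Cardinal.{u}, ∀ B : Str E.vocab, φ.Truth B → (B.dom (.inl ⟨false⟩)).card ≤ α →
      (B.dom (.inl ⟨true⟩)).card ≤ β → B.card ≤ c := by
  classical
  choose c hc using h
  -- If a cardinal is 0 there is no structure with that domain; the value 0 is then never used.
  let g : Set.Iic α × Set.Iic β → Cardinal.{u} := fun p =>
    if hp : ∀ s, (ordSets p.1 p.2 s).Nonempty then c (twoSets _ hp) else 0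
  refine ⟨⨆ p, g p, fun B hB h1 h2 => ?_⟩
  let D : E.vocab.Srt → ZFSet.{u} := fun s => match s with
    | .inl s => ordSets (B.dom (.inl ⟨false⟩)).card (B.dom (.inl ⟨true⟩)).card s
    | .inr s => B.dom (.inr s)
  have hD : ∀ s, (D s).card = (B.dom s).card := by
    rintro (⟨_ | _⟩ | s)
    · exact card_ord_toZFSet (B.dom (.inl ⟨false⟩)).card
    · exact card_ord_toZFSet (B.dom (.inl ⟨true⟩)).card
    · rfl
  let e : ∀ s, B.El s ≃ {x // x ∈ D s} := fun s => (exists_equiv_of_card_eq (hD s).symm).some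
  have hne : ∀ s, (ordSets (B.dom (.inl ⟨false⟩)).card (B.dom (.inl ⟨true⟩)).card s).Nonempty :=
    fun s => (B.transport e).dom_nonempty (.inl s)
  have h3 : (B.transport e).card = B.card := by
    have : ∀ s, ((B.transport e).dom s).card = (B.dom s).card := hD
    simp only [Str.card, this]
  rw [← h3]
  refine le_trans ?_ (le_ciSup (Cardinal.bddAbove_of_small)
    (⟨⟨(B.dom (.inl ⟨false⟩)).card, Set.mem_Iic.2 h1⟩,
      ⟨(B.dom (.inl ⟨true⟩)).card, Set.mem_Iic.2 h2⟩⟩ : Set.Iic α × Set.Iic β))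
  simp only [g]
  rw [dif_pos hne]
  exact hc _ _ ((B.transportIso e).truth hφ hB) (Str.twoSorts_ext rfl)

/-! ### Decoding the copy and bounding the sorts -/

namespace CodeAx

variable {τ ε : Vocab.{u}} {U W : ε.Srt} {N : ℕ} {k : CodeIdx τ N} {θ : Delta0 2 N}
  {B : Str (codeExt τ ε U W N).vocab} (h : CodeAx k θ B)

include h

theorem exists_collapse : ∃ c : B.El srtM → ZFSet.{u}, IsCollapse (codeE B) c :=
  exists_isCollapse h.wf h.ext

/-- `val` is a bijection from each coded domain to its sort. Its inverse, followed by the collapse,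
is the isomorphism onto the copy whose code the constants of the model describe. -/
theorem exists_transport (ν : Naming τ) {c : B.El srtM → ZFSet.{u}} (hc : IsCollapse (codeE B) c) :
    ∃ e : ∀ s, B.reduct.El s ≃ {x : ZFSet.{u} // x ∈ c (codeCst B (k.dom s))},
      (B.reduct.transport e).code ν = codeExpr ν (fun s => c (codeCst B (k.dom s)))
        (fun r => c (codeCst B (k.rel r))) fun f => c (codeCst B (k.fn f)) := by
  have h1 : ∀ s, ∃ e : B.reduct.El s ≃ {x : ZFSet.{u} // x ∈ c (codeCst B (k.dom s))},
      ∀ b, codeE B b (codeCst B (k.dom s)) → (e (codeVal B s b)).1 = c b := by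
    intro s
    have h2 : ∀ x : B.reduct.El s, ∃ y : {x : ZFSet.{u} // x ∈ c (codeCst B (k.dom s))},
        ∃ a, codeE B a (codeCst B (k.dom s)) ∧ codeVal B s a = x ∧ c a = y.1 := by
      intro x
      obtain ⟨a, ha, hx⟩ := h.val_surj s x
      exact ⟨⟨c a, (hc.mem_iff _ _).2 ha⟩, a, ha, hx, rfl⟩
    choose f a ha hx hca using h2
    refine ⟨Equiv.ofBijective f ⟨fun x y hxy => ?_, fun y => ?_⟩, fun b hb => ?_⟩
    · have : a x = a y := hc.inj (by rw [hca, hca, hxy])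
      rw [← hx x, this, hx y]
    · obtain ⟨b, hb, hy⟩ := hc.mem.1 y.2
      refine ⟨codeVal B s b, Subtype.ext ?_⟩
      rw [← hca, h.val_inj s _ (ha _) _ hb (hx _), hy]
    · change (f (codeVal B s b)).1 = c b
      rw [← hca, h.val_inj s _ (ha _) _ hb (hx _)]
  choose e he using h1
  refine ⟨e, code_transport _ e ν (fun r => ?_) fun f => ?_⟩
  · exact (isGraph_iff hc h.correct (exists_seqCode_formula _).choose_spec (fun i => rfl)
      (fun i => e ((τ.relDom r).sort i)) fun i b => he _ b).1 (h.rel r)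
  · exact (isGraph_iff hc h.correct (exists_graphCode_formula _).choose_spec (fun i => rfl)
      (fun i => e (τ.graphSrt f i)) fun i b => he _ b).1 (h.fn f)

/-- The map `key` is injective into ω and the coded domains, and `val` is injective on each coded
domain, so U embeds into ω together with all sorts of the reduct. -/
theorem card_U_le {c : B.El srtM → ZFSet.{u}} (hc : IsCollapse (codeE B) c)
    (hω : IsOmega (c (codeCst B k.omega))) :
    (B.dom (srtExt U)).card ≤ ℵ₀ + B.reduct.card := by
  -- `R a y` says that `y` names the key of `a`. A key may have several names, but a name belongs to
  -- at most one `a`, so any choice of names is injective.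
  let R : B.El (srtExt U) → (ULift.{u} ℕ ⊕ Σ s, Shrink.{u} (B.reduct.El s)) → Prop := fun a y =>
    match y with
    | .inl n => c (codeKey B a) = natCode n.down
    | .inr ⟨s, x⟩ => codeE B (codeKey B a) (codeCst B (k.dom s)) ∧
        equivShrink.{u} _ (codeVal B s (codeKey B a)) = x
  have hR : ∀ a, ∃ y, R a y := by
    intro a
    rcases h.key_mem a with ha | ⟨s, hs⟩
    · obtain ⟨n, hn⟩ := hω.exists_natCode _ ((hc.mem_iff _ _).2 ha)
      exact ⟨.inl ⟨n⟩, hn⟩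
    · exact ⟨.inr ⟨s, _⟩, hs, rfl⟩
  choose f hf using hR
  have hinj : ∀ a b y, R a y → R b y → a = b := by
    rintro a b (n | ⟨s, x⟩) ha hb
    · exact h.key_inj _ _ (hc.inj (Eq.trans ha (Eq.symm hb)))
    · exact h.key_inj _ _ (h.val_inj s _ ha.1 _ hb.1
        ((equivShrink.{u} _).injective (ha.2.trans hb.2.symm)))
  have := card_le_of_injective (f := f) fun a b hab => hinj a b _ (hf a) (hab ▸ hf b)
  simpa [Str.card, ZFSet.card] using this

/-- By the separation axiom an element of the model is determined by which images of U and of W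
belong to it. -/
theorem card_M_le : (B.dom srtM).card ≤
    2 ^ ((B.dom (srtExt U)).card + (B.dom (srtExt W)).card) := by
  have := card_le_of_injective (a := B.dom srtM)
    (Y := Set (Shrink.{u} (B.El (srtExt U)) ⊕ Shrink.{u} (B.El (srtExt W))))
    (f := fun m => {y | match y with
      | .inl x => codeE B (codeEmbU B ((equivShrink.{u} _).symm x)) m
      | .inr x => codeE B (codeEmbW B ((equivShrink.{u} _).symm x)) m}) (by
      intro a b hab
      refine h.sep a b (fun x => ?_) fun x => ?_
      · have := Set.ext_iff.1 hab (.inl (equivShrink.{u} _ x))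
        simpa only [Set.mem_ofPred_eq, Equiv.symm_apply_apply] using this
      · have := Set.ext_iff.1 hab (.inr (equivShrink.{u} _ x))
        simpa only [Set.mem_ofPred_eq, Equiv.symm_apply_apply] using this)
  rwa [Cardinal.mk_set, Cardinal.mk_sum, Cardinal.lift_id, Cardinal.lift_id] at this

end CodeAx

theorem card_codeExt {τ ε : Vocab.{u}} {U W : ε.Srt} {N : ℕ} (B : Str (codeExt τ ε U W N).vocab) :
    B.card = B.reduct.card + (B.sub.card + (B.dom srtM).card) := by
  have h1 := sum_card_sum (S := τ.Srt) (T := ε.Srt ⊕ PUnit) B.dom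
  have h2 := sum_card_sum (S := ε.Srt) (T := PUnit) fun s => B.dom (.inr s)
  have h3 : Cardinal.sum (fun s : PUnit.{u + 1} => (B.dom (.inr (.inr s))).card) =
      (B.dom srtM).card := by
    have : (fun s : PUnit.{u + 1} => (B.dom (.inr (.inr s))).card) =
        fun _ => (B.dom srtM).card := rfl
    rw [this, Cardinal.sum_const', Cardinal.mk_punit, one_mul]
  exact h1.trans (congrArg (B.reduct.card + ·) (h2.trans (congrArg (B.sub.card + ·) h3)))

/-- From |U| ≤ ℵ₀ + |A| follow, in turn, a bound on W by monotonicity of F, one on all sorts of the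
vocabulary for F by `exists_uniform_bound`, and one on the model by `card_M_le`. -/
theorem exists_bound_of_codeAx {F : Cardinal.{u} → Cardinal.{u}} (hF : Monotone F)
    {E : VocabExt twoSorts.{u}} {φ : Form E.vocab} (hφ : φ.IsFirstOrder)
    (hcard : ∀ C : Str E.vocab, φ.Truth C →
      (C.dom (.inl ⟨true⟩)).card ≤ F (C.dom (.inl ⟨false⟩)).card)
    (h : ∀ S : Str twoSorts.{u}, ∃ c : Cardinal.{u}, ∀ B : Str E.vocab, φ.Truth B → S = B.reduct →
      B.card ≤ c) {τ : Vocab.{u}} {N : ℕ} (k : CodeIdx τ N) {θ : Delta0 2 N}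
    (hθ : ∀ w : Fin N → ZFSet.{u}, θ.Holds PwSt w → IsOmega (w k.omega)) (A : Str τ) :
    ∃ c : Cardinal.{u}, ∀ B : Str (codeExt τ E.vocab (.inl ⟨false⟩) (.inl ⟨true⟩) N).vocab,
      CodeAx k θ B → φ.Truth B.sub → A = B.reduct → B.card ≤ c := by
  obtain ⟨c₀, hc₀⟩ := exists_uniform_bound hφ h (ℵ₀ + A.card) (F (ℵ₀ + A.card))
  refine ⟨A.card + (c₀ + 2 ^ (ℵ₀ + A.card + F (ℵ₀ + A.card))), ?_⟩
  rintro B hB hφB rfl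
  obtain ⟨c, hc⟩ := hB.exists_collapse
  have h1 := hB.card_U_le hc (hθ _ ((hc.holdsE_iff hB.correct _ _).1 hB.holds))
  have h2 : (B.dom (srtExt (.inl ⟨true⟩))).card ≤ F (ℵ₀ + B.reduct.card) :=
    (hcard B.sub hφB).trans (hF h1)
  have h3 : B.sub.card ≤ c₀ := hc₀ B.sub hφB h1 h2
  have h4 := hB.card_M_le.trans (power_le_power_left two_ne_zero (add_le_add h1 h2))
  exact (card_codeExt B).le.trans (add_le_add le_rfl (add_le_add h3 h4))

end BddSymb

namespace BddSymb

open Cardinal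

/-! ## Construction of models of the axioms for coded structures -/

section codeStr

variable {τ ε : Vocab.{u}} {U W : ε.Srt} {N : ℕ}

def codeStr (A : Str τ) (C : Str ε) (M : ZFSet.{u}) (hM : M.Nonempty) (cst : Fin N → {x // x ∈ M})
    (val : ∀ s, {x // x ∈ M} → A.El s) (embU : C.El U → {x // x ∈ M})
    (embW : C.El W → {x // x ∈ M}) (key : C.El U → {x // x ∈ M}) :
    Str (codeExt τ ε U W N).vocab where
  dom s := match s with
    | .inl s => A.dom s
    | .inr (.inl s) => C.dom s
    | .inr (.inr _) => M
  dom_nonempty s := match s with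
    | .inl s => A.dom_nonempty s
    | .inr (.inl s) => C.dom_nonempty s
    | .inr (.inr _) => hM
  rel r := match r with
    | .inl r => A.rel r
    | .inr (.inl r) => C.rel r
    | .inr (.inr _) => {t | (t (0 : Fin 2)).1 ∈ (t (1 : Fin 2)).1}
  fn f := match f with
    | .inl f => A.fn f
    | .inr (.inl f) => C.fn f
    | .inr (.inr (.cst i)) => fun _ => cst i
    | .inr (.inr (.val s)) => fun x => val s (x (0 : Fin 1))
    | .inr (.inr .embU) => fun x => embU (x (0 : Fin 1))
    | .inr (.inr .embW) => fun x => embW (x (0 : Fin 1))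
    | .inr (.inr .key) => fun x => key (x (0 : Fin 1))

theorem isCollapse_val {M : ZFSet.{u}} (hM : M.IsTransitive) :
    IsCollapse (fun a b : {x // x ∈ M} => a.1 ∈ b.1) Subtype.val :=
  ⟨Subtype.val_injective, fun _ _ => Iff.rfl, fun a z hz => ⟨⟨z, hM _ a.2 hz⟩, rfl⟩⟩

theorem isTransitive_powerset {t : ZFSet.{u}} (ht : t.IsTransitive) : t.powerset.IsTransitive := by
  intro a ha z hz
  rw [ZFSet.mem_powerset] at *
  exact ht _ (ha hz)

/-- A subset of a member of ℘(t) is again a member of ℘(t), so no subsets are missing. This is why a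
full power set is taken as the model. -/
theorem eCorrect_powerset {t : ZFSet.{u}} (ht : t.IsTransitive) :
    ECorrect fun a b : {x // x ∈ t.powerset} => a.1 ∈ b.1 := by
  have hM := isTransitive_powerset ht
  refine (isCollapse_val hM).eCorrect fun a b hab => ?_
  ext z
  rw [ZFSet.mem_powerset]
  constructor
  · intro hz w hw
    have hz' := hM _ b.2 hz
    exact (hab ⟨z, hz'⟩).1 hz ⟨w, hM _ hz' hw⟩ hw
  · intro hz
    have hz' : z ∈ t.powerset := ZFSet.mem_powerset.2 fun w hw => ZFSet.mem_powerset.1 a.2 (hz hw)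
    exact (hab ⟨z, hz'⟩).2 fun w hw => hz hw

theorem codeAx_codeStr {A : Str τ} {D : τ.Srt → ZFSet.{u}}
    (e : ∀ s, A.El s ≃ {x : ZFSet.{u} // x ∈ D s}) {C : Str ε} {t : ZFSet.{u}}
    (ht : t.IsTransitive) (hne : t.powerset.Nonempty) {k : CodeIdx τ N} {θ : Delta0 2 N}
    {cst : Fin N → {x // x ∈ t.powerset}} (hD : ∀ s, (cst (k.dom s)).1 = D s)
    (hR : ∀ r, (cst (k.rel r)).1 =
      ZFSet.range fun t : {t // t ∈ (A.transport e).rel r} => tupleCode t.1)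
    (hG : ∀ f, (cst (k.fn f)).1 = ZFSet.range fun t : Tuple (A.transport e).dom (τ.fnDom f) =>
      ZFSet.pair (tupleCode t) ((A.transport e).fn f t).1)
    (hθ : θ.Holds PwSt fun i => (cst i).1) {val : ∀ s, {x // x ∈ t.powerset} → A.El s}
    (hval : ∀ s a, a.1 ∈ D s → (e s (val s a)).1 = a.1)
    {embU : C.El U → {x // x ∈ t.powerset}} {embW : C.El W → {x // x ∈ t.powerset}}
    (hemb : ∀ z ∈ t, (∃ x, (embU x).1 = z) ∨ ∃ x, (embW x).1 = z)
    {key : C.El U → {x // x ∈ t.powerset}} (hkey : Function.Injective key)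
    (hkey' : ∀ x, (key x).1 ∈ (cst k.omega).1 ∨ ∃ s, (key x).1 ∈ D s) :
    CodeAx k θ (codeStr A C _ hne cst val embU embW key) := by
  have hc := isCollapse_val (isTransitive_powerset ht)
  have hE := eCorrect_powerset ht
  refine ⟨hc.isExt, hc.wellFounded, hE, (hc.holdsE_iff hE θ _).2 hθ, fun s a ha b hb h => ?_,
    fun s x => ?_, fun r => ?_, fun f => ?_, fun a b h => hkey h, fun a => ?_, fun a b h1 h2 => ?_⟩
  · have ha : a.1 ∈ D s := hD s ▸ ha
    have hb : b.1 ∈ D s := hD s ▸ hb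
    have h : val s a = val s b := h
    exact Subtype.ext ((hval s a ha).symm.trans (h ▸ hval s b hb))
  · have hx : (e s x).1 ∈ (cst (k.dom s)).1 := (hD s).symm ▸ (e s x).2
    refine ⟨⟨_, isTransitive_powerset ht _ (cst (k.dom s)).2 hx⟩, hx, ?_⟩
    exact (e s).injective (Subtype.ext (hval s _ (e s x).2))
  · refine (isGraph_iff hc hE (exists_seqCode_formula _).choose_spec (fun i => hD _)
      (fun i => e _) fun i b hb => hval _ b (hD _ ▸ hb)).2 fun z => ?_
    refine (Iff.of_eq (congrArg (z ∈ ·) (hR r))).trans (mem_transport_rel A e r z)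
  · refine (isGraph_iff hc hE (exists_graphCode_formula _).choose_spec (fun i => hD _)
      (fun i => e (τ.graphSrt f i)) fun i b hb => hval _ b (hD _ ▸ hb)).2 fun z => ?_
    refine (Iff.of_eq (congrArg (z ∈ ·) (hG f))).trans (mem_transport_fn A e f z)
  · refine (hkey' a).imp id fun ⟨s, hs⟩ => ⟨s, ?_⟩
    change (key a).1 ∈ (cst (k.dom s)).1
    rwa [hD]
  · refine Subtype.ext ?_
    have key : ∀ z ∈ t, z ∈ a.1 ↔ z ∈ b.1 := by
      intro z hz
      rcases hemb z hz with ⟨x, rfl⟩ | ⟨x, rfl⟩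
      · exact h1 x
      · exact h2 x
    ext z
    exact ⟨fun hz => (key z (ZFSet.mem_powerset.1 a.2 hz)).1 hz,
      fun hz => (key z (ZFSet.mem_powerset.1 b.2 hz)).2 hz⟩

end codeStr

/-- Positions of constants for the components of a structure and two further sets. -/
theorem exists_codeIdx (τ : Vocab.{u}) [Finite τ.Srt] [Finite τ.Rel] [Finite τ.Fn] :
    ∃ (N : ℕ) (k : CodeIdx τ N) (kx ky : Fin N), ∀ {X : Type (u + 1)} (D : τ.Srt → X)
      (R : τ.Rel → X) (G : τ.Fn → X) (o x y : X), ∃ w : Fin N → X, (∀ s, w (k.dom s) = D s) ∧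
        (∀ r, w (k.rel r) = R r) ∧ (∀ f, w (k.fn f) = G f) ∧ w k.omega = o ∧ w kx = x ∧
          w ky = y := by
  let q := Finite.equivFin (τ.Srt ⊕ τ.Rel ⊕ τ.Fn ⊕ Fin 3)
  refine ⟨_, ⟨fun s => q (.inl s), fun r => q (.inr (.inl r)), fun f => q (.inr (.inr (.inl f))),
    q (.inr (.inr (.inr 0)))⟩, q (.inr (.inr (.inr 1))), q (.inr (.inr (.inr 2))),
    fun D R G o x y => ⟨fun i => Sum.elim D (Sum.elim R (Sum.elim G ![o, x, y])) (q.symm i), ?_⟩⟩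
  simp

theorem exists_code_formula {τ : Vocab.{u}} [Finite τ.Srt] [Finite τ.Rel] [Finite τ.Fn]
    {ν : Naming τ} (hν : ν.IsNatural) {N : ℕ} (k : CodeIdx τ N) (kx ky : Fin N)
    (ψ : Delta0 2 (1 + 1)) : ∃ θ : Delta0 2 N, ∀ w : Fin N → ZFSet.{u}, θ.Holds PwSt w ↔
      w kx = codeExpr ν (fun s => w (k.dom s)) (fun r => w (k.rel r)) (fun f => w (k.fn f)) ∧
        IsOmega (w k.omega) ∧
          ψ.Holds PwSt (Fin.snoc (α := fun _ => ZFSet.{u}) (fun _ : Fin 1 => w kx) (w ky)) := by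
  have h1 := (D0Fun.codeExpr hν (fun s => D0Fun.of_eq (k.dom s)) (fun r => D0Fun.of_eq (k.rel r))
    fun f => D0Fun.of_eq.{u} (k.fn f)).eq_var kx
  have h2 : D0 fun w : Fin N → ZFSet.{u} =>
      ψ.Holds PwSt (Fin.snoc (α := fun _ => ZFSet.{u}) (fun _ : Fin 1 => w kx) (w ky)) := by
    refine (D0.comp ⟨⟨ψ, fun w => Iff.rfl⟩⟩ (Fin.snoc (α := fun _ => Fin N)
      (fun _ : Fin 1 => kx) ky)).congr fun w => Iff.of_eq ?_
    congr 1
    funext i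
    match i with
    | 0 => rfl
    | 1 => rfl
  exact (inferInstance : D0 fun w : Fin N → ZFSet.{u} => _ ∧ IsOmega (w k.omega) ∧ _).out

theorem codeExpr_mem {τ : Vocab.{u}} [Finite τ.Srt] [Finite τ.Rel] [Finite τ.Fn]
    {ν : Naming τ} (hν : ν.IsNatural) (T : AdjClosed.{u}) {D : τ.Srt → ZFSet.{u}}
    {R : τ.Rel → ZFSet.{u}} {G : τ.Fn → ZFSet.{u}} (hD : ∀ s, D s ∈ T.set)
    (hR : ∀ r, R r ∈ T.set) (hG : ∀ f, G f ∈ T.set) : codeExpr ν D R G ∈ T.set := by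
  have h1 : ∀ s, ν.srt s ∈ T.set := fun s => by
    obtain ⟨n, hn⟩ := hν.1 s
    exact hn ▸ T.natCode_mem n
  have h2 : ∀ r, ν.rel r ∈ T.set := fun r => by
    obtain ⟨n, hn⟩ := hν.2.1 r
    exact hn ▸ T.natCode_mem n
  have h3 : ∀ f, ν.fn f ∈ T.set := fun f => by
    obtain ⟨n, hn⟩ := hν.2.2 f
    exact hn ▸ T.natCode_mem n
  have h4 : ∀ p, ν.profile p ∈ T.set := fun p => T.seqCode_mem fun i => h1 _
  exact T.pair_mem (T.pair_mem (T.finite_range_mem h1) (T.pair_mem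
    (T.finite_range_mem fun r => T.pair_mem (h2 r) (h4 _))
    (T.finite_range_mem fun f => T.pair_mem (h3 f) (T.pair_mem (h4 _) (h1 _)))))
    (T.pair_mem (T.finite_range_mem fun s => T.pair_mem (h1 s) (hD s)) (T.pair_mem
      (T.finite_range_mem fun r => T.pair_mem (h2 r) (hR r))
      (T.finite_range_mem fun f => T.pair_mem (h3 f) (hG f))))

/-- This set will be the sort U itself, with inclusion as key map. It is transitive, being a union
of ordinals, so its cardinality also controls the H-rank of the copy's code. -/
theorem exists_transitive_keys {ι : Type u} [Finite ι] (κ : ι → Cardinal.{u}) : ∃ s : ZFSet.{u},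
    s.IsTransitive ∧ ZFSet.range natCode.{u} ⊆ s ∧ (∀ i, (κ i).ord.toZFSet ⊆ s) ∧
      ∀ z ∈ s, z ∈ ZFSet.range natCode.{u} ∨ ∃ i, z ∈ (κ i).ord.toZFSet := by
  refine ⟨ZFSet.range natCode ∪ ZFSet.iUnion fun i => (κ i).ord.toZFSet, ?_, fun z hz => ?_,
    fun i z hz => ?_, fun z hz => ?_⟩
  · refine isTransitive_range_natCode.union fun a ha z hz => ?_
    obtain ⟨i, hi⟩ := ZFSet.mem_iUnion.1 ha
    exact ZFSet.mem_iUnion.2 ⟨i, (ZFSet.isOrdinal_toZFSet _).isTransitive _ hi hz⟩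
  · exact ZFSet.mem_union.2 (.inl hz)
  · exact ZFSet.mem_union.2 (.inr (ZFSet.mem_iUnion.2 ⟨i, hz⟩))
  · exact (ZFSet.mem_union.1 hz).imp id ZFSet.mem_iUnion.1

/-- Adjoining subsets of a transitive set as elements keeps it transitive, and κ many of them do not
raise the cardinality. -/
theorem exists_adjClosed_subsets {κ : Cardinal.{u}} (hκ : ℵ₀ ≤ κ) {s : ZFSet.{u}}
    (hs : s.IsTransitive) (hc : s.card ≤ κ) {ι : Type u} (hι : #ι ≤ κ) {f : ι → ZFSet.{u}}
    (hf : ∀ i, f i ⊆ s) :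
    ∃ T : AdjClosed.{u}, s ⊆ T.set ∧ (∀ i, f i ∈ T.set) ∧ T.set.card ≤ κ := by
  obtain ⟨T, h1, h2⟩ := exists_adjClosed hκ (s := s ∪ ZFSet.range f) (fun a ha z hz => by
    rw [ZFSet.mem_union] at *
    rcases ha with ha | ha
    · exact .inl (hs _ ha hz)
    · obtain ⟨i, rfl⟩ := ZFSet.mem_range.1 ha
      exact .inl (hf i hz))
    (ZFSet.card_union_le.trans (Cardinal.add_le_of_le hκ hc ((card_range_le _).trans hι)))
  exact ⟨T, fun z hz => h1 (ZFSet.mem_union.2 (.inl hz)),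
    fun i => h1 (ZFSet.mem_union.2 (.inr (ZFSet.mem_range.2 ⟨i, rfl⟩))), h2⟩

theorem rhoTuple_const_le {κ : Cardinal.{u}} (hκ : ℵ₀ ≤ κ) {x t : ZFSet.{u}} (ht : t.IsTransitive)
    (hx : x ⊆ t) (hc : t.card ≤ κ) : rhoTuple (fun _ : Fin 1 => x) ≤ κ :=
  max_le hκ (ciSup_le' fun _ => rhoH_le hκ ht hx hc)

/-- Passing to initial ordinals is essential: the given domains may have arbitrarily large
transitive closures, whereas the code of the copy has H-rank at most that of U's cardinality. Then F
bounds the witness by |W|, as required. -/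
theorem exists_codeAx_model {F : Cardinal.{u} → Cardinal.{u}} (hF : Monotone F)
    {E : VocabExt twoSorts.{u}} {φ : Form E.vocab} (hφ : ∀ S : Str twoSorts.{u},
      (S.dom ⟨true⟩).card ≤ F (S.dom ⟨false⟩).card → ∃ C : Str E.vocab, φ.Truth C ∧ S = C.reduct)
    {τ : Vocab.{u}} [Finite τ.Srt] [Finite τ.Rel] [Finite τ.Fn] {ν : Naming τ} (hν : ν.IsNatural)
    {N : ℕ} {k : CodeIdx τ N} {kx ky : Fin N} (hk : ∀ {X : Type (u + 1)} (D : τ.Srt → X)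
      (R : τ.Rel → X) (G : τ.Fn → X) (o x y : X), ∃ w : Fin N → X, (∀ s, w (k.dom s) = D s) ∧
        (∀ r, w (k.rel r) = R r) ∧ (∀ f, w (k.fn f) = G f) ∧ w k.omega = o ∧ w kx = x ∧
          w ky = y) {ψ : Delta0 2 (1 + 1)} {θ : Delta0 2 N}
    (hθ : ∀ w : Fin N → ZFSet.{u}, θ.Holds PwSt w ↔
      w kx = codeExpr ν (fun s => w (k.dom s)) (fun r => w (k.rel r)) (fun f => w (k.fn f)) ∧
        IsOmega (w k.omega) ∧
          ψ.Holds PwSt (Fin.snoc (α := fun _ => ZFSet.{u}) (fun _ : Fin 1 => w kx) (w ky)))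
    (A : Str τ) (e : ∀ s, A.El s ≃ {x : ZFSet.{u} // x ∈ (A.dom s).card.ord.toZFSet})
    (hA : ∃ y, rhoH y ≤ F (rhoTuple fun _ : Fin 1 => (A.transport e).code ν) ∧
      ψ.Holds PwSt (Fin.snoc (α := fun _ => ZFSet.{u})
        (fun _ : Fin 1 => (A.transport e).code ν) y)) :
    ∃ B : Str (codeExt τ E.vocab (.inl ⟨false⟩) (.inl ⟨true⟩) N).vocab,
      (CodeAx k θ B ∧ φ.Truth B.sub) ∧ A = B.reduct := by
  obtain ⟨s, hs, hωs, hDs, hs'⟩ := exists_transitive_keys fun i => (A.dom i).card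
  have hμ : ℵ₀ ≤ s.card := aleph0_le_card_range_natCode.trans (ZFSet.card_mono hωs)
  obtain ⟨T, hsT, hT⟩ := exists_adjClosed hμ hs le_rfl
  let D : τ.Srt → ZFSet.{u} := fun i => (A.dom i).card.ord.toZFSet
  let R : τ.Rel → ZFSet.{u} := fun r =>
    ZFSet.range fun t : {t // t ∈ (A.transport e).rel r} => tupleCode t.1
  let G : τ.Fn → ZFSet.{u} := fun f =>
    ZFSet.range fun t : Tuple (A.transport e).dom (τ.fnDom f) =>
      ZFSet.pair (tupleCode t) ((A.transport e).fn f t).1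
  have htup : ∀ {p} (t : Tuple (A.transport e).dom p), tupleCode t ∈ T.set := fun t =>
    T.seqCode_mem fun i => hsT (hDs _ (t i).2)
  -- The domains, relations and graphs of the copy are subsets of T but need not be elements. A
  -- second closure makes them elements, still with at most |s| elements in all.
  obtain ⟨T', hTT, hT'm, hT'⟩ := exists_adjClosed_subsets hμ T.trans hT
    (ι := τ.Srt ⊕ τ.Rel ⊕ τ.Fn) ((Cardinal.lt_aleph0_of_finite _).le.trans hμ)
    (f := Sum.elim D (Sum.elim R G)) (by
      rintro (i | r | f) z hz
      · exact hsT (hDs i hz)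
      · obtain ⟨t, rfl⟩ := ZFSet.mem_range.1 hz
        exact htup _
      · obtain ⟨t, rfl⟩ := ZFSet.mem_range.1 hz
        exact T.pair_mem (htup _) (hsT (hDs _ ((A.transport e).fn f t).2)))
  have hD' : ∀ i, D i ∈ T'.set := fun i => hT'm (.inl i)
  have hR' : ∀ i, R i ∈ T'.set := fun i => hT'm (.inr (.inl i))
  have hG' : ∀ i, G i ∈ T'.set := fun i => hT'm (.inr (.inr i))
  have hx : (A.transport e).code ν ∈ T'.set := codeExpr_mem hν T' hD' hR' hG'
  obtain ⟨y, hy, hψ⟩ := hA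
  have hFy : rhoH y ≤ F s.card := hy.trans (hF (rhoTuple_const_le hμ T'.trans (T'.trans _ hx) hT'))
  obtain ⟨hω, t₀, ht₀, hyt, hcard⟩ := rhoH_spec y
  -- The model will be ℘(t) for this union t: T' contains the code, and the witness y is a subset of
  -- t₀.
  have ht : (T'.set ∪ t₀).IsTransitive := T'.trans.union ht₀
  have hM : ∀ {a}, a ⊆ T'.set → a ∈ (T'.set ∪ t₀).powerset := fun h =>
    ZFSet.mem_powerset.2 fun z hz => ZFSet.mem_union.2 (.inl (h hz))
  have hne : (T'.set ∪ t₀).powerset.Nonempty := ⟨_, hM fun _ h => h⟩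
  have : Nonempty {x // x ∈ (T'.set ∪ t₀).powerset} := ⟨⟨_, hne.choose_spec⟩⟩
  -- U is s and W is the initial ordinal of F(|s|); the two-sorted structure satisfies the bound
  -- with equality.
  obtain ⟨C, hC, hS⟩ := hφ (twoSets (fun b => match b with
      | ⟨false⟩ => s
      | ⟨true⟩ => (F s.card).ord.toZFSet) (by
      rintro ⟨_ | _⟩
      · exact ⟨_, hωs (ZFSet.mem_range.2 ⟨0, rfl⟩)⟩
      · refine ⟨(0 : Ordinal.{u}).toZFSet, Ordinal.toZFSet_mem_toZFSet_iff.2 ?_⟩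
        exact Cardinal.ord_pos.2 (aleph0_pos.trans_le (hω.trans hFy))))
    (card_ord_toZFSet _).le
  have hU : s = C.dom (.inl ⟨false⟩) := congrArg (fun S : Str twoSorts.{u} => S.dom ⟨false⟩) hS
  have hW : (F s.card).ord.toZFSet = C.dom (.inl ⟨true⟩) :=
    congrArg (fun S : Str twoSorts.{u} => S.dom ⟨true⟩) hS
  -- The images of U and W must together cover t, so that the subsets of t are separated. U is large
  -- enough to cover T', and W to cover t₀; injectivity plays no role.
  obtain ⟨embU, hembU⟩ := exists_cover_of_card_le (a := C.dom (.inl ⟨false⟩)) (hU ▸ hT')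
    fun z => (⟨z.1, hM (T'.trans _ z.2)⟩ : {x // x ∈ (T'.set ∪ t₀).powerset})
  obtain ⟨embW, hembW⟩ := exists_cover_of_card_le (a := C.dom (.inl ⟨true⟩)) (b := t₀)
    (by rw [← hW, card_ord_toZFSet]; exact hcard.trans hFy)
    fun z => (⟨z.1, ZFSet.mem_powerset.2 fun w hw => ZFSet.mem_union.2 (.inr (ht₀ _ z.2 hw))⟩ :
      {x // x ∈ (T'.set ∪ t₀).powerset})
  let key : C.El (.inl ⟨false⟩) → {x // x ∈ (T'.set ∪ t₀).powerset} := fun x =>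
    ⟨x.1, hM (T'.trans _ (hTT (hsT (hU ▸ x.2))))⟩
  obtain ⟨cst, h1, h2, h3, h4, h5, h6⟩ := hk (X := {x // x ∈ (T'.set ∪ t₀).powerset})
    (fun i => ⟨D i, hM (T'.trans _ (hD' i))⟩) (fun i => ⟨R i, hM (T'.trans _ (hR' i))⟩)
    (fun i => ⟨G i, hM (T'.trans _ (hG' i))⟩)
    ⟨ZFSet.range natCode, hM fun z hz => hTT (hsT (hωs hz))⟩ ⟨_, hM (T'.trans _ hx)⟩
    ⟨y, ZFSet.mem_powerset.2 fun z hz => ZFSet.mem_union.2 (.inr (hyt hz))⟩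
  classical
  let val : ∀ i, {x // x ∈ (T'.set ∪ t₀).powerset} → A.El i := fun i a =>
    if h : a.1 ∈ D i then (e i).symm ⟨a.1, h⟩ else Classical.arbitrary _
  refine ⟨codeStr A C _ hne cst val embU embW key, ⟨codeAx_codeStr e ht hne
    (fun i => congrArg Subtype.val (h1 i)) (fun i => congrArg Subtype.val (h2 i))
    (fun i => congrArg Subtype.val (h3 i)) ?_ (fun i a ha => ?_) (fun z hz => ?_)
    (fun a b h => Subtype.ext (congrArg (fun x => x.1) h)) fun x => ?_, hC⟩, rfl⟩
  · rw [hθ]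
    simp only [h1, h2, h3, h4, h5, h6]
    exact ⟨rfl, isOmega_range_natCode, hψ⟩
  · exact (congrArg (fun z => (e i z).1) (dif_pos ha)).trans
      (congrArg Subtype.val ((e i).apply_symm_apply ⟨a.1, ha⟩))
  · rcases ZFSet.mem_union.1 hz with hz | hz
    · obtain ⟨x, hx⟩ := hembU ⟨z, hz⟩
      exact .inl ⟨x, congrArg Subtype.val hx⟩
    · obtain ⟨x, hx⟩ := hembW ⟨z, hz⟩
      exact .inr ⟨x, congrArg Subtype.val hx⟩
  · rw [h4]
    exact hs' _ (hU ▸ x.2)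

end BddSymb

namespace BddSymb

open Cardinal

/-! ## Bounded symbiosis -/

theorem range_pair_injective {ι : Type u} (f : ι ↪ ZFSet.{u}) {g h : ι → ZFSet.{u}}
    (H : (ZFSet.range fun i => ZFSet.pair (f i) (g i)) = ZFSet.range fun i => ZFSet.pair (f i) (h i)) :
    g = h := by
  funext i
  obtain ⟨j, hj⟩ := ZFSet.mem_range.1 (H ▸ ZFSet.mem_range.2 ⟨i, rfl⟩ :
    ZFSet.pair (f i) (g i) ∈ ZFSet.range fun i => ZFSet.pair (f i) (h i))
  obtain ⟨h1, h2⟩ := ZFSet.pair_inj.1 hj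
  rw [← h2, f.injective h1]

theorem Str.code_injective {τ : Vocab.{u}} (ν : Naming τ) :
    Function.Injective fun A : Str τ => A.code ν := by
  rintro ⟨d, hd, r, f⟩ ⟨d', hd', r', f'⟩ h
  obtain ⟨-, h⟩ := ZFSet.pair_inj.1 h
  obtain ⟨h1, h⟩ := ZFSet.pair_inj.1 h
  obtain ⟨h2, h3⟩ := ZFSet.pair_inj.1 h
  obtain rfl : d = d' := range_pair_injective ν.srt h1
  have h2 := range_pair_injective ν.rel h2
  have h3 := range_pair_injective ν.fn h3
  obtain rfl : r = r' := by
    funext i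
    ext t
    have h4 : ∀ q : ∀ i, Set (Tuple d (τ.relDom i)),
        tupleCode t ∈ (ZFSet.range fun t : {t // t ∈ q i} => tupleCode t.1) ↔ t ∈ q i := by
      intro q
      rw [ZFSet.mem_range]
      exact ⟨fun ⟨t', h⟩ => tupleCode_inj.1 h ▸ t'.2, fun h => ⟨⟨t, h⟩, rfl⟩⟩
    exact (h4 r).symm.trans ((Iff.of_eq (congrArg (tupleCode t ∈ ·) (congrFun h2 i))).trans (h4 r'))
  obtain rfl : f = f' := by
    funext i t
    have h4 : ZFSet.pair (tupleCode t) (f i t).1 ∈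
        ZFSet.range fun t : Tuple d (τ.fnDom i) => ZFSet.pair (tupleCode t) (f' i t).1 :=
      (congrFun h3 i) ▸ ZFSet.mem_range.2 ⟨t, rfl⟩
    obtain ⟨t', h5⟩ := ZFSet.mem_range.1 h4
    obtain ⟨h6, h7⟩ := ZFSet.pair_inj.1 h5
    exact Subtype.ext (tupleCode_inj.1 h6 ▸ h7.symm)
  rfl

theorem classRel_code {τ : Vocab.{u}} (ν : Naming τ) (K : Str τ → Prop) (A : Str τ) :
    ClassRel ν K (fun _ => A.code ν) ↔ K A :=
  ⟨fun ⟨B, hB, h⟩ => (Str.code_injective ν h : A = B) ▸ hB, fun h => ⟨A, h, rfl⟩⟩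

/-- Only the values of `P` on codes matter. So the lemma applies to the complement too, although the
negation of `ClassRel` also holds of sets that are not codes. -/
theorem isSigmaB_of_isSigma1 {F : Cardinal.{u} → Cardinal.{u}} (hF : DefinablyBounding F)
    {τ : Vocab.{u}} [Finite τ.Srt] [Finite τ.Rel] [Finite τ.Fn] {ν : Naming τ} (hν : ν.IsNatural)
    {K : Str τ → Prop} (hK : ClosedUnderIso K) {P : (Fin 1 → ZFSet.{u}) → Prop}
    (hP : IsSigma1 PwSt F P) (hKP : ∀ A, P (fun _ => A.code ν) ↔ K A) : IsSigmaB L2.{u} K := by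
  obtain ⟨hmono, E, ⟨φ, _, hφ⟩, h1, h2⟩ := hF
  obtain ⟨ψ, hψ, hψ'⟩ := hP
  obtain ⟨N, k, kx, ky, hk⟩ := exists_codeIdx τ
  obtain ⟨θ, hθ⟩ := exists_code_formula hν k kx ky ψ
  obtain ⟨χ, hχ, hχ'⟩ := 
    exists_codeAx_sentence (ε := E.vocab) (U := .inl ⟨false⟩) (W := .inl ⟨true⟩) k θ hφ
  refine ⟨codeExt τ E.vocab (.inl ⟨false⟩) (.inl ⟨true⟩) N, ⟨χ, hχ⟩, fun A => ⟨fun hA => ?_, ?_⟩,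
    fun A => ?_⟩
  · let e : ∀ s, A.El s ≃ {x : ZFSet.{u} // x ∈ (A.dom s).card.ord.toZFSet} := fun s =>
      (exists_equiv_of_card_eq (card_ord_toZFSet _).symm).some
    -- Closure under isomorphism puts the copy on initial ordinals into the class, which gives a
    -- bounded witness for its code.
    obtain ⟨B, hB, hAB⟩ := exists_codeAx_model hmono (fun S => (h1 S).1) hν hk hθ A e
      (hψ' _ ((hKP _).2 (hK _ _ ⟨A.transportIso e⟩ hA)))
    exact ⟨B, (hχ' B).2 hB, hAB⟩
  · rintro ⟨B, hB, rfl⟩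
    obtain ⟨hB, -⟩ := (hχ' B).1 hB
    obtain ⟨c, hc⟩ := hB.exists_collapse
    obtain ⟨e, he⟩ := hB.exists_transport ν hc
    obtain ⟨h3, -, h4⟩ := (hθ _).1 ((hc.holdsE_iff hB.correct θ _).1 hB.holds)
    -- The collapsed constant is a real witness, whatever its size: the bound on witnesses is needed
    -- only to build expansions.
    have h5 := (hψ _).2 ⟨_, h4⟩
    simp only [h3, ← he] at h5
    exact hK _ _ ⟨(B.reduct.transportIso e).symm⟩ ((hKP _).1 h5)
  · obtain ⟨c, hc⟩ := exists_bound_of_codeAx hmono hφ (fun C hC => (h1 C.reduct).2 ⟨C, hC, rfl⟩) h2 k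
      (fun w hw => ((hθ w).1 hw).2.1) A
    exact ⟨c, fun B hB hA => hc B ((hχ' B).1 hB).1 ((hχ' B).1 hB).2 hA⟩

theorem isDeltaB_of_isDelta1 {F : Cardinal.{u} → Cardinal.{u}} (hF : DefinablyBounding F)
    {τ : Vocab.{u}} [Finite τ.Srt] [Finite τ.Rel] [Finite τ.Fn] {ν : Naming τ} (hν : ν.IsNatural)
    {K : Str τ → Prop} (hK : ClosedUnderIso K) (h : IsDelta1 PwSt F (ClassRel ν K)) :
    IsDeltaB L2.{u} K :=
  ⟨isSigmaB_of_isSigma1 hF hν hK h.1 fun A => classRel_code ν K A,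
    isSigmaB_of_isSigma1 hF hν (fun A B ⟨i⟩ hA hB => hA (hK _ _ ⟨i.symm⟩ hB)) h.2
      fun A => not_congr (classRel_code ν K A)⟩

end BddSymb

end

theorem proposition5p3 :
    BddSymb.BoundedlySymbiotic BddSymb.L2.{u} BddSymb.PwSt ∧
    (BddSymb.DefinablyBounding (fun α : Cardinal.{u} => 2 ^ (2 ^ α : Cardinal.{u})) ∧
      BddSymb.IsDelta1 BddSymb.PwSt (fun α : Cardinal.{u} => 2 ^ (2 ^ α : Cardinal.{u}))
        (BddSymb.SatRel BddSymb.L2.{u})) ∧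
    BddSymb.IsAxiomatisable BddSymb.L2.{u} (BddSymb.QClass.{u} BddSymb.PwSt) := by
  exact ⟨⟨⟨_, BddSymb.definablyBounding_two_power, BddSymb.isDelta1_satRel_L2⟩,
      fun F hF τ _ _ _ ν hν K hK h => BddSymb.isDeltaB_of_isDelta1 hF hν hK h⟩,
    ⟨BddSymb.definablyBounding_two_power, BddSymb.isDelta1_satRel_L2⟩,
    BddSymb.isAxiomatisable_qClass⟩
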